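/- Let $d\ge 1$ and let $\Omega\subset\mathbb{R}^d$ be a bounded open set whose boundary is of class $C^{3,r}$ for some $r\in(0,1)$. Let $\mu$ be a finite measure on $\Omega$, equivalent to Lebesgue measure on $\Omega$, such that the logarithm of its Radon–Nikodym derivative is bounded. Let $\mathcal{H}^p$ be the space of $f\in L^2(\Omega,\mu)$ whose weak derivatives of order at most $p$ all lie in $L^2(\mu)$, with norm $\sum_{|\alpha|\le p}\|D_\alpha f\|_{L^2(\mu)}$; let $\mathcal{H}^1_0$ be the closure of $C_c^\infty(\Omega)$ in $\mathcal{H}^1$, and $\mathcal{H}^2_{(0)}=\mathcal{H}^2\cap\mathcal{H}^1_0$ with the $\mathcal{H}^2$ norm. Let $\mathcal{A}=\sum_{|\alpha|\le 2}a_\alpha(x)D_\alpha$ be a linear differential operator with measurable coefficients such that, for some $k>0$ and all $f_1,f_2\in\mathcal{H}^2$, for a.e. $x\in\Omega$, $$|\mathcal{A}f_1(x)-\mathcal{A}f_2(x)|\le k\sum_{|\alpha|\le 2}|D_\alpha f_1(x)-D_\alpha f_2(x)| .$$ Let $\eta\in C^3_b(\mathbb{R}^d)$ satisfy $\eta>0$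 in $\Omega$, $\eta=0$ on $\partial\Omega$ and $\nabla\eta\neq0$ on $\partial\Omega$. Let $\sigma\in C^4_b(\mathbb{R})$ be non-constant. Let $(c,w,b)$ be a random vector in $\mathbb{R}\times\mathbb{R}^d\times\mathbb{R}$ such that $|c|<K_0$ almost surely for some constant $K_0$, $\mathbb{E}[c]=0$, $\mathbb{P}((w,b)\in D)>0$ for every non-empty open $D\subseteq\mathbb{R}^{d+1}$, $\mathbb{E}[|w_k|^4]<\infty$ for $k=1,\dots,d$, and $\mathbb{E}[|b|]<\infty$. Put $$U(x,y)=\mathbb{E}\Big[\nabla_{c,w,b}\,\mathcal{A}[\eta(x)c\,\sigma(w\cdot x+b)]\cdot\nabla_{c,w,b}[\eta(y)c\,\sigma(w\cdot y+b)]\Big],\qquad \mathcal{U}f(y)=\int_\Omega f(x)U(x,y)\,d\mu(x),$$ where $\mathcal{A}$ acts in the variable $x$. Let $g\in L^2(\mu)$, and let the wide-limit network $(Q_t)_{t\ge0}$ be the solution in $\mathcal{H}^2_{(0)}$ of $$\frac{dQ_t}{dt}=-\mathcal{U}[\mathcal{A}Q_t-g],\qquad Q_0=0 .$$ Theorem (Convergence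 of $Q_t$ under DGM). Suppose that $\mathcal{A}$ has a bounded inverse, i.e. there is a constant $k>0$ such that for every $h\in L^2(\mu)$ the Dirichlet problem $\mathcal{A}v=h$ in $\Omega$, $v=0$ on $\partial\Omega$, has a unique solution $v\in\mathcal{H}^2_{(0)}$, and $\|v\|_{L^2(\mu)}\le k\|h\|_{L^2(\mu)}$. Then $Q_t$ converges to the solution $u\in\mathcal{H}^2_{(0)}$ of $\mathcal{A}u=g$: $$\lim_{t\to\infty}\|Q_t-u\|_{L^2(\mu)}=0 .$$ -/

import Mathlib

open MeasureTheory Filter Topology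
open scoped NNReal ENNReal ContDiff

noncomputable section

namespace DGM

/-- The Euclidean space `ℝ^d`. -/
abbrev Sp (d : ℕ) := EuclideanSpace ℝ (Fin d)

/-- Indices of partial derivatives of order at most `p`: a word `(i₁, …, i_k)` of coordinate
directions with `k ≤ p` stands for `∂_{i₁} ⋯ ∂_{i_k}`. -/
abbrev Idx (d p : ℕ) := (k : Fin (p + 1)) × (Fin k → Fin d)

/-- The empty word (no derivative). -/
def idx0 (d p : ℕ) : Idx d p := ⟨0, fun m => m.elim0⟩

/-- The classical partial derivative `D_α f (x)`. -/
def partialD {d p : ℕ} (α : Idx d p) (f : Sp d → ℝ) (x : Sp d) : ℝ :=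
  iteratedFDeriv ℝ (α.1 : ℕ) f x (fun m => EuclideanSpace.single (α.2 m) (1 : ℝ))

/-- `φ ∈ C_c^∞(Ω)`. -/
def IsTestFunction {d : ℕ} (Ω : Set (Sp d)) (φ : Sp d → ℝ) : Prop :=
  ContDiff ℝ ∞ φ ∧ HasCompactSupport φ ∧ tsupport φ ⊆ Ω

/-- `h` is the weak derivative `D_α f` on `Ω`. -/
def HasWeakDeriv {d p : ℕ} (Ω : Set (Sp d)) (α : Idx d p) (f h : Sp d → ℝ) : Prop :=
  ∀ φ : Sp d → ℝ, IsTestFunction Ω φ →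
    ∫ x in Ω, f x * partialD α φ x = (-1 : ℝ) ^ (α.1 : ℕ) * ∫ x in Ω, h x * φ x

/-- `f ∈ C_b^k`: `k` times continuously differentiable, with `f` and all its derivatives up to
order `k` bounded. -/
def IsCb {F : Type*} [NormedAddCommGroup F] [NormedSpace ℝ F] (k : ℕ) (f : F → ℝ) : Prop :=
  ContDiff ℝ k f ∧ ∀ j ≤ k, ∃ C : ℝ, ∀ x, ‖iteratedFDeriv ℝ j f x‖ ≤ C

/-- The boundary of `Ω` is of class `C^{k,r}`: near each of its points, after relabelling and
reorienting the coordinate axes, `Ω` is the region strictly above the graph of a `C^{k,r}` function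
`γ` of the other coordinates (that is, `γ` does not depend on the coordinate `i`). -/
def HasHolderBoundary {d : ℕ} (Ω : Set (Sp d)) (k : ℕ) (r : ℝ≥0) : Prop :=
  ∀ x₀ ∈ frontier Ω, ∃ ρ : ℝ, 0 < ρ ∧ ∃ (i : Fin d) (s : ℝ) (γ : Sp d → ℝ),
    (s = 1 ∨ s = -1) ∧
    (∀ (x : Sp d) (τ : ℝ), γ (x + EuclideanSpace.single i τ) = γ x) ∧
    ContDiff ℝ k γ ∧ (∃ C : ℝ≥0, HolderWith C r (iteratedFDeriv ℝ k γ)) ∧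
    ∀ x ∈ Metric.ball x₀ ρ, (x ∈ Ω ↔ γ x < s * x i)

/-- `μ` is a finite measure on `Ω`, equivalent to Lebesgue measure on `Ω`, and the logarithm of its
Radon-Nikodym derivative is (essentially) bounded. -/
structure IsSamplingMeasure {d : ℕ} (Ω : Set (Sp d)) (μ : Measure (Sp d)) : Prop where
  finite : IsFiniteMeasure μ
  ac : μ ≪ volume.restrict Ω
  ac' : volume.restrict Ω ≪ μ
  log_bdd : ∃ C : ℝ, ∀ᵐ x ∂(volume.restrict Ω),
    |Real.log (μ.rnDeriv (volume.restrict Ω) x).toReal| ≤ C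

/-- Families `(u_α)`, `α` of order at most `p`, in `L²(μ)`, with norm `∑_α ‖u_α‖_{L²(μ)}`. -/
abbrev Jet {d : ℕ} (p : ℕ) (μ : Measure (Sp d)) := PiLp 1 (fun _ : Idx d p => Lp ℝ 2 μ)

/-- The underlying `L²` function of a jet. -/
def Jet.fn {d p : ℕ} {μ : Measure (Sp d)} (u : Jet p μ) : Lp ℝ 2 μ := u (idx0 d p)

/-- The Sobolev space `H^p(Ω)`. A function `u ∈ H^p` is represented by the family `(D_α u)` of its
weak derivatives of order at most `p`, which it determines; the norm inherited from `Jet p μ` is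
`∑_α ‖D_α u‖_{L²(μ)}`. -/
def sobolev {d : ℕ} (p : ℕ) (Ω : Set (Sp d)) (μ : Measure (Sp d)) : Set (Jet p μ) :=
  {u | ∀ α : Idx d p, HasWeakDeriv Ω α (u.fn : Sp d → ℝ) (u α : Sp d → ℝ)}

/-- `H^1_0(Ω)`: the closure of `C_c^∞(Ω)` in the `H^1` norm. -/
def sobolevOneZero {d : ℕ} (Ω : Set (Sp d)) (μ : Measure (Sp d)) : Set (Jet 1 μ) :=
  closure {v | ∃ φ : Sp d → ℝ, IsTestFunction Ω φ ∧
    ∀ α : Idx d 1, (v α : Sp d → ℝ) =ᵐ[μ] partialD α φ}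

/-- The part of order at most one of a second order jet (the inclusion `H² ⊆ H¹`). -/
def Jet.toOne {d : ℕ} {μ : Measure (Sp d)} (u : Jet 2 μ) : Jet 1 μ :=
  WithLp.toLp 1 (fun α : Idx d 1 => u ⟨Fin.castLE (by norm_num) α.1, α.2⟩)

/-- `H²_{(0)} = H² ∩ H^1_0`. -/
def sobolevZero {d : ℕ} (Ω : Set (Sp d)) (μ : Measure (Sp d)) : Set (Jet 2 μ) :=
  {u | u ∈ sobolev 2 Ω μ ∧ u.toOne ∈ sobolevOneZero Ω μ}

/-- The coefficients `a_α` of a linear differential operator `𝒜 = ∑_{|α| ≤ 2} a_α(x) D_α`. -/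
abbrev Coeff (d : ℕ) := Idx d 2 → Sp d → ℝ

/-- `𝒜 u` for `u ∈ H²`. -/
def opWeak {d : ℕ} {μ : Measure (Sp d)} (a : Coeff d) (u : Jet 2 μ) (x : Sp d) : ℝ :=
  ∑ α : Idx d 2, a α x * (u α : Sp d → ℝ) x

/-- `𝒜 f` for a classical `C²` function `f`. -/
def opClassical {d : ℕ} (a : Coeff d) (f : Sp d → ℝ) (x : Sp d) : ℝ :=
  ∑ α : Idx d 2, a α x * partialD α f x

/-- The Lipschitz condition on `𝒜`. -/
def OpLipschitz {d : ℕ} (Ω : Set (Sp d)) (μ : Measure (Sp d)) (a : Coeff d) : Prop :=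
  ∃ k : ℝ, 0 < k ∧ ∀ f₁ ∈ sobolev 2 Ω μ, ∀ f₂ ∈ sobolev 2 Ω μ, ∀ᵐ x ∂μ,
    |opWeak a f₁ x - opWeak a f₂ x| ≤
      k * ∑ α : Idx d 2, |(f₁ α : Sp d → ℝ) x - (f₂ α : Sp d → ℝ) x|

/-- `𝒜` has a bounded inverse: the Dirichlet problem `𝒜 u = h` in `Ω`, `u = 0` on `∂Ω`, has for
every `h ∈ L²` a unique solution in `H²_{(0)}`, and `‖u‖_{L²(μ)} ≤ k ‖h‖_{L²(μ)}`. -/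
def HasBoundedInverse {d : ℕ} (Ω : Set (Sp d)) (μ : Measure (Sp d)) (a : Coeff d) : Prop :=
  ∃ k : ℝ, 0 < k ∧ ∀ h : Lp ℝ 2 μ, ∃ u ∈ sobolevZero Ω μ,
    opWeak a u =ᵐ[μ] h ∧ ‖u.fn‖ ≤ k * ‖h‖ ∧
    ∀ v ∈ sobolevZero Ω μ, opWeak a v =ᵐ[μ] h → v = u

/-- The auxiliary function `η`. Since `η = 0` on `∂Ω`, its gradient there is normal to `∂Ω`, so that
the last condition says that the normal derivative does not vanish. -/
structure IsAuxiliary {d : ℕ} (Ω : Set (Sp d)) (η : Sp d → ℝ) : Prop where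
  smooth : IsCb 3 η
  pos : ∀ x ∈ Ω, 0 < η x
  zero : ∀ x ∈ frontier Ω, η x = 0
  deriv_ne : ∀ x ∈ frontier Ω, fderiv ℝ η x ≠ 0

/-- Parameters `(c, w, b)` of one hidden unit. -/
abbrev Param (d : ℕ) := ℝ × Sp d × ℝ

/-- The conditions on the common law `P` of the initial parameters `(c, w, b)` of the hidden
units. -/
structure IsInitialLaw {d : ℕ} (P : Measure (Param d)) : Prop where
  prob : IsProbabilityMeasure P
  c_bdd : ∃ K : ℝ, ∀ᵐ θ ∂P, |θ.1| < K
  c_mean : ∫ θ, θ.1 ∂P = 0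
  full_support : ∀ D : Set (Sp d × ℝ), IsOpen D → D.Nonempty → 0 < P {θ | θ.2 ∈ D}
  w_moment : ∀ k : Fin d, Integrable (fun θ : Param d => |θ.2.1 k| ^ 4) P
  b_moment : Integrable (fun θ : Param d => |θ.2.2|) P

/-- One hidden unit times `η`: `x ↦ η(x) c σ(w · x + b)`. -/
def unit {d : ℕ} (η : Sp d → ℝ) (σ : ℝ → ℝ) (θ : Param d) (x : Sp d) : ℝ :=
  η x * (θ.1 * σ (inner ℝ θ.2.1 x + θ.2.2))

/-- `∇_{c,w,b} F · ∇_{c,w,b} G` at `θ`. -/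
def gradDot {d : ℕ} (F G : Param d → ℝ) (θ : Param d) : ℝ :=
  fderiv ℝ F θ (1, 0, 0) * fderiv ℝ G θ (1, 0, 0)
    + ∑ k : Fin d, fderiv ℝ F θ (0, EuclideanSpace.single k 1, 0)
        * fderiv ℝ G θ (0, EuclideanSpace.single k 1, 0)
    + fderiv ℝ F θ (0, 0, 1) * fderiv ℝ G θ (0, 0, 1)

/-- The kernel
`U(x, y) = 𝔼 [∇_{c,w,b} 𝒜[η(x) c σ(w · x + b)] · ∇_{c,w,b} [η(y) c σ(w · y + b)]]`. -/
def kernelU {d : ℕ} (a : Coeff d) (η : Sp d → ℝ) (σ : ℝ → ℝ) (P : Measure (Param d))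
    (x y : Sp d) : ℝ :=
  ∫ θ, gradDot (fun θ' => opClassical a (unit η σ θ') x) (fun θ' => unit η σ θ' y) θ ∂P

/-- The integral operator `(𝒰 f)(y) = ∫ f(x) U(x, y) dμ(x)`. -/
def opU {d : ℕ} (μ : Measure (Sp d)) (a : Coeff d) (η : Sp d → ℝ) (σ : ℝ → ℝ)
    (P : Measure (Param d)) (f : Sp d → ℝ) (y : Sp d) : ℝ :=
  ∫ x, f x * kernelU a η σ P x y ∂μ

/-- `Q` is a wide-limit network: a solution on `[0, ∞)`, in the space `H²_{(0)}` with its norm, of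
`dQ_t/dt = - 𝒰 [𝒜 Q_t - g]`, `Q_0 = 0`. -/
structure IsWideLimit {d : ℕ} (Ω : Set (Sp d)) (μ : Measure (Sp d)) (a : Coeff d)
    (η : Sp d → ℝ) (σ : ℝ → ℝ) (P : Measure (Param d)) (g : Lp ℝ 2 μ) (Q : ℝ → Jet 2 μ) :
    Prop where
  init : Q 0 = 0
  mem : ∀ t, 0 ≤ t → Q t ∈ sobolevZero Ω μ
  ode : ∀ t, 0 ≤ t → ∃ V ∈ sobolevZero Ω μ,
    (V.fn : Sp d → ℝ) =ᵐ[μ] (fun y => - opU μ a η σ P (fun x => opWeak a (Q t) x - g x) y) ∧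
    HasDerivWithinAt Q V (Set.Ici 0) t

end DGM

end

open MeasureTheory Filter Topology
open scoped NNReal ENNReal ContDiff InnerProductSpace FourierTransform

/-! The argument follows the residual `h_t = 𝒜 Q_t - g` in `L²(μ)` instead of `Q_t` itself. Applying
`𝒜` to the evolution equation gives `h' = -S h` with `S = 𝒜 𝒰` a bounded operator on `L²(μ)`.
Writing `J_m(θ)` for the derivative of a hidden unit in the parameter direction `m`, Fubini gives
`⟪S f, f'⟫ = 𝔼 ∑_m ⟪𝒜 J_m, f⟫ ⟪𝒜 J_m, f'⟫` (`exists_network_operator`), so `S` is symmetric and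
nonnegative. If `S` is also injective, its range is dense. The flow is a contraction, and along a
trajectory started in the range the norm decays like `t^(-1/2)`. Hence `h_t → 0` for every initial
value (`tendsto_zero_of_flow`). Since `𝒜 (Q_t - u) = h_t`, the bounded inverse turns this into
convergence of `Q_t` to `u`.

The substance is injectivity. If `S f = 0`, then `f` is orthogonal to `𝒜[η σ(w · x + b)]` for almost
every parameter, hence by continuity and full support for every `(w, b)`. Two density statements in
dual form then show that `f` is orthogonal to `𝒜 v` for all `v ∈ H²_{(0)}`. By solvability of the
Dirichlet problem these `𝒜 v` exhaust `L²(μ)`, so `f = 0`.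

The first density statement (`integral_partialD_eq_zero_of_ridge`) says that a second order
functional vanishing on all ridge functions vanishes on `C_c²`. After mollification of `σ`,
differentiating `n` times in the dilation at `0` isolates the `n`-th moment in direction `w` times
an `n`-th derivative. A bounded nonconstant function is not a polynomial, so all moments vanish,
hence all exponentials are annihilated, and Fourier inversion finishes.

The second (`Annihilates.integral_jetForm_eq_zero`) says that a functional vanishing on all `η φ`
with `φ ∈ C_c²` vanishes on `H²_{(0)}`. A partition of unity localizes the problem. Inside `Ω` one
mollifies and divides by `η`. Near the boundary a volume preserving shear flattens `∂Ω`, odd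
reflection extends the function to `H²` of the whole space, and mollification by a radial kernel
keeps it odd. The result vanishes on the hyperplane, so it is the normal coordinate times a `C²`
function. Since `η` is the normal coordinate times a nonvanishing `C²` function, the quotient by `η`
is an admissible `φ`. Only weak convergence of the mollifications is needed, because the functional
is given by `L²` functions. -/

namespace DGM

/-! ### Gradient-type flows of nonnegative symmetric operators -/

section HilbertFlow

variable {G : Type*} [NormedAddCommGroup G] [InnerProductSpace ℝ G]

/-- Along a solution of `h' = -S h` with `S` nonnegative, the norm is nonincreasing. -/
theorem norm_sq_antitone_of_flow {S : G →L[ℝ] G} (hpos : ∀ x, 0 ≤ ⟪S x, x⟫_ℝ) {h : ℝ → G}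
    (hh : ∀ t, 0 ≤ t → HasDerivWithinAt h (-(S (h t))) (Set.Ici 0) t) :
    AntitoneOn (fun t => ‖h t‖ ^ 2) (Set.Ici 0) := by
  have hd : ∀ t, 0 ≤ t → HasDerivWithinAt (fun t => ‖h t‖ ^ 2)
      (2 * ⟪h t, -(S (h t))⟫_ℝ) (Set.Ici 0) t := fun t ht => (hh t ht).norm_sq
  refine antitoneOn_of_deriv_nonpos (convex_Ici 0)
    (fun t ht => (hd t ht).continuousWithinAt) ?_ ?_
  · intro t ht
    rw [interior_Ici] at ht ⊢
    exact ((hd t ht.le).mono Set.Ioi_subset_Ici_self).differentiableWithinAt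
  · intro t ht
    rw [interior_Ici] at ht
    rw [((hd t (le_of_lt ht)).hasDerivAt (Ici_mem_nhds ht)).deriv, inner_neg_right,
      real_inner_comm]
    have := hpos (h t)
    linarith

theorem norm_le_of_flow {S : G →L[ℝ] G} (hpos : ∀ x, 0 ≤ ⟪S x, x⟫_ℝ) {h : ℝ → G}
    (hh : ∀ t, 0 ≤ t → HasDerivWithinAt h (-(S (h t))) (Set.Ici 0) t) {t : ℝ} (ht : 0 ≤ t) :
    ‖h t‖ ≤ ‖h 0‖ := by
  have := norm_sq_antitone_of_flow hpos hh (Set.mem_Ici.2 le_rfl) (Set.mem_Ici.2 ht) ht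
  exact le_of_sq_le_sq this (norm_nonneg _)

/-- For a nonnegative symmetric operator, `‖S x‖² ≤ ‖S‖ ⟪S x, x⟫`. -/
theorem norm_sq_apply_le {S : G →L[ℝ] G} (hsym : ∀ x y, ⟪S x, y⟫_ℝ = ⟪x, S y⟫_ℝ)
    (hpos : ∀ x, 0 ≤ ⟪S x, x⟫_ℝ) (x : G) : ‖S x‖ ^ 2 ≤ ‖S‖ * ⟪S x, x⟫_ℝ := by
  -- Nonnegativity of the form at `x + τ • S x`, with the quadratic coefficient `⟪S (S x), S x⟫`
  -- replaced by its upper bound; the claim is the discriminant condition divided by `‖S x‖²`.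
  have key : ∀ τ : ℝ, 0 ≤ ‖S‖ * ‖S x‖ ^ 2 * (τ * τ) + (2 * ‖S x‖ ^ 2) * τ + ⟪S x, x⟫_ℝ := by
    intro τ
    have h0 := hpos (x + τ • S x)
    have h1 : ⟪S (S x), S x⟫_ℝ ≤ ‖S‖ * ‖S x‖ ^ 2 :=
      (real_inner_le_norm _ _).trans (by
        have := mul_le_mul_of_nonneg_right (S.le_opNorm (S x)) (norm_nonneg (S x))
        linarith [sq (‖S x‖)])
    simp only [map_add, map_smul, inner_add_left, inner_add_right, inner_smul_left,
      inner_smul_right, real_inner_self_eq_norm_sq, hsym (S x) x, RCLike.conj_to_real] at h0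
    nlinarith [mul_self_nonneg τ]
  have hdis := discrim_le_zero key
  unfold discrim at hdis
  by_cases hx : ‖S x‖ ^ 2 = 0
  · rw [hx]; exact mul_nonneg (norm_nonneg _) (hpos x)
  · have hx' : 0 < ‖S x‖ ^ 2 := lt_of_le_of_ne (sq_nonneg _) (Ne.symm hx)
    nlinarith

/-- Along the flow, `S h_t → 0` with rate `t ‖S h_t‖² ≤ ‖S‖ ‖h_0‖²`. -/
theorem mul_norm_sq_apply_flow_le {S : G →L[ℝ] G} (hsym : ∀ x y, ⟪S x, y⟫_ℝ = ⟪x, S y⟫_ℝ)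
    (hpos : ∀ x, 0 ≤ ⟪S x, x⟫_ℝ) {h : ℝ → G}
    (hh : ∀ t, 0 ≤ t → HasDerivWithinAt h (-(S (h t))) (Set.Ici 0) t) {t : ℝ} (ht : 0 ≤ t) :
    2 * t * ‖S (h t)‖ ^ 2 ≤ ‖S‖ * ‖h 0‖ ^ 2 := by
  have hS : ∀ t, 0 ≤ t → HasDerivWithinAt (fun t => S (h t)) (-(S (S (h t)))) (Set.Ici 0) t := by
    intro t ht
    have := S.hasFDerivAt.comp_hasDerivWithinAt t (hh t ht)
    rwa [map_neg] at this
  have hmono := norm_sq_antitone_of_flow hpos hS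
  -- A Lyapunov function with the final time `t` frozen. It decreases because `‖S h_s‖` is itself
  -- nonincreasing (`S h` solves the same equation), so `‖S h_t‖² ≤ ‖S h_s‖² ≤ ‖S‖ ⟪S h_s, h_s⟫` for
  -- `s ≤ t`.
  let F : ℝ → ℝ := fun s => ‖S‖ * ‖h s‖ ^ 2 + 2 * s * ‖S (h t)‖ ^ 2
  have hd : ∀ s, 0 ≤ s → HasDerivWithinAt F
      (‖S‖ * (2 * ⟪h s, -(S (h s))⟫_ℝ) + 2 * 1 * ‖S (h t)‖ ^ 2) (Set.Ici 0) s := fun s hs =>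
    ((hh s hs).norm_sq.const_mul _).add
      (((hasDerivWithinAt_id s _).const_mul 2).mul_const _)
  have hF : AntitoneOn F (Set.Icc 0 t) := by
    refine antitoneOn_of_deriv_nonpos (convex_Icc 0 t)
      (fun s hs => ((hd s hs.1).continuousWithinAt).mono Set.Icc_subset_Ici_self) ?_ ?_
    · intro s hs
      rw [interior_Icc] at hs ⊢
      exact ((hd s hs.1.le).mono (fun r hr => Set.mem_Ici.2 hr.1.le)).differentiableWithinAt
    · intro s hs
      rw [interior_Icc] at hs
      rw [((hd s hs.1.le).hasDerivAt (Ici_mem_nhds hs.1)).deriv, inner_neg_right,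
        real_inner_comm]
      have h1 := norm_sq_apply_le hsym hpos (h s)
      have h2 := hmono (Set.mem_Ici.2 hs.1.le) (Set.mem_Ici.2 ht) hs.2.le
      simp only at h2
      linarith
  have := hF (Set.left_mem_Icc.2 ht) (Set.right_mem_Icc.2 ht) ht
  simp only [F] at this
  have h3 : 0 ≤ ‖S‖ * ‖h t‖ ^ 2 := by positivity
  linarith

/-- A symmetric injective operator has dense range. -/
theorem dense_range_of_symmetric_injective [CompleteSpace G] {S : G →L[ℝ] G}
    (hsym : ∀ x y, ⟪S x, y⟫_ℝ = ⟪x, S y⟫_ℝ) (hinj : ∀ x, S x = 0 → x = 0) :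
    Dense (Set.range S) := by
  have h : (LinearMap.range (S : G →ₗ[ℝ] G)).topologicalClosure = ⊤ := by
    rw [Submodule.topologicalClosure_eq_top_iff, Submodule.eq_bot_iff]
    intro x hx
    apply hinj
    -- Testing with `S (S x)` and moving one `S` across gives `‖S x‖² = 0`.
    have := (Submodule.mem_orthogonal _ _).1 hx (S (S x)) ⟨S x, rfl⟩
    rw [hsym, real_inner_self_eq_norm_sq] at this
    simpa using this
  rw [← Submodule.dense_iff_topologicalClosure_eq_top] at h
  exact h

/-- Solutions of `h' = -S h` with `S` symmetric, nonnegative and injective converge to zero. -/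
theorem tendsto_zero_of_flow [CompleteSpace G] {S : G →L[ℝ] G}
    (hsym : ∀ x y, ⟪S x, y⟫_ℝ = ⟪x, S y⟫_ℝ) (hpos : ∀ x, 0 ≤ ⟪S x, x⟫_ℝ)
    (hinj : ∀ x, S x = 0 → x = 0) {h : ℝ → G}
    (hh : ∀ t, 0 ≤ t → HasDerivWithinAt h (-(S (h t))) (Set.Ici 0) t) :
    Tendsto (fun t => ‖h t‖) atTop (𝓝 0) := by
  rw [Metric.tendsto_atTop]
  intro ε hε
  obtain ⟨_, ⟨v, rfl⟩, hv⟩ := (dense_range_of_symmetric_injective hsym hinj).exists_dist_lt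
    (h 0) (half_pos hε)
  -- Compare `h` with the trajectory `S (V t)` started at the nearby point `S v`. The difference
  -- again solves the flow, so it stays below `ε / 2` by contraction, while `S (V t)` decays with a
  -- rate.
  let V : ℝ → G := fun t => NormedSpace.exp (t • (-S)) v
  have hV : ∀ t, HasDerivAt V (-(S (V t))) t := by
    intro t
    have := (hasDerivAt_exp_smul_const' (𝕂 := ℝ) (-S) t).clm_apply (hasDerivAt_const t v)
    simpa [V] using this
  have hV0 : V 0 = v := by simp [V]
  have hVw : ∀ t, 0 ≤ t → HasDerivWithinAt V (-(S (V t))) (Set.Ici 0) t :=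
    fun t _ => (hV t).hasDerivWithinAt
  have hr : ∀ t, 0 ≤ t → HasDerivWithinAt (fun t => h t - S (V t))
      (-(S (h t - S (V t)))) (Set.Ici 0) t := by
    intro t ht
    have := (hh t ht).sub (S.hasFDerivAt.comp_hasDerivWithinAt t (hVw t ht))
    have e : -(S (h t - S (V t))) = -(S (h t)) - S (-(S (V t))) := by
      rw [map_sub, map_neg]; abel
    rw [e]
    exact this
  have hrb : ∀ t, 0 ≤ t → ‖h t - S (V t)‖ < ε / 2 := by
    intro t ht
    refine (norm_le_of_flow hpos hr ht).trans_lt ?_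
    rw [hV0, ← dist_eq_norm]
    exact hv
  -- Beyond this time the rate forces `‖S (V t)‖ < ε / 2`; the `+ 1` gives strictness and `N > 0`.
  let N : ℝ := ‖S‖ * ‖v‖ ^ 2 / (ε / 2) ^ 2 + 1
  have hN0 : 0 < N := by positivity
  refine ⟨N, fun t ht => ?_⟩
  have ht0 : 0 < t := lt_of_lt_of_le hN0 ht
  have h1 := mul_norm_sq_apply_flow_le hsym hpos hVw ht0.le
  rw [hV0] at h1
  have h2 : ‖S (V t)‖ < ε / 2 := by
    by_contra hc
    push Not at hc
    have h3 : (ε / 2) ^ 2 ≤ ‖S (V t)‖ ^ 2 := by gcongr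
    have h4 : ‖S‖ * ‖v‖ ^ 2 < N * (ε / 2) ^ 2 := by
      have h5 : ‖S‖ * ‖v‖ ^ 2 / (ε / 2) ^ 2 * (ε / 2) ^ 2 = ‖S‖ * ‖v‖ ^ 2 := by
        field_simp
      have h6 : 0 < (ε / 2) ^ 2 := by positivity
      simp only [N, add_mul, h5]
      linarith
    have h7 : N * (ε / 2) ^ 2 ≤ t * ‖S (V t)‖ ^ 2 := by gcongr
    have h8 : 0 ≤ t * ‖S (V t)‖ ^ 2 := by positivity
    linarith
  have h9 : ‖h t‖ ≤ ‖h t - S (V t)‖ + ‖S (V t)‖ := by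
    simpa using norm_add_le (h t - S (V t)) (S (V t))
  rw [Real.dist_eq, sub_zero, abs_of_nonneg (norm_nonneg _)]
  linarith [hrb t ht0.le]

end HilbertFlow

/-! ### One-dimensional ridge functionals: from a nonconstant activation to moments and exponentials
-/

section RidgeMoments

/-- A bounded smooth function one of whose derivatives vanishes identically is constant. -/
theorem eq_of_bounded_of_iteratedDeriv_eq_zero (n : ℕ) : ∀ G : ℝ → ℝ, ContDiff ℝ ∞ G →
    (∃ C, ∀ x, |G x| ≤ C) → (∀ x, iteratedDeriv n G x = 0) → ∀ x, G x = G 0 := by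
  induction n with
  | zero =>
    intro G _ _ h x
    simp only [iteratedDeriv_zero] at h
    rw [h, h]
  | succ n ih =>
    intro G hG ⟨C, hC⟩ h τ
    have hconst : ∀ x y, iteratedDeriv n G x = iteratedDeriv n G y := by
      apply is_const_of_deriv_eq_zero
      · exact hG.differentiable_iteratedDeriv n (by exact_mod_cast ENat.natCast_lt_top n)
      · intro x
        rw [← iteratedDeriv_succ]
        exact h x
    have hsh : ContDiff ℝ ∞ (fun x => G (x + τ)) := hG.comp (contDiff_id.add contDiff_const)
    -- The `n`-th derivative of the increment vanishes because that of `G` is constant. By induction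
    -- the increment is constant, so `G` grows linearly along multiples of `τ`, which boundedness
    -- forbids unless the increment is zero.
    have key := ih (fun x => G (x + τ) - G x) (hsh.sub hG) ⟨C + C, fun x =>
      (abs_sub _ _).trans (add_le_add (hC _) (hC _))⟩ (by
        intro x
        have e : (fun x => G (x + τ) - G x) = (fun x => G (x + τ)) - G := rfl
        rw [e, iteratedDeriv_sub (hsh.of_le (by exact_mod_cast le_top)).contDiffAt
          (hG.of_le (by exact_mod_cast le_top)).contDiffAt, iteratedDeriv_comp_add_const]
        simp only
        rw [hconst (x + τ) x, sub_self])
    simp only [zero_add] at key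
    set c := G τ - G 0 with hc
    have hk : ∀ k : ℕ, G (k * τ) = G 0 + k * c := by
      intro k
      induction k with
      | zero => simp
      | succ k ihk =>
        have := key (k * τ)
        push_cast
        rw [add_mul, one_mul]
        linarith
    by_contra hne
    have hc0 : 0 < |c| := abs_pos.2 (fun h0 => hne (by linarith))
    obtain ⟨k, hk'⟩ := exists_nat_gt ((C + C) / |c|)
    rw [div_lt_iff₀ hc0] at hk'
    have h1 := hk k
    have h2 : |(k : ℝ) * c| ≤ C + C := by
      have : (k : ℝ) * c = G (k * τ) - G 0 := by linarith
      rw [this]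
      exact (abs_sub _ _).trans (add_le_add (hC _) (hC _))
    rw [abs_mul, Nat.abs_cast] at h2
    linarith

/-- Differentiation of a mollification when the derivative falls on the mollified function. -/
theorem hasDerivAt_integral_mul_comp_sub {χ g g' : ℝ → ℝ} (hχ : Continuous χ)
    (hχc : HasCompactSupport χ) (hg : ∀ x, HasDerivAt g (g' x) x) (hg' : Continuous g')
    {C : ℝ} (hC : ∀ x, |g' x| ≤ C) (y : ℝ) :
    HasDerivAt (fun y => ∫ v, χ v * g (y - v)) (∫ v, χ v * g' (y - v)) y := by
  have hgc : Continuous g := continuous_iff_continuousAt.2 fun x => (hg x).continuousAt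
  have hχi : Integrable χ := hχ.integrable_of_hasCompactSupport hχc
  have hcg : ∀ z, Continuous fun v => χ v * g (z - v) := fun z => by fun_prop
  have hcg' : ∀ z, Continuous fun v => χ v * g' (z - v) := fun z => by fun_prop
  refine (hasDerivAt_integral_of_dominated_loc_of_deriv_le (s := Set.univ) (μ := volume)
    (F := fun y v => χ v * g (y - v)) (F' := fun y v => χ v * g' (y - v))
    (bound := fun v => |χ v| * C) univ_mem
    (Eventually.of_forall fun z => (hcg z).aestronglyMeasurable)
    ((hcg y).integrable_of_hasCompactSupport hχc.mul_right)
    (hcg' y).aestronglyMeasurable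
    (Eventually.of_forall fun v z _ => ?_) (hχi.abs.mul_const C)
    (Eventually.of_forall fun v z _ => ?_)).2
  · rw [Real.norm_eq_abs, abs_mul]
    exact mul_le_mul_of_nonneg_left (hC _) (abs_nonneg _)
  · have := (hg (z - v)).comp z ((hasDerivAt_id z).sub_const v)
    simpa [Function.comp_def] using this.const_mul (χ v)

variable {X : Type*} [MeasurableSpace X] {ν : Measure X} {s : X → ℝ} {M0 M1 M2 : X → ℝ}

/-- The functional `g ↦ ∫ M₀ g(s) + M₁ g'(s) + M₂ g''(s)`, given the values `(g, g', g'')`. -/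
noncomputable def ridgeInt (ν : Measure X) (s M0 M1 M2 : X → ℝ) (g0 g1 g2 : ℝ → ℝ) : ℝ :=
  ∫ x, (M0 x * g0 (s x) + M1 x * g1 (s x) + M2 x * g2 (s x)) ∂ν

theorem integrable_mul_comp {M : X → ℝ} (hs : Measurable s) {R : ℝ} (hR : ∀ᵐ x ∂ν, |s x| ≤ R)
    (hM : Integrable M ν) {g : ℝ → ℝ} (hg : Continuous g) :
    Integrable (fun x => M x * g (s x)) ν := by
  obtain ⟨C, hC⟩ := (isCompact_Icc (a := -R) (b := R)).exists_bound_of_continuousOn hg.continuousOn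
  refine hM.mul_bdd (c := C) (hg.measurable.comp hs).aestronglyMeasurable ?_
  filter_upwards [hR] with x hx
  exact hC _ (abs_le.1 hx)

/-- Mollifying the activation averages over the shifts `b - v`, and the functional vanishes at each
of them; Fubini exchanges the two integrations. -/
theorem ridgeInt_mollify [SFinite ν] (hs : Measurable s)
    (hM0 : Integrable M0 ν) (hM1 : Integrable M1 ν) (hM2 : Integrable M2 ν)
    {χ g0 g1 g2 : ℝ → ℝ} (hχ : Continuous χ) (hχc : HasCompactSupport χ)
    (hg0 : Continuous g0) (hg1 : Continuous g1) (hg2 : Continuous g2) {C : ℝ}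
    (hC0 : ∀ x, |g0 x| ≤ C) (hC1 : ∀ x, |g1 x| ≤ C) (hC2 : ∀ x, |g2 x| ≤ C) (t b : ℝ)
    (h : ∀ b, ridgeInt ν s M0 M1 M2 (fun z => g0 (t * z + b)) (fun z => t * g1 (t * z + b))
      (fun z => t ^ 2 * g2 (t * z + b)) = 0) :
    ridgeInt ν s M0 M1 M2 (fun z => ∫ v, χ v * g0 (t * z + b - v))
      (fun z => t * ∫ v, χ v * g1 (t * z + b - v))
      (fun z => t ^ 2 * ∫ v, χ v * g2 (t * z + b - v)) = 0 := by
  have hχi : Integrable χ := hχ.integrable_of_hasCompactSupport hχc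
  have hb : ∀ g : ℝ → ℝ, Continuous g → ∀ z, Integrable (fun v => χ v * g (z - v)) := fun g hg z =>
    (hχ.mul (hg.comp (by fun_prop))).integrable_of_hasCompactSupport hχc.mul_right
  have hI : ∀ M : X → ℝ, Integrable M ν → ∀ g : ℝ → ℝ, Continuous g → (∀ x, |g x| ≤ C) →
      Integrable (fun p : X × ℝ => M p.1 * χ p.2 * g (t * s p.1 + b - p.2)) (ν.prod volume) := by
    intro M hM g hg hC
    refine (hM.mul_prod hχi).mul_bdd (c := C) ?_ (Eventually.of_forall fun p => hC _)
    exact (hg.measurable.comp (by fun_prop)).aestronglyMeasurable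
  have e : ridgeInt ν s M0 M1 M2 (fun z => ∫ v, χ v * g0 (t * z + b - v))
      (fun z => t * ∫ v, χ v * g1 (t * z + b - v))
      (fun z => t ^ 2 * ∫ v, χ v * g2 (t * z + b - v)) =
      ∫ x, ∫ v : ℝ, (M0 x * χ v * g0 (t * s x + b - v) + t * (M1 x * χ v * g1 (t * s x + b - v))
        + t ^ 2 * (M2 x * χ v * g2 (t * s x + b - v))) ∂volume ∂ν := by
    unfold ridgeInt
    refine integral_congr_ae (Eventually.of_forall fun x => ?_)
    simp only
    rw [← integral_const_mul, ← integral_const_mul, ← integral_const_mul, ← integral_const_mul,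
      ← integral_const_mul, ← integral_add, ← integral_add]
    · refine integral_congr_ae (Eventually.of_forall fun v => ?_)
      simp only
      ring
    · exact ((hb g0 hg0 _).const_mul _).add (((hb g1 hg1 _).const_mul _).const_mul _)
    · exact (((hb g2 hg2 _).const_mul _).const_mul _)
    · exact (hb g0 hg0 _).const_mul _
    · exact ((hb g1 hg1 _).const_mul _).const_mul _
  rw [e, integral_integral_swap]
  · refine integral_eq_zero_of_ae (Eventually.of_forall fun v => ?_)
    have h' := h (b - v)
    unfold ridgeInt at h'
    have : (fun x => M0 x * χ v * g0 (t * s x + b - v) + t * (M1 x * χ v * g1 (t * s x + b - v))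
        + t ^ 2 * (M2 x * χ v * g2 (t * s x + b - v))) = fun x => χ v * (M0 x * g0 (t * s x + (b - v))
        + M1 x * (t * g1 (t * s x + (b - v))) + M2 x * (t ^ 2 * g2 (t * s x + (b - v)))) := by
      funext x
      rw [add_sub_assoc]
      ring
    simp only [this, integral_const_mul, h', mul_zero, Pi.zero_apply]
  · exact ((hI M0 hM0 g0 hg0 hC0).add ((hI M1 hM1 g1 hg1 hC1).const_mul t)).add
      ((hI M2 hM2 g2 hg2 hC2).const_mul (t ^ 2))

/-- If the ridge functional vanishes on all `G(t · + b)`, then also on `z ^ n G⁽ⁿ⁾(t z + b)`. -/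
theorem ridgeInt_pow_mul_iteratedDeriv (hs : Measurable s) {R : ℝ} (hR : ∀ᵐ x ∂ν, |s x| ≤ R)
    (hM0 : Integrable M0 ν) (hM1 : Integrable M1 ν) (hM2 : Integrable M2 ν)
    {G : ℝ → ℝ} (hG : ContDiff ℝ ∞ G)
    (h : ∀ t b, ridgeInt ν s M0 M1 M2 (fun z => G (t * z + b))
      (fun z => t * iteratedDeriv 1 G (t * z + b))
      (fun z => t ^ 2 * iteratedDeriv 2 G (t * z + b)) = 0) (b : ℝ) (n : ℕ) : ∀ t,
    ridgeInt ν s M0 M1 M2 (fun z => z ^ n * iteratedDeriv n G (t * z + b))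
      (fun z => n * z ^ (n - 1) * iteratedDeriv n G (t * z + b)
        + t * z ^ n * iteratedDeriv (n + 1) G (t * z + b))
      (fun z => n * (n - 1) * z ^ (n - 2) * iteratedDeriv n G (t * z + b)
        + 2 * n * t * z ^ (n - 1) * iteratedDeriv (n + 1) G (t * z + b)
        + t ^ 2 * z ^ n * iteratedDeriv (n + 2) G (t * z + b)) = 0 := by
  have hcont : ∀ k, Continuous (iteratedDeriv k G) := fun k =>
    hG.continuous_iteratedDeriv k (by exact_mod_cast le_top)
  have hder : ∀ k z, HasDerivAt (iteratedDeriv k G) (iteratedDeriv (k + 1) G z) z := by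
    intro k z
    rw [iteratedDeriv_succ]
    exact ((hG.differentiable_iteratedDeriv k (by exact_mod_cast ENat.natCast_lt_top k)) z).hasDerivAt
  induction n with
  | zero =>
    intro t
    simpa using h t b
  | succ n ih =>
    intro t₀
    have hdt : ∀ k t z, HasDerivAt (fun t => iteratedDeriv k G (t * z + b))
        (iteratedDeriv (k + 1) G (t * z + b) * z) t := by
      intro k t z
      have := (hder k (t * z + b)).comp t (((hasDerivAt_id t).mul_const z).add_const b)
      simpa [Function.comp_def] using this
    -- `A0`, `A1`, `A2` are the `t`-derivatives of the three entries at level `n`. They coincide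
    -- with the entries at level `n + 1`, so differentiating the vanishing integral under the
    -- integral sign gives the next level.
    let A0 : ℝ → ℝ → ℝ := fun t z => z ^ (n + 1) * iteratedDeriv (n + 1) G (t * z + b)
    let A1 : ℝ → ℝ → ℝ := fun t z => (n + 1) * z ^ n * iteratedDeriv (n + 1) G (t * z + b)
        + t * z ^ (n + 1) * iteratedDeriv (n + 2) G (t * z + b)
    let A2 : ℝ → ℝ → ℝ := fun t z => (n + 1) * n * z ^ (n - 1) * iteratedDeriv (n + 1) G (t * z + b)
        + 2 * (n + 1) * t * z ^ n * iteratedDeriv (n + 2) G (t * z + b)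
        + t ^ 2 * z ^ (n + 1) * iteratedDeriv (n + 3) G (t * z + b)
    have hA0 : Continuous (fun p : ℝ × ℝ => A0 p.1 p.2) := by
      have := hcont (n + 1)
      simp only [A0]; fun_prop
    have hA1 : Continuous (fun p : ℝ × ℝ => A1 p.1 p.2) := by
      have := hcont (n + 1); have := hcont (n + 2)
      simp only [A1]; fun_prop
    have hA2 : Continuous (fun p : ℝ × ℝ => A2 p.1 p.2) := by
      have := hcont (n + 1); have := hcont (n + 2); have := hcont (n + 3)
      simp only [A2]; fun_prop
    have hbd : ∀ A : ℝ × ℝ → ℝ, Continuous A → ∃ C, ∀ t ∈ Set.Icc (t₀ - 1) (t₀ + 1),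
        ∀ z ∈ Set.Icc (-R) R, |A (t, z)| ≤ C := by
      intro A hA
      obtain ⟨C, hC⟩ := (isCompact_Icc.prod isCompact_Icc).exists_bound_of_continuousOn
        (hA.continuousOn (s := Set.Icc (t₀ - 1) (t₀ + 1) ×ˢ Set.Icc (-R) R))
      exact ⟨C, fun t ht z hz => hC (t, z) ⟨ht, hz⟩⟩
    obtain ⟨C0, hC0⟩ := hbd _ hA0
    obtain ⟨C1, hC1⟩ := hbd _ hA1
    obtain ⟨C2, hC2⟩ := hbd _ hA2
    have hint : ∀ (M : X → ℝ), Integrable M ν → ∀ g : ℝ → ℝ, Continuous g →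
        Integrable (fun x => M x * g (s x)) ν := fun M hM g hg => integrable_mul_comp hs hR hM hg
    have c0 := hcont n
    have c1 := hcont (n + 1)
    have c2 := hcont (n + 2)
    have c3 := hcont (n + 3)
    have hFint : ∀ t, Integrable (fun x => M0 x * (s x ^ n * iteratedDeriv n G (t * s x + b))
        + M1 x * (n * s x ^ (n - 1) * iteratedDeriv n G (t * s x + b)
        + t * s x ^ n * iteratedDeriv (n + 1) G (t * s x + b))
        + M2 x * (n * (n - 1) * s x ^ (n - 2) * iteratedDeriv n G (t * s x + b)
        + 2 * n * t * s x ^ (n - 1) * iteratedDeriv (n + 1) G (t * s x + b)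
        + t ^ 2 * s x ^ n * iteratedDeriv (n + 2) G (t * s x + b))) ν := by
      intro t
      exact ((hint M0 hM0 (fun z => z ^ n * iteratedDeriv n G (t * z + b)) (by fun_prop)).add
        (hint M1 hM1 (fun z => n * z ^ (n - 1) * iteratedDeriv n G (t * z + b)
        + t * z ^ n * iteratedDeriv (n + 1) G (t * z + b)) (by fun_prop))).add
        (hint M2 hM2 (fun z => n * (n - 1) * z ^ (n - 2) * iteratedDeriv n G (t * z + b)
        + 2 * n * t * z ^ (n - 1) * iteratedDeriv (n + 1) G (t * z + b)
        + t ^ 2 * z ^ n * iteratedDeriv (n + 2) G (t * z + b)) (by fun_prop))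
    have hF'int : Integrable (fun x => M0 x * A0 t₀ (s x) + M1 x * A1 t₀ (s x)
        + M2 x * A2 t₀ (s x)) ν :=
      ((hint M0 hM0 (A0 t₀) (hA0.comp (by fun_prop : Continuous fun z : ℝ => (t₀, z)))).add
        (hint M1 hM1 (A1 t₀) (hA1.comp (by fun_prop : Continuous fun z : ℝ => (t₀, z))))).add
        (hint M2 hM2 (A2 t₀) (hA2.comp (by fun_prop : Continuous fun z : ℝ => (t₀, z))))
    have key := (hasDerivAt_integral_of_dominated_loc_of_deriv_le (μ := ν)
      (s := Set.Icc (t₀ - 1) (t₀ + 1)) (x₀ := t₀)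
      (bound := fun x => |M0 x| * C0 + |M1 x| * C1 + |M2 x| * C2)
      (F' := fun t x => M0 x * A0 t (s x) + M1 x * A1 t (s x) + M2 x * A2 t (s x))
      (Icc_mem_nhds (by linarith) (by linarith))
      (Eventually.of_forall fun t => (hFint t).aestronglyMeasurable) (hFint t₀)
      hF'int.aestronglyMeasurable ?_
      (((hM0.abs.mul_const _).add (hM1.abs.mul_const _)).add (hM2.abs.mul_const _))
      (Eventually.of_forall fun x t _ => ?_)).2
    · have hz : (fun t => ∫ x, (M0 x * (s x ^ n * iteratedDeriv n G (t * s x + b))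
        + M1 x * (n * s x ^ (n - 1) * iteratedDeriv n G (t * s x + b)
        + t * s x ^ n * iteratedDeriv (n + 1) G (t * s x + b))
        + M2 x * (n * (n - 1) * s x ^ (n - 2) * iteratedDeriv n G (t * s x + b)
        + 2 * n * t * s x ^ (n - 1) * iteratedDeriv (n + 1) G (t * s x + b)
        + t ^ 2 * s x ^ n * iteratedDeriv (n + 2) G (t * s x + b))) ∂ν) = fun _ => 0 :=
        funext ih
      rw [hz] at key
      have := key.unique (hasDerivAt_const t₀ 0)
      unfold ridgeInt
      simp only [A0, A1, A2] at this
      rw [← this]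
      refine integral_congr_ae (Eventually.of_forall fun x => ?_)
      have e1 : n + 1 - 2 = n - 1 := by omega
      simp only [Nat.add_sub_cancel, Nat.cast_add, Nat.cast_one, add_sub_cancel_right, e1,
        add_assoc n 1 1, add_assoc n 1 2, one_add_one_eq_two]
    · filter_upwards [hR] with x hx t ht
      have hx' := abs_le.1 hx
      rw [Real.norm_eq_abs]
      refine (abs_add_le _ _).trans (add_le_add ((abs_add_le _ _).trans (add_le_add ?_ ?_)) ?_)
      · rw [abs_mul]; exact mul_le_mul_of_nonneg_left (hC0 t ht _ hx') (abs_nonneg _)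
      · rw [abs_mul]; exact mul_le_mul_of_nonneg_left (hC1 t ht _ hx') (abs_nonneg _)
      · rw [abs_mul]; exact mul_le_mul_of_nonneg_left (hC2 t ht _ hx') (abs_nonneg _)
    -- With truncated subtraction in the exponents, the numerical factors `n` and `n (n - 1)` kill
    -- the exceptional cases `n = 0` and `n = 1`.
    · have p1 : (n : ℝ) * s x ^ (n - 1) * s x = n * s x ^ n := by
        cases n with
        | zero => simp
        | succ k => simp [pow_succ, mul_assoc]
      have p2 : (n : ℝ) * (n - 1) * s x ^ (n - 2) * s x = n * (n - 1) * s x ^ (n - 1) := by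
        rcases n with _ | _ | k
        · simp
        · simp
        · simp [pow_succ, mul_assoc]
      have d0 := hdt n t (s x)
      have d1 := hdt (n + 1) t (s x)
      have d2 := hdt (n + 2) t (s x)
      have ht := hasDerivAt_id t
      have D := ((d0.const_mul (s x ^ n)).const_mul (M0 x)).add
        (((d0.const_mul (n * s x ^ (n - 1))).add ((ht.mul_const (s x ^ n)).mul d1)).const_mul
          (M1 x)) |>.add ((((d0.const_mul (n * (n - 1) * s x ^ (n - 2))).add
          (((ht.const_mul (2 * (n : ℝ))).mul_const (s x ^ (n - 1))).mul d1)).add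
          ((((hasDerivAt_pow 2 t)).mul_const (s x ^ n)).mul d2)).const_mul (M2 x))
      refine D.congr_deriv ?_
      have e2 : iteratedDeriv (n + 1 + 1) G (t * s x + b) = iteratedDeriv (n + 2) G (t * s x + b) :=
        rfl
      have e3 : iteratedDeriv (n + 2 + 1) G (t * s x + b) = iteratedDeriv (n + 3) G (t * s x + b) :=
        rfl
      simp only [A0, A1, A2, id, e2, e3]
      generalize iteratedDeriv (n + 1) G (t * s x + b) = y1
      generalize iteratedDeriv (n + 3) G (t * s x + b) = y3
      generalize iteratedDeriv (n + 2) G (t * s x + b) = y2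
      push_cast
      linear_combination M1 x * y1 * p1 + M2 x * (y1 * p2 + 2 * t * y2 * p1)

/-- The vanishing of the ridge functional on all dilates and translates of a bounded nonconstant
`C²` function forces its vanishing on all monomials. -/
theorem ridgeInt_pow_eq_zero [SFinite ν] (hs : Measurable s) {R : ℝ} (hR : ∀ᵐ x ∂ν, |s x| ≤ R)
    (hM0 : Integrable M0 ν) (hM1 : Integrable M1 ν) (hM2 : Integrable M2 ν)
    {g : ℝ → ℝ} (hg : ContDiff ℝ 2 g) {C : ℝ} (hC : ∀ k ≤ 2, ∀ x, |iteratedDeriv k g x| ≤ C)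
    (hnc : ¬ ∃ c, ∀ z, g z = c)
    (h : ∀ t b, ridgeInt ν s M0 M1 M2 (fun z => g (t * z + b))
      (fun z => t * iteratedDeriv 1 g (t * z + b))
      (fun z => t ^ 2 * iteratedDeriv 2 g (t * z + b)) = 0) (n : ℕ) :
    ridgeInt ν s M0 M1 M2 (fun z => z ^ n) (fun z => n * z ^ (n - 1))
      (fun z => n * (n - 1) * z ^ (n - 2)) = 0 := by
  have hg0 : Continuous g := hg.continuous
  have hg1 : Continuous (iteratedDeriv 1 g) := hg.continuous_iteratedDeriv 1 (by norm_num)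
  have hg2 : Continuous (iteratedDeriv 2 g) := hg.continuous_iteratedDeriv 2 (by norm_num)
  have hd0 : ∀ x, HasDerivAt g (iteratedDeriv 1 g x) x := fun x => by
    rw [iteratedDeriv_one]
    exact (hg.differentiable (by norm_num) x).hasDerivAt
  have hd1 : ∀ x, HasDerivAt (iteratedDeriv 1 g) (iteratedDeriv 2 g x) x := fun x => by
    rw [iteratedDeriv_succ (n := 1)]
    exact (hg.differentiable_iteratedDeriv 1 (by norm_num) x).hasDerivAt
  have hC0 : ∀ x, |g x| ≤ C := by simpa using hC 0 (by norm_num)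
  have hC1 := hC 1 (by norm_num)
  have hC2 := hC 2 le_rfl
  -- A dichotomy for each mollification `G` of `g`. Either some derivative of `G` vanishes
  -- identically, and then boundedness makes `G` constant, or for every `n` there is a point `b`
  -- with `G⁽ⁿ⁾(b) ≠ 0`, which yields the `n`-th moment.
  have main : ∀ φ : ContDiffBump (0 : ℝ), (∀ n : ℕ, ridgeInt ν s M0 M1 M2 (fun z => z ^ n)
      (fun z => n * z ^ (n - 1)) (fun z => n * (n - 1) * z ^ (n - 2)) = 0) ∨
      ∀ y, ∫ v, φ.normed volume v * g (y - v) = ∫ v, φ.normed volume v * g (0 - v) := by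
    intro φ
    set χ := φ.normed volume with hχdef
    have hχ : Continuous χ := φ.continuous_normed
    have hχc : HasCompactSupport χ := φ.hasCompactSupport_normed
    have hχs : ContDiff ℝ ∞ χ := φ.contDiff_normed
    have hχi : Integrable χ := hχ.integrable_of_hasCompactSupport hχc
    let G : ℝ → ℝ := fun y => ∫ v, χ v * g (y - v)
    have hGs : ContDiff ℝ ∞ G :=
      hχc.contDiff_convolution_left (ContinuousLinearMap.mul ℝ ℝ) hχs hg0.locallyIntegrable
    have hG1 : iteratedDeriv 1 G = fun y => ∫ v, χ v * iteratedDeriv 1 g (y - v) := by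
      funext y
      rw [iteratedDeriv_one]
      exact (hasDerivAt_integral_mul_comp_sub hχ hχc hd0 hg1 hC1 y).deriv
    have hG2 : iteratedDeriv 2 G = fun y => ∫ v, χ v * iteratedDeriv 2 g (y - v) := by
      funext y
      rw [iteratedDeriv_succ (n := 1), hG1]
      exact (hasDerivAt_integral_mul_comp_sub hχ hχc hd1 hg2 hC2 y).deriv
    have hGb : ∃ C, ∀ x, |G x| ≤ C := by
      refine ⟨∫ v, |χ v| * C, fun y => ?_⟩
      rw [← Real.norm_eq_abs]
      refine norm_integral_le_of_norm_le (hχi.abs.mul_const C) (Eventually.of_forall fun v => ?_)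
      rw [Real.norm_eq_abs, abs_mul]
      exact mul_le_mul_of_nonneg_left (hC0 _) (abs_nonneg _)
    have hGt : ∀ t b, ridgeInt ν s M0 M1 M2 (fun z => G (t * z + b))
        (fun z => t * iteratedDeriv 1 G (t * z + b))
        (fun z => t ^ 2 * iteratedDeriv 2 G (t * z + b)) = 0 := by
      intro t b
      rw [hG1, hG2]
      exact ridgeInt_mollify hs hM0 hM1 hM2 hχ hχc hg0 hg1 hg2 hC0 hC1 hC2 t b (h t)
    by_cases hz : ∃ n, ∀ b, iteratedDeriv n G b = 0
    · obtain ⟨n, hn⟩ := hz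
      exact Or.inr (eq_of_bounded_of_iteratedDeriv_eq_zero n G hGs hGb hn)
    · push Not at hz
      refine Or.inl fun n => ?_
      obtain ⟨b, hb⟩ := hz n
      -- At `t = 0` the argument `t z + b` no longer depends on `z`, and the common factor `G⁽ⁿ⁾(b)`
      -- can be divided out.
      have := ridgeInt_pow_mul_iteratedDeriv hs hR hM0 hM1 hM2 hGs hGt b n 0
      unfold ridgeInt at this ⊢
      simp only [zero_mul, zero_add, mul_zero, add_zero, ne_eq, OfNat.ofNat_ne_zero,
        not_false_eq_true, zero_pow, ← mul_assoc, ← add_mul, integral_mul_const] at this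
      simpa only [← mul_assoc] using (mul_eq_zero.1 this).resolve_right hb
  by_contra hne
  refine hnc ⟨g 0, fun z => ?_⟩
  -- If the moment did not vanish, every mollification would be constant. Letting the radius `1 / (k
  -- + 1)` tend to zero would make `g` constant.
  let φ : ℕ → ContDiffBump (0 : ℝ) := fun k =>
    ⟨1 / (k + 1) / 2, 1 / (k + 1), by positivity, half_lt_self (by positivity)⟩
  have hlim : ∀ y, Tendsto (fun k => ∫ v, (φ k).normed volume v * g (y - v)) atTop (𝓝 (g y)) := by
    intro y
    exact ContDiffBump.convolution_tendsto_right_of_continuous (φ := φ) (μ := volume)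
      tendsto_one_div_add_atTop_nhds_zero_nat hg0 y
  refine tendsto_nhds_unique (hlim z) ((hlim 0).congr fun k => ?_)
  exact ((main (φ k)).resolve_left (fun h0 => hne (h0 n)) z).symm

/-- The complex exponential is a combination of monomials, also in the ridge functional. -/
theorem integral_exp_eq_zero (hs : Measurable s) {R : ℝ} (hR : ∀ᵐ x ∂ν, |s x| ≤ R)
    (hM0 : Integrable M0 ν) (hM1 : Integrable M1 ν) (hM2 : Integrable M2 ν)
    (h : ∀ n : ℕ, ridgeInt ν s M0 M1 M2 (fun z => z ^ n) (fun z => n * z ^ (n - 1))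
      (fun z => n * (n - 1) * z ^ (n - 2)) = 0) :
    ∫ x, ((M0 x : ℂ) + M1 x * Complex.I + M2 x * Complex.I ^ 2) *
      Complex.exp (Complex.I * s x) ∂ν = 0 := by
  -- Taking `K ≥ 1` lets `K ^ n` bound all lower powers of `|s x|` as well, uniformly in the
  -- truncated exponents.
  set K : ℝ := max R 1 with hK
  have hK1 : 1 ≤ K := le_max_right _ _
  have hE : ∀ z : ℝ, HasSum (fun n : ℕ => Complex.I ^ n / n.factorial * (z : ℂ) ^ n)
      (Complex.exp (Complex.I * z)) := by
    intro z
    have := NormedSpace.expSeries_div_hasSum_exp (𝔸 := ℂ) (Complex.I * z)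
    rw [← Complex.exp_eq_exp_ℂ] at this
    refine this.congr_fun fun n => ?_
    rw [mul_pow]; ring
  have hfac : ∀ n : ℕ, (((n + 1).factorial : ℕ) : ℂ) = (n + 1) * n.factorial := fun n => by
    rw [Nat.factorial_succ]; push_cast; ring
  have hf0 : ∀ n : ℕ, ((n.factorial : ℕ) : ℂ) ≠ 0 := fun n =>
    Nat.cast_ne_zero.2 (Nat.factorial_ne_zero n)
  have hn0 : ∀ n : ℕ, ((n : ℂ) + 1) ≠ 0 := fun n => Nat.cast_add_one_ne_zero n
  have hE1 : ∀ z : ℝ, HasSum (fun n : ℕ => Complex.I ^ n / n.factorial * (n * (z : ℂ) ^ (n - 1)))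
      (Complex.I * Complex.exp (Complex.I * z)) := by
    intro z
    rw [← hasSum_nat_add_iff' 1]
    simp only [Finset.range_one, Finset.sum_singleton, Nat.cast_zero, zero_mul, mul_zero, sub_zero,
      Nat.add_sub_cancel]
    refine ((hE z).mul_left Complex.I).congr_fun fun n => ?_
    rw [hfac, pow_succ]
    have := hf0 n; have := hn0 n
    push_cast
    field_simp
  have hE2 : ∀ z : ℝ, HasSum (fun n : ℕ => Complex.I ^ n / n.factorial *
      (n * (n - 1) * (z : ℂ) ^ (n - 2))) (Complex.I * (Complex.I * Complex.exp (Complex.I * z))) := by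
    intro z
    rw [← hasSum_nat_add_iff' 1]
    simp only [Finset.range_one, Finset.sum_singleton, Nat.cast_zero, zero_mul, mul_zero, sub_zero]
    refine ((hE1 z).mul_left Complex.I).congr_fun fun n => ?_
    have e : n + 1 - 2 = n - 1 := by omega
    rw [hfac, pow_succ, e]
    have := hf0 n; have := hn0 n
    push_cast
    field_simp
    ring
  let F : ℕ → X → ℂ := fun n x => Complex.I ^ n / n.factorial *
    ((M0 x * s x ^ n + M1 x * (n * s x ^ (n - 1)) + M2 x * (n * (n - 1) * s x ^ (n - 2)) : ℝ) : ℂ)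
  have hFreal : ∀ n : ℕ, Integrable (fun x => M0 x * s x ^ n + M1 x * (n * s x ^ (n - 1))
      + M2 x * (n * (n - 1) * s x ^ (n - 2))) ν := fun n =>
    ((integrable_mul_comp hs hR hM0 (g := fun z => z ^ n) (by fun_prop)).add
      (integrable_mul_comp hs hR hM1 (g := fun z => n * z ^ (n - 1)) (by fun_prop))).add
      (integrable_mul_comp hs hR hM2 (g := fun z => n * (n - 1) * z ^ (n - 2)) (by fun_prop))
  have hFint : ∀ n, Integrable (F n) ν := fun n => (hFreal n).ofReal.const_mul _
  have hFz : ∀ n, ∫ x, F n x ∂ν = 0 := by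
    intro n
    simp only [F]
    rw [integral_const_mul, integral_complex_ofReal]
    have := h n
    unfold ridgeInt at this
    rw [this]
    simp
  have hsum := hasSum_integral_of_dominated_convergence (μ := ν) (F := F)
    (f := fun x => ((M0 x : ℂ) + M1 x * Complex.I + M2 x * Complex.I ^ 2) *
      Complex.exp (Complex.I * s x))
    -- The `4 ^ n` absorbs the factors `n` and `n (n - 1)` coming from differentiating `z ^ n`,
    -- since `n ≤ 2 ^ n`.
    (fun n x => (|M0 x| + |M1 x| + |M2 x|) * ((4 * K) ^ n / n.factorial))
    (fun n => (hFint n).aestronglyMeasurable) (fun n => ?_) (Eventually.of_forall fun x =>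
      (Real.summable_pow_div_factorial (4 * K)).mul_left _) ?_ (Eventually.of_forall fun x => ?_)
  · simp only [hFz] at hsum
    exact hsum.unique hasSum_zero
  · filter_upwards [hR] with x hx
    have hsK : |s x| ≤ K := hx.trans (le_max_left _ _)
    have hpw : ∀ m ≤ n, |s x| ^ m ≤ K ^ n := fun m hm =>
      (pow_le_pow_left₀ (abs_nonneg _) hsK m).trans (pow_le_pow_right₀ hK1 hm)
    have hn4 : (n : ℝ) ≤ 2 ^ n := by exact_mod_cast (Nat.lt_two_pow_self).le
    have h4 : (4 : ℝ) ^ n = 2 ^ n * 2 ^ n := by rw [← mul_pow]; norm_num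
    have h21 : (1 : ℝ) ≤ 2 ^ n := one_le_pow₀ (by norm_num)
    have hKn : 0 ≤ K ^ n := by positivity
    have b0 : |s x ^ n| ≤ (4 * K) ^ n := by
      rw [abs_pow, mul_pow]
      exact (hpw n le_rfl).trans (le_mul_of_one_le_left hKn (one_le_pow₀ (by norm_num)))
    have b1 : |(n : ℝ) * s x ^ (n - 1)| ≤ (4 * K) ^ n := by
      rw [abs_mul, abs_pow, mul_pow, Nat.abs_cast]
      have := hpw (n - 1) (Nat.sub_le _ _)
      refine mul_le_mul ?_ this (by positivity) (by positivity)
      nlinarith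
    have b2 : |(n : ℝ) * (n - 1) * s x ^ (n - 2)| ≤ (4 * K) ^ n := by
      rw [abs_mul, abs_mul, abs_pow, mul_pow, Nat.abs_cast, h4]
      have := hpw (n - 2) (Nat.sub_le _ _)
      refine mul_le_mul (mul_le_mul hn4 ?_ (abs_nonneg _) (by positivity)) this (by positivity)
        (by positivity)
      rw [abs_le]
      constructor
      · have : (0 : ℝ) ≤ n := Nat.cast_nonneg n
        linarith
      · linarith
    have hnorm : ‖F n x‖ = |M0 x * s x ^ n + M1 x * (n * s x ^ (n - 1))
        + M2 x * (n * (n - 1) * s x ^ (n - 2))| / n.factorial := by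
      simp only [F]
      rw [norm_mul, norm_div, norm_pow, Complex.norm_I, one_pow, Complex.norm_natCast,
        Complex.norm_real, Real.norm_eq_abs]
      ring
    rw [hnorm, ← mul_div_assoc]
    refine div_le_div_of_nonneg_right ?_ (Nat.cast_nonneg _)
    refine (abs_add_le _ _).trans ((add_le_add (abs_add_le _ _) le_rfl).trans ?_)
    rw [abs_mul (M0 x), abs_mul (M1 x), abs_mul (M2 x), add_mul, add_mul]
    gcongr
  · simp only [tsum_mul_left]
    exact ((hM0.abs.add hM1.abs).add hM2.abs).mul_const _
  · have := (((hE (s x)).mul_left (M0 x : ℂ)).add ((hE1 (s x)).mul_left (M1 x : ℂ))).add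
      ((hE2 (s x)).mul_left (M2 x : ℂ))
    have e : ((M0 x : ℂ) + M1 x * Complex.I + M2 x * Complex.I ^ 2) *
        Complex.exp (Complex.I * s x) = M0 x * Complex.exp (Complex.I * s x)
        + M1 x * (Complex.I * Complex.exp (Complex.I * s x))
        + M2 x * (Complex.I * (Complex.I * Complex.exp (Complex.I * s x))) := by ring
    rw [e]
    refine this.congr_fun fun n => ?_
    simp only [F]
    push_cast
    ring

end RidgeMoments

/-! ### Ridge functions determine second order functionals on `C_c²` -/

section UniversalApproximation

variable {d : ℕ}

theorem partialD_ridge {p : ℕ} (α : Idx d p) {g : ℝ → ℝ} {n : ℕ∞} (hg : ContDiff ℝ n g)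
    (hn : (α.1 : ℕ) ≤ n) (w : Sp d) (b : ℝ) (x : Sp d) :
    partialD α (fun x => g (inner ℝ w x + b)) x =
      (∏ m, w (α.2 m)) * iteratedDeriv α.1 g (inner ℝ w x + b) := by
  have hgb : ContDiff ℝ n (fun z => g (z + b)) := hg.comp (contDiff_id.add contDiff_const)
  have := (innerSL ℝ w).iteratedFDeriv_comp_right (f := fun z => g (z + b)) hgb x
    (i := (α.1 : ℕ)) (by exact_mod_cast hn)
  unfold partialD
  have e : (fun x => g (inner ℝ w x + b)) = (fun z => g (z + b)) ∘ (innerSL ℝ w) := by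
    funext x; simp
  rw [e, this]
  simp only [ContinuousMultilinearMap.compContinuousLinearMap_apply, innerSL_apply_apply,
    iteratedFDeriv_apply_eq_iteratedDeriv_mul_prod, iteratedDeriv_comp_add_const, smul_eq_mul]
  simp [EuclideanSpace.inner_single_right]

/-- Sums over words of length at most two, by length. -/
theorem sum_idx_two {A : Type*} [AddCommMonoid A] (f : Idx d 2 → A) :
    ∑ α, f α = f (idx0 d 2) + ∑ i, f ⟨1, ![i]⟩ + ∑ i, ∑ j, f ⟨2, ![i, j]⟩ := by
  rw [Fintype.sum_sigma, Fin.sum_univ_three]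
  congr 1
  · congr 1
    · have : Unique (Fin ((0 : Fin 3) : ℕ) → Fin d) := inferInstanceAs (Unique (Fin 0 → Fin d))
      rw [Fintype.sum_unique]
      congr 1
      exact congrArg (Sigma.mk (0 : Fin 3)) (Subsingleton.elim _ _)
    · exact Fintype.sum_equiv (Equiv.funUnique (Fin 1) (Fin d)) _ _ (fun x => by
        congr 2; funext i; fin_cases i; rfl)
  · rw [← Fintype.sum_prod_type']
    refine Fintype.sum_equiv (finTwoArrowEquiv (Fin d)) _ _ (fun x => ?_)
    congr 2
    funext i; fin_cases i <;> rfl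

/-- For fixed `w`, the derivatives of `σ(w · x + b)` of order `k` are monomials in `w` times `σ⁽ᵏ⁾`.
Grouping the coefficients by order reduces the hypothesis on the ray `t • w` to a one-dimensional
ridge functional in `s = w · x`. The conclusion is the same functional on the exponential `exp(i w ·
x)`. -/
theorem integral_ridge_exp_eq_zero {Ω : Set (Sp d)} (hΩm : MeasurableSet Ω)
    (hΩ : Bornology.IsBounded Ω) {M : Idx d 2 → Sp d → ℝ} (hM : ∀ α, IntegrableOn (M α) Ω)
    {σ : ℝ → ℝ} (hσ : ContDiff ℝ 2 σ) {C : ℝ} (hC : ∀ k ≤ 2, ∀ x, |iteratedDeriv k σ x| ≤ C)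
    (hnc : ¬ ∃ c, ∀ z, σ z = c)
    (h : ∀ w b, ∫ x in Ω, ∑ α, M α x * partialD α (fun x => σ (inner ℝ w x + b)) x = 0)
    (w : Sp d) :
    ∫ x in Ω, ∑ α : Idx d 2, (M α x : ℂ) * (∏ m, (Complex.I * w (α.2 m))) *
      Complex.exp (Complex.I * (inner ℝ w x : ℝ)) = 0 := by
  obtain ⟨R, hR⟩ := hΩ.exists_norm_le
  have hs : Measurable fun x : Sp d => inner ℝ w x := by fun_prop
  have hsR : ∀ᵐ x ∂(volume.restrict Ω), |inner ℝ w x| ≤ ‖w‖ * R := by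
    filter_upwards [ae_restrict_mem hΩm] with x hx
    exact (abs_real_inner_le_norm _ _).trans (mul_le_mul_of_nonneg_left (hR x hx) (norm_nonneg _))
  let M0 : Sp d → ℝ := M (idx0 d 2)
  let M1 : Sp d → ℝ := fun x => ∑ i, M ⟨1, ![i]⟩ x * w i
  let M2 : Sp d → ℝ := fun x => ∑ i, ∑ j, M ⟨2, ![i, j]⟩ x * (w i * w j)
  have hM0 : IntegrableOn M0 Ω := hM _
  have hM1 : IntegrableOn M1 Ω := integrable_finsetSum _ fun i _ => (hM _).mul_const _
  have hM2 : IntegrableOn M2 Ω := integrable_finsetSum _ fun i _ =>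
    integrable_finsetSum _ fun j _ => (hM _).mul_const _
  have hr : ∀ t b, ridgeInt (volume.restrict Ω) (fun x => inner ℝ w x) M0 M1 M2
      (fun z => σ (t * z + b)) (fun z => t * iteratedDeriv 1 σ (t * z + b))
      (fun z => t ^ 2 * iteratedDeriv 2 σ (t * z + b)) = 0 := by
    intro t b
    rw [← h (t • w) b]
    unfold ridgeInt
    refine integral_congr_ae (Eventually.of_forall fun x => ?_)
    have hp : ∀ α : Idx d 2, partialD α (fun x => σ (inner ℝ (t • w) x + b)) x =
        (∏ m, (t • w) (α.2 m)) * iteratedDeriv α.1 σ (inner ℝ (t • w) x + b) := fun α =>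
      partialD_ridge α (n := 2) hσ (by have := α.1.2; exact_mod_cast Nat.lt_succ_iff.1 this) _ _ _
    simp only [hp]
    rw [sum_idx_two]
    simp only [M0, M1, M2, Finset.sum_mul]
    simp only [inner_smul_left, PiLp.smul_apply, smul_eq_mul,
      RCLike.conj_to_real]
    congr 1
    · congr 1
      · have : ∀ f : Fin ((idx0 d 2).1 : ℕ) → ℝ, ∏ m, f m = 1 := fun f => Fin.prod_univ_zero f
        rw [this]
        simp [idx0]
      · refine Finset.sum_congr rfl fun i _ => ?_
        simp
        ring
    · refine Finset.sum_congr rfl fun i _ => Finset.sum_congr rfl fun j _ => ?_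
      have : ∀ f : Fin ((2 : Fin 3) : ℕ) → ℝ, ∏ m, f m = f (0 : Fin 2) * f (1 : Fin 2) :=
        fun f => Fin.prod_univ_two f
      rw [this]
      simp
      ring
  have key := integral_exp_eq_zero hs hsR hM0 hM1 hM2
    (ridgeInt_pow_eq_zero hs hsR hM0 hM1 hM2 hσ hC hnc hr)
  rw [← key]
  refine integral_congr_ae (Eventually.of_forall fun x => ?_)
  simp only
  rw [sum_idx_two, add_mul, add_mul]
  simp only [M0, M1, M2, Finset.sum_mul, Complex.ofReal_sum]
  congr 1
  · congr 1
    · have : ∀ f : Fin ((idx0 d 2).1 : ℕ) → ℂ, ∏ m, f m = 1 := fun f => Fin.prod_univ_zero f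
      rw [this]
      simp
    · refine Finset.sum_congr rfl fun i _ => ?_
      simp
      ring
  · refine Finset.sum_congr rfl fun i _ => Finset.sum_congr rfl fun j _ => ?_
    have : ∀ f : Fin ((2 : Fin 3) : ℕ) → ℂ, ∏ m, f m = f (0 : Fin 2) * f (1 : Fin 2) :=
      fun f => Fin.prod_univ_two f
    rw [this]
    simp only [Complex.ofReal_mul, Matrix.cons_val_zero, Matrix.cons_val_one]
    ring

theorem fourier_partialD {p : ℕ} (α : Idx d p) {φ : Sp d → ℝ} (hφ : ContDiff ℝ p φ)
    (hφc : HasCompactSupport φ) (η : Sp d) :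
    𝓕 (fun x => (partialD α φ x : ℂ)) η =
      (∏ m, (2 * Real.pi * Complex.I * η (α.2 m))) * 𝓕 (fun x => (φ x : ℂ)) η := by
  have hα : (α.1 : ℕ) ≤ p := Nat.lt_succ_iff.1 α.1.2
  let φc : Sp d → ℂ := fun x => (φ x : ℂ)
  have hφcs : ContDiff ℝ p φc := Complex.ofRealCLM.contDiff.comp hφ
  have hcc : HasCompactSupport φc := hφc.comp_left (g := fun z : ℝ => (z : ℂ)) (by simp)
  have hint : ∀ n : ℕ, n ≤ (p : ℕ∞) → Integrable (iteratedFDeriv ℝ n φc) := fun n hn =>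
    (hφcs.continuous_iteratedFDeriv (by exact_mod_cast hn)).integrable_of_hasCompactSupport
      (hcc.iteratedFDeriv n)
  have h1 := Real.fourier_iteratedFDeriv (N := p) (f := φc) (by exact_mod_cast hφcs) hint
    (n := α.1) (by exact_mod_cast hα)
  have h2 : (fun x => (partialD α φ x : ℂ)) = fun x => iteratedFDeriv ℝ (α.1 : ℕ) φc x
      (fun m => EuclideanSpace.single (α.2 m) (1 : ℝ)) := by
    funext x
    have := Complex.ofRealCLM.iteratedFDeriv_comp_left (hφ.contDiffAt (x := x)) (i := (α.1 : ℕ))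
      (by exact_mod_cast hα)
    have e : φc = Complex.ofRealCLM ∘ φ := rfl
    rw [e, this]
    rfl
  rw [h2, ← Real.fourier_continuousMultilinearMap_apply (hint _ (by exact_mod_cast hα)), h1]
  simp only [VectorFourier.fourierPowSMulRight_apply]
  have hin : ∀ i, innerSL ℝ η (EuclideanSpace.single (α.2 i) (1 : ℝ)) = η (α.2 i) := fun i => by
    rw [innerSL_apply_apply, EuclideanSpace.inner_single_right]
    simp
  simp only [_root_.neg_apply, Finset.prod_neg, Finset.card_univ, Fintype.card_fin,
    hin, Finset.prod_mul_distrib, Finset.prod_const, φc, Complex.real_smul, smul_eq_mul]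
  rw [neg_pow]
  push_cast
  -- Two signs cancel: one from the convention in the Fourier transform of derivatives, one pulled
  -- out of the product.
  have h1 : ((-1 : ℂ) ^ (α.1 : ℕ)) * (-1) ^ (α.1 : ℕ) = 1 := by rw [← mul_pow]; simp
  linear_combination ((2 * Real.pi * Complex.I) ^ (α.1 : ℕ) * (∏ i, (η (α.2 i) : ℂ)) *
    𝓕 (fun x => (φ x : ℂ)) η) * h1

/-- If a second order functional on `Ω` vanishes on all ridge functions `σ(w · x + b)`, then it
vanishes on `C_c²`. -/
theorem integral_partialD_eq_zero_of_ridge {Ω : Set (Sp d)} (hΩm : MeasurableSet Ω)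
    (hΩ : Bornology.IsBounded Ω) {M : Idx d 2 → Sp d → ℝ} (hM : ∀ α, IntegrableOn (M α) Ω)
    {σ : ℝ → ℝ} (hσ : ContDiff ℝ 2 σ) {C : ℝ} (hC : ∀ k ≤ 2, ∀ x, |iteratedDeriv k σ x| ≤ C)
    (hnc : ¬ ∃ c, ∀ z, σ z = c)
    (h : ∀ w b, ∫ x in Ω, ∑ α, M α x * partialD α (fun x => σ (inner ℝ w x + b)) x = 0)
    {φ : Sp d → ℝ} (hφ : ContDiff ℝ 2 φ) (hφc : HasCompactSupport φ) :
    ∫ x in Ω, ∑ α, M α x * partialD α φ x = 0 := by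
  have hα : ∀ α : Idx d 2, (α.1 : ℕ) ≤ 2 := fun α => Nat.lt_succ_iff.1 α.1.2
  have hDc : ∀ α : Idx d 2, Continuous (partialD α φ) := fun α =>
    (ContinuousMultilinearMap.apply ℝ _ ℝ _).continuous.comp
      (hφ.continuous_iteratedFDeriv (by exact_mod_cast hα α))
  have hDs : ∀ α : Idx d 2, HasCompactSupport (partialD α φ) := fun α =>
    HasCompactSupport.comp_left (g := fun L : (Sp d) [×(α.1 : ℕ)]→L[ℝ] ℝ =>
      L fun m => EuclideanSpace.single (α.2 m) (1 : ℝ)) (hφc.iteratedFDeriv (𝕜 := ℝ) α.1) rfl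
  let m : Idx d 2 → Sp d → ℂ := fun α x => ((Ω.indicator (M α) x : ℝ) : ℂ)
  -- With the reflected derivative, the pairing of `M α` with `D_α φ` becomes the value at `0` of a
  -- convolution, so it suffices that the continuous function `F` below vanishes.
  let ψ : Idx d 2 → Sp d → ℂ := fun α y => ((partialD α φ (-y) : ℝ) : ℂ)
  have hm : ∀ α, Integrable (m α) := fun α => ((integrable_indicator_iff hΩm).2 (hM α)).ofReal
  have hψc : ∀ α, Continuous (ψ α) := fun α =>
    Complex.continuous_ofReal.comp ((hDc α).comp continuous_neg)
  have hψs : ∀ α, HasCompactSupport (ψ α) := fun α =>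
    ((hDs α).comp_homeomorph (Homeomorph.neg (Sp d))).comp_left (g := fun z : ℝ => (z : ℂ)) (by simp)
  have hψi : ∀ α, Integrable (ψ α) := fun α =>
    (hψc α).integrable_of_hasCompactSupport (hψs α)
  let F : Sp d → ℂ := fun z => ∑ α, convolution (m α) (ψ α) (ContinuousLinearMap.mul ℂ ℂ) volume z
  have hFc : Continuous F := continuous_finsetSum _ fun α _ =>
    (hψs α).continuous_convolution_right _ (hm α).locallyIntegrable (hψc α)
  have hFi : ∀ α, Integrable (convolution (m α) (ψ α) (ContinuousLinearMap.mul ℂ ℂ) volume) :=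
    fun α => (hm α).integrable_convolution _ (hψi α)
  have hFint : Integrable F := integrable_finsetSum _ fun α _ => hFi α
  have hF0 : 𝓕 F = 0 := by
    funext ξ
    have e1 : 𝓕 F ξ = ∑ α, 𝓕 (m α) ξ * 𝓕 (ψ α) ξ := by
      simp only [← Real.fourier_mul_convolution_eq (hm _) (hψi _)]
      simp only [Real.fourier_eq, F, Finset.smul_sum]
      exact integral_finsetSum _ fun α _ =>
        (Real.fourierIntegral_convergent_iff ξ).2 (hFi α)
    have e2 : ∀ α, 𝓕 (ψ α) ξ = (∏ m, (-(2 * Real.pi * Complex.I * ξ (α.2 m)))) *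
        𝓕 (fun x => (φ x : ℂ)) (-ξ) := by
      intro α
      have h1 := Real.fourier_comp_linearIsometry (LinearIsometryEquiv.neg ℝ)
        (fun x => (partialD α φ x : ℂ)) ξ
      have h2 := fourier_partialD α (p := 2) (by exact_mod_cast hφ) hφc (-ξ)
      simp only [LinearIsometryEquiv.coe_neg] at h1
      rw [h2] at h1
      simp only [PiLp.neg_apply, Complex.ofReal_neg, mul_neg] at h1
      exact h1
    -- The transform of `F` at `ξ` is `𝓕 φ (-ξ)` times the functional evaluated on the exponential
    -- of frequency `-2π ξ`.
    have key := integral_ridge_exp_eq_zero hΩm hΩ hM hσ hC hnc h (-(2 * Real.pi) • ξ)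
    have e3 : ∑ α, 𝓕 (m α) ξ * (∏ m, (-(2 * Real.pi * Complex.I * ξ (α.2 m)))) = 0 := by
      rw [← key, integral_finsetSum]
      · refine Finset.sum_congr rfl fun α _ => ?_
        rw [Real.fourier_eq', ← integral_mul_const, ← integral_indicator hΩm]
        refine integral_congr_ae (Eventually.of_forall fun x => ?_)
        by_cases hx : x ∈ Ω
        · simp only [m, Set.indicator_of_mem hx, smul_eq_mul]
          rw [mul_comm (Complex.exp _), mul_right_comm]
          congr 2
          · refine Finset.prod_congr rfl fun i _ => ?_
            simp
            ring
          · rw [inner_smul_left, real_inner_comm]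
            simp
            ring
        · simp [m, Set.indicator_of_notMem hx]
      · intro α _
        refine (((hM α).ofReal).mul_const _).mul_bdd (c := 1) (by fun_prop)
          (Eventually.of_forall fun x => ?_)
        rw [Complex.norm_exp]
        simp
    rw [e1]
    simp only [e2, ← mul_assoc, ← Finset.sum_mul, e3, zero_mul, Pi.zero_apply]
  have hF : F = 0 := by
    -- Inversion holds pointwise because `F` is continuous and integrable and its transform, being
    -- zero, is integrable.
    have h1 := hFc.fourierInv_fourier_eq hFint (by rw [hF0]; exact integrable_zero _ _ _)
    rw [← h1, hF0]
    funext z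
    simp [Real.fourierInv_eq]
  have h0 : F 0 = ((∫ x in Ω, ∑ α, M α x * partialD α φ x : ℝ) : ℂ) := by
    simp only [F, convolution, zero_sub, ContinuousLinearMap.mul_apply', m, ψ, neg_neg]
    rw [integral_finsetSum]
    · rw [Complex.ofReal_sum]
      refine Finset.sum_congr rfl fun α _ => ?_
      rw [← integral_complex_ofReal, ← integral_indicator hΩm]
      refine integral_congr_ae (Eventually.of_forall fun x => ?_)
      by_cases hx : x ∈ Ω
      · simp [Set.indicator_of_mem hx]
      · simp [Set.indicator_of_notMem hx]
    · intro α _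
      obtain ⟨C, hC⟩ := (hDc α).bounded_above_of_compact_support (hDs α)
      exact (hM α).mul_bdd (c := C) (hDc α).aestronglyMeasurable (Eventually.of_forall hC)
  rw [hF, Pi.zero_apply] at h0
  exact_mod_cast h0.symm

end UniversalApproximation

/-! ### Bookkeeping for partial derivatives of order at most two -/

section PartialDerivatives

theorem natCast_le_infty (n : ℕ) : ((n : ℕ∞) : WithTop ℕ∞) ≤ ((⊤ : ℕ∞) : WithTop ℕ∞) := by
  exact_mod_cast le_top

theorem one_le_infty : (1 : WithTop ℕ∞) ≤ ((⊤ : ℕ∞) : WithTop ℕ∞) := natCast_le_infty 1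

theorem two_le_infty : (2 : WithTop ℕ∞) ≤ ((⊤ : ℕ∞) : WithTop ℕ∞) := natCast_le_infty 2

theorem three_le_infty : (3 : WithTop ℕ∞) ≤ ((⊤ : ℕ∞) : WithTop ℕ∞) := natCast_le_infty 3

variable {d : ℕ}

theorem idx_le {p : ℕ} (α : Idx d p) : (α.1 : ℕ) ≤ p := Nat.lt_succ_iff.1 α.1.2

theorem continuous_partialD {p : ℕ} (α : Idx d p) {φ : Sp d → ℝ} (hφ : ContDiff ℝ p φ) :
    Continuous (partialD α φ) :=
  (ContinuousMultilinearMap.apply ℝ _ ℝ _).continuous.comp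
    (hφ.continuous_iteratedFDeriv (by exact_mod_cast idx_le α))

theorem hasCompactSupport_partialD {p : ℕ} (α : Idx d p) {φ : Sp d → ℝ}
    (hφc : HasCompactSupport φ) : HasCompactSupport (partialD α φ) :=
  HasCompactSupport.comp_left (g := fun L : (Sp d) [×(α.1 : ℕ)]→L[ℝ] ℝ =>
    L fun m => EuclideanSpace.single (α.2 m) (1 : ℝ)) (hφc.iteratedFDeriv (𝕜 := ℝ) α.1) rfl

theorem partialD_idx0 {p : ℕ} (f : Sp d → ℝ) (x : Sp d) : partialD (idx0 d p) f x = f x := by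
  exact iteratedFDeriv_zero_apply _

/-- The `i`-th vector of the standard basis. -/
noncomputable abbrev bv (i : Fin d) : Sp d := EuclideanSpace.single i (1 : ℝ)

theorem partialD_one (i : Fin d) (f : Sp d → ℝ) (x : Sp d) :
    partialD (⟨1, ![i]⟩ : Idx d 2) f x = fderiv ℝ f x (bv i) := by
  unfold partialD
  exact iteratedFDeriv_one_apply _

theorem partialD_two (i j : Fin d) (f : Sp d → ℝ) (x : Sp d) :
    partialD (⟨2, ![i, j]⟩ : Idx d 2) f x = fderiv ℝ (fderiv ℝ f) x (bv i) (bv j) := by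
  unfold partialD
  exact iteratedFDeriv_two_apply f x _

theorem fderiv_fderiv_apply {E : Type*} [NormedAddCommGroup E] [NormedSpace ℝ E]
    {f : E → ℝ} (hf : ContDiff ℝ 2 f) (x v w : E) :
    fderiv ℝ (fderiv ℝ f) x w v = fderiv ℝ (fun y => fderiv ℝ f y v) x w := by
  rw [fderiv_clm_apply ((hf.fderiv_right (m := 1) le_rfl).differentiable (by norm_num) x)
    (differentiableAt_const v)]
  simp

theorem fderiv_fderiv_comm {E : Type*} [NormedAddCommGroup E] [NormedSpace ℝ E]
    {f : E → ℝ} (hf : ContDiff ℝ 2 f) (x v w : E) :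
    fderiv ℝ (fderiv ℝ f) x v w = fderiv ℝ (fderiv ℝ f) x w v :=
  (hf.contDiffAt.isSymmSndFDerivAt (by simp)).eq v w

theorem contDiff_fderiv_apply {E : Type*} [NormedAddCommGroup E] [NormedSpace ℝ E]
    {f : E → ℝ} {n m : ℕ∞} (hf : ContDiff ℝ n f) (h : m + 1 ≤ n) (v : E) :
    ContDiff ℝ m (fun y => fderiv ℝ f y v) :=
  (hf.fderiv_right (m := m) (by exact_mod_cast h)).clm_apply contDiff_const

end PartialDerivatives

/-! ### Radial mollifiers and their action on weak derivatives -/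

section Mollifier

variable {d : ℕ}

/-- The unnormalized radial bump `smoothTransition (ε² - |x|²)`. -/
noncomputable def preMollifier (ε : ℝ) (x : Sp d) : ℝ := Real.smoothTransition (ε ^ 2 - ‖x‖ ^ 2)

/-- A smooth radial mollifier supported in the ball of radius `ε`. -/
noncomputable def mollifier (ε : ℝ) (x : Sp d) : ℝ :=
  (∫ y : Sp d, preMollifier ε y)⁻¹ * preMollifier ε x

theorem contDiff_preMollifier (ε : ℝ) : ContDiff ℝ ∞ (preMollifier ε : Sp d → ℝ) :=
  Real.smoothTransition.contDiff.comp (contDiff_const.sub (contDiff_norm_sq ℝ))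

theorem contDiff_mollifier (ε : ℝ) : ContDiff ℝ ∞ (mollifier ε : Sp d → ℝ) :=
  contDiff_const.mul (contDiff_preMollifier ε)

theorem preMollifier_eq_zero {ε : ℝ} (hε : 0 < ε) {x : Sp d} (hx : ε ≤ ‖x‖) :
    preMollifier ε x = 0 := by
  refine Real.smoothTransition.zero_of_nonpos ?_
  have : ε ^ 2 ≤ ‖x‖ ^ 2 := by gcongr
  linarith

theorem mollifier_eq_zero {ε : ℝ} (hε : 0 < ε) {x : Sp d} (hx : ε ≤ ‖x‖) : mollifier ε x = 0 := by
  rw [mollifier, preMollifier_eq_zero hε hx, mul_zero]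

/-- Radial symmetry is what makes mollification commute with reflections, so that odd functions stay
odd. -/
theorem mollifier_congr_norm (ε : ℝ) {x y : Sp d} (h : ‖x‖ = ‖y‖) :
    mollifier ε x = mollifier ε y := by
  simp only [mollifier, preMollifier, h]

theorem hasCompactSupport_preMollifier {ε : ℝ} (hε : 0 < ε) :
    HasCompactSupport (preMollifier ε : Sp d → ℝ) :=
  HasCompactSupport.intro (isCompact_closedBall 0 ε) fun x hx => preMollifier_eq_zero hε (by
    rw [mem_closedBall_zero_iff, not_le] at hx; exact hx.le)

theorem hasCompactSupport_mollifier {ε : ℝ} (hε : 0 < ε) :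
    HasCompactSupport (mollifier ε : Sp d → ℝ) :=
  (hasCompactSupport_preMollifier hε).mul_left

theorem preMollifier_nonneg (ε : ℝ) (x : Sp d) : 0 ≤ preMollifier ε x :=
  Real.smoothTransition.nonneg _

theorem mollifier_nonneg (ε : ℝ) (x : Sp d) : 0 ≤ mollifier ε x :=
  mul_nonneg (inv_nonneg.2 (integral_nonneg fun _ => preMollifier_nonneg ε _))
    (preMollifier_nonneg ε x)

theorem integrable_mollifier {ε : ℝ} (hε : 0 < ε) : Integrable (mollifier ε : Sp d → ℝ) :=
  (contDiff_mollifier ε).continuous.integrable_of_hasCompactSupport (hasCompactSupport_mollifier hε)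

theorem integral_mollifier {ε : ℝ} (hε : 0 < ε) : ∫ x : Sp d, mollifier ε x = 1 := by
  simp only [mollifier]
  rw [integral_const_mul]
  refine inv_mul_cancel₀ (ne_of_gt ?_)
  refine (contDiff_preMollifier ε).continuous.integral_pos_of_hasCompactSupport_nonneg_nonzero
    (hasCompactSupport_preMollifier hε) (fun x => preMollifier_nonneg ε x) (x := 0) ?_
  refine (Real.smoothTransition.pos_of_pos ?_).ne'
  simpa using pow_pos hε 2

/-- The mollification of `q` by the kernel `ρ`. -/
noncomputable def moll (ρ q : Sp d → ℝ) (x : Sp d) : ℝ := ∫ t, ρ t * q (x - t)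

theorem moll_eq_convolution (ρ q : Sp d → ℝ) :
    moll ρ q = convolution ρ q (ContinuousLinearMap.mul ℝ ℝ) volume := rfl

theorem moll_eq (ρ q : Sp d → ℝ) (x : Sp d) : moll ρ q x = ∫ z, q z * ρ (x - z) := by
  unfold moll
  rw [← integral_sub_left_eq_self _ volume x]
  refine integral_congr_ae (Eventually.of_forall fun z => ?_)
  simp [mul_comm]

theorem contDiff_moll {ρ q : Sp d → ℝ} (hρ : ContDiff ℝ ∞ ρ) (hρc : HasCompactSupport ρ)
    (hq : LocallyIntegrable q) : ContDiff ℝ ∞ (moll ρ q) :=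
  hρc.contDiff_convolution_left (ContinuousLinearMap.mul ℝ ℝ) hρ hq

theorem fderiv_moll {ρ q : Sp d → ℝ} (hρ : ContDiff ℝ ∞ ρ) (hρc : HasCompactSupport ρ)
    (hq : LocallyIntegrable q) (x v : Sp d) :
    fderiv ℝ (moll ρ q) x v = moll (fun y => fderiv ℝ ρ y v) q x := by
  have h1 := (hρc.hasFDerivAt_convolution_left (ContinuousLinearMap.mul ℝ ℝ)
    (hρ.of_le one_le_infty) hq x).fderiv
  rw [moll_eq_convolution, h1]
  unfold convolution moll
  rw [ContinuousLinearMap.integral_apply]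
  · rfl
  · have h2 : Continuous (fderiv ℝ ρ) := hρ.continuous_fderiv (by simp)
    exact (hρc.fderiv (𝕜 := ℝ)).convolutionExists_left _ h2 hq x

/-- `g` is the weak derivative of `u` in direction `v` when tested on `C_c¹(O)`. -/
def WeakD (O : Set (Sp d)) (u g : Sp d → ℝ) (v : Sp d) : Prop :=
  ∀ χ : Sp d → ℝ, ContDiff ℝ 1 χ → HasCompactSupport χ → tsupport χ ⊆ O →
    ∫ x, u x * fderiv ℝ χ x v = - ∫ x, g x * χ x

theorem fderiv_reflect_apply {ρ : Sp d → ℝ} (hρ : Differentiable ℝ ρ) (x z v : Sp d) :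
    fderiv ℝ (fun z => ρ (x - z)) z v = - fderiv ℝ ρ (x - z) v := by
  have e : (fun z => ρ (x - z)) = ρ ∘ fun z => x - z := rfl
  have e' : HasFDerivAt (fun z => x - z) (-ContinuousLinearMap.id ℝ (Sp d)) z :=
    (hasFDerivAt_id z).const_sub x
  rw [e, ((hρ (x - z)).hasFDerivAt.comp z e').fderiv]
  simp

theorem hasCompactSupport_comp_const_sub {ρ : Sp d → ℝ} (hρ : HasCompactSupport ρ) (x : Sp d) :
    HasCompactSupport (fun z => ρ (x - z)) :=
  hρ.comp_homeomorph (Homeomorph.subLeft x)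

/-- Mollification turns weak derivatives into classical ones. -/
theorem fderiv_moll_of_weakD {ρ u g : Sp d → ℝ} (hρ : ContDiff ℝ ∞ ρ) (hρc : HasCompactSupport ρ)
    (hu : LocallyIntegrable u) {v : Sp d} (h : WeakD Set.univ u g v) (x : Sp d) :
    fderiv ℝ (moll ρ u) x v = moll ρ g x := by
  rw [fderiv_moll hρ hρc hu, moll_eq, moll_eq]
  have := h (fun z => ρ (x - z)) ((hρ.of_le one_le_infty).comp (by fun_prop))
    (hasCompactSupport_comp_const_sub hρc x) (Set.subset_univ _)
  simp only [fderiv_reflect_apply (hρ.differentiable (by simp)), mul_neg, integral_neg, neg_inj] at this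
  exact this

/-- `q` is the weak derivative `∂_w ∂_v u` on the whole space. -/
def WeakD₂ (u q : Sp d → ℝ) (v w : Sp d) : Prop :=
  ∀ χ : Sp d → ℝ, ContDiff ℝ ∞ χ → HasCompactSupport χ →
    ∫ x, u x * fderiv ℝ (fderiv ℝ χ) x w v = ∫ x, q x * χ x

/-- Both derivatives are first put on the kernel. The reflected kernel is then an admissible test
function, and the two signs from the reflection cancel. -/
theorem fderiv_fderiv_moll_of_weakD₂ {ρ u q : Sp d → ℝ} (hρ : ContDiff ℝ ∞ ρ)
    (hρc : HasCompactSupport ρ) (hu : LocallyIntegrable u) {v w : Sp d} (h : WeakD₂ u q v w)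
    (x : Sp d) : fderiv ℝ (fderiv ℝ (moll ρ u)) x w v = moll ρ q x := by
  have hρ2 : ContDiff ℝ 2 ρ := hρ.of_le two_le_infty
  have hρv : ContDiff ℝ ∞ (fun y => fderiv ℝ ρ y v) :=
    contDiff_fderiv_apply (n := ⊤) (m := ⊤) hρ (by simp) v
  have hρvc : HasCompactSupport (fun y => fderiv ℝ ρ y v) := hρc.fderiv_apply (𝕜 := ℝ) v
  rw [fderiv_fderiv_apply ((contDiff_moll hρ hρc hu).of_le two_le_infty)]
  simp only [fderiv_moll hρ hρc hu _ v]
  have e : (fun y => moll (fun y => fderiv ℝ ρ y v) u y) = moll (fun y => fderiv ℝ ρ y v) u := rfl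
  rw [e, fderiv_moll hρv hρvc hu, moll_eq, moll_eq]
  have := h (fun z => ρ (x - z)) (hρ.comp (by fun_prop)) (hasCompactSupport_comp_const_sub hρc x)
  rw [← this]
  refine integral_congr_ae (Eventually.of_forall fun z => ?_)
  have h2 : ContDiff ℝ 2 (fun z => ρ (x - z)) := hρ2.comp (by fun_prop)
  simp only
  rw [fderiv_fderiv_apply h2]
  simp only [fderiv_reflect_apply (hρ.differentiable (by simp))]
  rw [fderiv_fun_neg]
  have h3 := fderiv_reflect_apply (hρv.differentiable (by simp)) x z w
  rw [neg_apply, h3, neg_neg]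

end Mollifier

/-! ### Weak `L²` convergence of mollifications -/

section WeakConvergence

variable {d : ℕ}

theorem integrable_mul_of_memLp_two {X : Type*} [MeasurableSpace X] {ν : Measure X} {f g : X → ℝ}
    (hf : MemLp f 2 ν) (hg : MemLp g 2 ν) : Integrable (fun x => f x * g x) ν :=
  hf.integrable_mul hg

/-- Correlations of `L²` functions are continuous in the shift. -/
theorem continuous_integral_mul_shift {m q : Sp d → ℝ} (hm : MemLp m 2) (hq : MemLp q 2) :
    Continuous fun v => ∫ x, m x * q (x - v) := by
  let T : Sp d → C(Sp d, Sp d) := fun v => ⟨fun x => x - v, by fun_prop⟩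
  have hT : Continuous T :=
    (ContinuousMap.curry ⟨fun p : Sp d × Sp d => p.2 - p.1, by fun_prop⟩).continuous
  have hmp : ∀ v, MeasurePreserving (T v) volume volume := fun v =>
    measurePreserving_sub_right volume v
  have hc : Continuous fun v => Lp.compMeasurePreserving (T v) (hmp v) (hq.toLp q) :=
    Continuous.compMeasurePreservingLp continuous_const hT hmp (by simp)
  have e : (fun v => ∫ x, m x * q (x - v)) = fun v =>
      inner ℝ (hm.toLp m) (Lp.compMeasurePreserving (T v) (hmp v) (hq.toLp q)) := by
    funext v
    rw [L2.inner_def]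
    refine integral_congr_ae ?_
    filter_upwards [hm.coeFn_toLp, Lp.coeFn_compMeasurePreserving (hq.toLp q) (hmp v),
      (hmp v).quasiMeasurePreserving.ae_eq_comp hq.coeFn_toLp] with x h1 h2 h3
    rw [h1, h2, h3]
    simp [T, mul_comm]
  rw [e]
  exact continuous_const.inner hc

/-- By `|a b| ≤ a² + b²` the integrand is dominated by `m² |ρ|` plus `|ρ| q²` shifted. The first is
a product of integrable functions, the second a convolution integrand. -/
theorem integrable_mollify_prod {ρ m q : Sp d → ℝ} (hρ : Continuous ρ) (hρi : Integrable ρ)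
    (hm : MemLp m 2) (hq : MemLp q 2) :
    Integrable (fun p : Sp d × Sp d => m p.1 * (ρ p.2 * q (p.1 - p.2))) (volume.prod volume) := by
  have h1 : Integrable (fun p : Sp d × Sp d => m p.1 ^ 2 * |ρ p.2|) (volume.prod volume) :=
    hm.integrable_sq.mul_prod hρi.abs
  have h2 : Integrable (fun p : Sp d × Sp d => |ρ p.2| * q (p.1 - p.2) ^ 2)
      (volume.prod volume) :=
    hρi.abs.convolution_integrand (ContinuousLinearMap.mul ℝ ℝ) hq.integrable_sq
  refine (h1.add h2).mono ?_ (Eventually.of_forall fun p => ?_)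
  · refine (hm.1.comp_fst (ν := volume)).mul ((hρ.aestronglyMeasurable.comp_snd
      (μ := volume)).mul ?_)
    exact hq.1.comp_quasiMeasurePreserving (quasiMeasurePreserving_sub volume volume)
  · simp only [Pi.add_apply, Real.norm_eq_abs]
    rw [abs_mul, abs_mul, abs_of_nonneg (by positivity :
      0 ≤ m p.1 ^ 2 * |ρ p.2| + |ρ p.2| * q (p.1 - p.2) ^ 2), ← sq_abs (m p.1),
      ← sq_abs (q (p.1 - p.2))]
    generalize |m p.1| = a
    generalize |q (p.1 - p.2)| = b
    have h0 := abs_nonneg (ρ p.2)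
    generalize |ρ p.2| = c at h0
    nlinarith [mul_nonneg h0 (sq_nonneg (a - b)), mul_nonneg h0 (sq_nonneg a),
      mul_nonneg h0 (sq_nonneg b)]

theorem integral_mul_moll {ρ m q : Sp d → ℝ} (hρ : Continuous ρ) (hρi : Integrable ρ)
    (hm : MemLp m 2) (hq : MemLp q 2) :
    ∫ x, m x * moll ρ q x = ∫ v, ρ v * ∫ x, m x * q (x - v) := by
  have e1 : ∫ x, m x * moll ρ q x = ∫ x, ∫ v, m x * (ρ v * q (x - v)) := by
    simp only [moll, integral_const_mul]
  rw [e1, integral_integral_swap (integrable_mollify_prod hρ hρi hm hq)]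
  refine integral_congr_ae (Eventually.of_forall fun v => ?_)
  simp only
  rw [← integral_const_mul]
  refine integral_congr_ae (Eventually.of_forall fun x => ?_)
  simp only
  ring

/-- Mollifications converge weakly in `L²`. -/
theorem tendsto_integral_mul_moll {m q : Sp d → ℝ} (hm : MemLp m 2) (hq : MemLp q 2) :
    Tendsto (fun ε => ∫ x, m x * moll (mollifier ε) q x) (𝓝[>] 0) (𝓝 (∫ x, m x * q x)) := by
  -- The pairing with the mollification is the average of `Φ` against a probability kernel
  -- concentrating at `0`, and `Φ` is continuous.
  set Φ : Sp d → ℝ := fun v => ∫ x, m x * q (x - v) with hΦ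
  have hΦc : Continuous Φ := continuous_integral_mul_shift hm hq
  have hΦ0 : Φ 0 = ∫ x, m x * q x := by simp [hΦ]
  rw [← hΦ0, Metric.tendsto_nhds]
  intro η hη
  obtain ⟨δ, hδ, hδ'⟩ := Metric.continuous_iff.1 hΦc 0 (η / 2) (half_pos hη)
  filter_upwards [Ioo_mem_nhdsGT hδ] with ε hε
  have hρi := integrable_mollifier (d := d) hε.1
  have hρc := (contDiff_mollifier (d := d) ε).continuous
  have hi : Integrable fun v => mollifier ε v * Φ v :=
    (hρc.mul hΦc).integrable_of_hasCompactSupport (hasCompactSupport_mollifier hε.1).mul_right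
  rw [integral_mul_moll hρc hρi hm hq, dist_eq_norm]
  have e : (∫ v, mollifier ε v * Φ v) - Φ 0 = ∫ v, mollifier ε v * (Φ v - Φ 0) := by
    simp only [mul_sub]
    rw [integral_sub hi (hρi.mul_const _), integral_mul_const, integral_mollifier hε.1, one_mul]
  rw [e]
  refine (norm_integral_le_of_norm_le (hρi.mul_const (η / 2))
    (Eventually.of_forall fun v => ?_)).trans_lt ?_
  · rw [norm_mul, Real.norm_of_nonneg (mollifier_nonneg ε v)]
    by_cases hv : ε ≤ ‖v‖
    · rw [mollifier_eq_zero hε.1 hv]; simp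
    · refine mul_le_mul_of_nonneg_left ?_ (mollifier_nonneg ε v)
      have := hδ' v (by rw [dist_zero_right]; exact (not_le.1 hv).trans hε.2)
      rw [← dist_eq_norm]
      exact this.le
  · rw [integral_mul_const, integral_mollifier hε.1, one_mul]
    exact half_lt_self hη

end WeakConvergence

/-! ### Smooth test functions suffice for weak derivatives -/

section WeakDerivative

variable {d : ℕ}

theorem tsupport_moll_subset {ε : ℝ} (hε : 0 < ε) {q : Sp d → ℝ} :
    tsupport (moll (mollifier ε) q) ⊆ Metric.cthickening ε (tsupport q) := by
  refine closure_minimal (fun x hx => ?_) Metric.isClosed_cthickening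
  by_contra hne
  refine hx ?_
  unfold moll
  refine integral_eq_zero_of_ae (Eventually.of_forall fun t => ?_)
  by_cases ht : ε ≤ ‖t‖
  · simp [mollifier_eq_zero hε ht]
  · have : q (x - t) = 0 := by
      by_contra hq
      refine hne (Metric.mem_cthickening_of_dist_le x (x - t) ε _ (subset_tsupport q hq) ?_)
      rw [dist_eq_norm]
      simpa using (not_le.1 ht).le
    simp [this]

theorem hasCompactSupport_moll {ε : ℝ} (hε : 0 < ε) {q : Sp d → ℝ} (hq : HasCompactSupport q) :
    HasCompactSupport (moll (mollifier ε) q) :=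
  IsCompact.of_isClosed_subset (IsCompact.cthickening hq) (isClosed_tsupport _)
    (tsupport_moll_subset hε)

theorem weakD_of_classical {χ : Sp d → ℝ} (hχ : ContDiff ℝ 1 χ) (hχc : HasCompactSupport χ)
    (v : Sp d) : WeakD Set.univ χ (fun x => fderiv ℝ χ x v) v := by
  intro ψ hψ hψc _
  have c1 : Continuous fun x => fderiv ℝ χ x v := (hχ.continuous_fderiv (by simp)).clm_apply
    continuous_const
  have c2 : Continuous fun x => fderiv ℝ ψ x v := (hψ.continuous_fderiv (by simp)).clm_apply
    continuous_const
  refine integral_mul_fderiv_eq_neg_fderiv_mul_of_integrable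
    ((c1.mul hψ.continuous).integrable_of_hasCompactSupport hψc.mul_left)
    ((hχ.continuous.mul c2).integrable_of_hasCompactSupport hχc.mul_right)
    ((hχ.continuous.mul hψ.continuous).integrable_of_hasCompactSupport hψc.mul_left)
    (fun x _ => hχ.differentiable (by simp) x) (fun x _ => hψ.differentiable (by simp) x)

/-- To check a weak derivative it is enough to test with smooth functions. -/
theorem weakD_of_smooth {O : Set (Sp d)} (hO : IsOpen O) {u g : Sp d → ℝ} (hu : MemLp u 2)
    (hg : MemLp g 2) {v : Sp d}
    (h : ∀ χ : Sp d → ℝ, ContDiff ℝ ∞ χ → HasCompactSupport χ → tsupport χ ⊆ O →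
      ∫ x, u x * fderiv ℝ χ x v = - ∫ x, g x * χ x) : WeakD O u g v := by
  intro χ hχ hχc hχO
  have cD : Continuous fun x => fderiv ℝ χ x v := (hχ.continuous_fderiv (by simp)).clm_apply
    continuous_const
  have mD : MemLp (fun x => fderiv ℝ χ x v) 2 :=
    cD.memLp_of_hasCompactSupport (hχc.fderiv_apply (𝕜 := ℝ) v)
  have mχ : MemLp χ 2 := hχ.continuous.memLp_of_hasCompactSupport hχc
  have hl : LocallyIntegrable χ := hχ.continuous.locallyIntegrable
  have t1 := tendsto_integral_mul_moll hu mD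
  have t2 := (tendsto_integral_mul_moll hg mχ).neg
  refine tendsto_nhds_unique (t1.congr' ?_) t2
  -- For small `ε` the mollified test function is still supported in `O`, so the hypothesis applies
  -- to it; both sides pass to the limit by weak convergence.
  obtain ⟨δ, hδ, hδO⟩ := hχc.exists_cthickening_subset_open hO hχO
  filter_upwards [Ioo_mem_nhdsGT hδ] with ε hε
  have hs := contDiff_mollifier (d := d) ε
  have hsc := hasCompactSupport_mollifier (d := d) hε.1
  have := h (moll (mollifier ε) χ) (contDiff_moll hs hsc hl) (hasCompactSupport_moll hε.1 hχc)
    ((tsupport_moll_subset hε.1).trans ((Metric.cthickening_mono hε.2.le _).trans hδO))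
  simp only [fderiv_moll_of_weakD hs hsc hl (weakD_of_classical hχ hχc v)] at this
  exact this

end WeakDerivative

/-! ### Calculus of weak derivatives and localization by cutoffs -/

section WeakCalculus

variable {d : ℕ} {O O' : Set (Sp d)} {u u' g g' : Sp d → ℝ} {v : Sp d}

theorem WeakD.mono (h : WeakD O u g v) (hO : O' ⊆ O) : WeakD O' u g v :=
  fun χ h1 h2 h3 => h χ h1 h2 (h3.trans hO)

theorem integrable_mul_test {c : Sp d → ℝ} (hu : MemLp u 2) (hc : Continuous c)
    (hcs : HasCompactSupport c) : Integrable fun x => u x * c x :=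
  integrable_mul_of_memLp_two hu (hc.memLp_of_hasCompactSupport hcs)

theorem continuous_fderiv_apply_const {χ : Sp d → ℝ} (hχ : ContDiff ℝ 1 χ) (v : Sp d) :
    Continuous fun x => fderiv ℝ χ x v :=
  (hχ.continuous_fderiv (by simp)).clm_apply continuous_const

theorem WeakD.add (h : WeakD O u g v) (h' : WeakD O u' g' v) (hu : MemLp u 2) (hu' : MemLp u' 2)
    (hg : MemLp g 2) (hg' : MemLp g' 2) :
    WeakD O (fun x => u x + u' x) (fun x => g x + g' x) v := by
  intro χ hχ hχc hχO
  have c1 := continuous_fderiv_apply_const hχ v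
  have s1 := hχc.fderiv_apply (𝕜 := ℝ) v
  simp only [add_mul]
  rw [integral_add (integrable_mul_test hu c1 s1) (integrable_mul_test hu' c1 s1),
    integral_add (integrable_mul_test hg hχ.continuous hχc)
      (integrable_mul_test hg' hχ.continuous hχc), h χ hχ hχc hχO, h' χ hχ hχc hχO]
  ring

/-- Leibniz rule for weak derivatives. -/
theorem WeakD.mul (h : WeakD O u g v) (hu : MemLp u 2) (hg : MemLp g 2) {ζ : Sp d → ℝ}
    (hζ : ContDiff ℝ 1 ζ) (hO : O' ∩ tsupport ζ ⊆ O) :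
    WeakD O' (fun x => ζ x * u x) (fun x => ζ x * g x + fderiv ℝ ζ x v * u x) v := by
  intro χ hχ hχc hχO
  have c1 := continuous_fderiv_apply_const hχ v
  have s1 := hχc.fderiv_apply (𝕜 := ℝ) v
  have c2 := continuous_fderiv_apply_const hζ v
  have key := h (fun x => ζ x * χ x) (hζ.mul hχ) hχc.mul_left
    (fun x hx => hO ⟨hχO (tsupport_mul_subset_right hx), tsupport_mul_subset_left hx⟩)
  have hd : ∀ x, fderiv ℝ (fun x => ζ x * χ x) x v =
      ζ x * fderiv ℝ χ x v + fderiv ℝ ζ x v * χ x := by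
    intro x
    rw [fderiv_fun_mul (hζ.differentiable (by simp) x) (hχ.differentiable (by simp) x)]
    simp [mul_comm]
  simp only [hd, mul_add] at key
  have i1 : Integrable fun x => u x * (ζ x * fderiv ℝ χ x v) :=
    integrable_mul_test hu (hζ.continuous.mul c1) s1.mul_left
  have i2 : Integrable fun x => u x * (fderiv ℝ ζ x v * χ x) :=
    integrable_mul_test hu (c2.mul hχ.continuous) hχc.mul_left
  have i3 : Integrable fun x => g x * (ζ x * χ x) :=
    integrable_mul_test hg (hζ.continuous.mul hχ.continuous) hχc.mul_left
  rw [integral_add i1 i2] at key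
  have e1 : ∫ x, ζ x * u x * fderiv ℝ χ x v = ∫ x, u x * (ζ x * fderiv ℝ χ x v) :=
    integral_congr_ae (Eventually.of_forall fun x => by ring)
  have e2 : ∫ x, (ζ x * g x + fderiv ℝ ζ x v * u x) * χ x =
      (∫ x, g x * (ζ x * χ x)) + ∫ x, u x * (fderiv ℝ ζ x v * χ x) := by
    rw [← integral_add i3 i2]
    exact integral_congr_ae (Eventually.of_forall fun x => by ring)
  rw [e1, e2]
  linarith

/-- The coefficients arising from a chart are continuous but possibly unbounded on the whole space;
compact support of the other factor makes up for that. -/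
theorem memLp_continuous_mul {c : Sp d → ℝ} (hc : Continuous c) (hu : MemLp u 2) {K : Set (Sp d)}
    (hK : IsCompact K) (h0 : ∀ x, x ∉ K → u x = 0) : MemLp (fun x => c x * u x) 2 := by
  obtain ⟨C, hC⟩ := hK.exists_bound_of_continuousOn hc.continuousOn
  refine hu.of_le_mul (c := C) (hc.aestronglyMeasurable.mul hu.1) (Eventually.of_forall fun x => ?_)
  by_cases hx : x ∈ K
  · rw [norm_mul]; exact mul_le_mul_of_nonneg_right (hC x hx) (norm_nonneg _)
  · simp [h0 x hx]

/-- A function with weak derivatives up to order two: `f` and `p v = ∂_v f` in `L²(ℝ^d)`, where the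
second derivatives `q v w = ∂_w ∂_v f` only need to be weak derivatives in `O`. -/
structure H2Data (O : Set (Sp d)) (f : Sp d → ℝ) (p : Sp d → Sp d → ℝ)
    (q : Sp d → Sp d → Sp d → ℝ) : Prop where
  memf : MemLp f 2
  memp : ∀ v, MemLp (p v) 2
  memq : ∀ v w, MemLp (q v w) 2
  p_add : ∀ v v' x, p (v + v') x = p v x + p v' x
  p_smul : ∀ (c : ℝ) v x, p (c • v) x = c * p v x
  q_symm : ∀ v w x, q v w x = q w v x
  q_add : ∀ v v' w x, q (v + v') w x = q v w x + q v' w x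
  q_smul : ∀ (c : ℝ) v w x, q (c • v) w x = c * q v w x
  weak_one : ∀ v, WeakD Set.univ f (p v) v
  weak_two : ∀ v w, WeakD O (p v) (q v w) w

/-- The family `(f, p, q)` vanishes outside `K`. -/
def SupportedIn (K : Set (Sp d)) (f : Sp d → ℝ) (p : Sp d → Sp d → ℝ)
    (q : Sp d → Sp d → Sp d → ℝ) : Prop :=
  ∀ x, x ∉ K → f x = 0 ∧ (∀ v, p v x = 0) ∧ ∀ v w, q v w x = 0

variable {f : Sp d → ℝ} {p : Sp d → Sp d → ℝ} {q : Sp d → Sp d → Sp d → ℝ}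

theorem memLp_mul_of_hasCompactSupport {c : Sp d → ℝ} (hc : Continuous c)
    (hcs : HasCompactSupport c) (hu : MemLp u 2) : MemLp (fun x => c x * u x) 2 := by
  obtain ⟨C, hC⟩ := hcs.exists_bound_of_continuous hc
  refine hu.of_le_mul (c := C) (hc.aestronglyMeasurable.mul hu.1) (Eventually.of_forall fun x => ?_)
  rw [norm_mul]; exact mul_le_mul_of_nonneg_right (hC x) (norm_nonneg _)

/-- Multiplication by a cutoff changes the domain of the second derivatives: only the part of `O'`
met by the support of `ζ` has to lie in `O`. A cutoff inside `Ω` therefore produces global data, and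
a cutoff inside a boundary patch produces data on the whole region above the graph. -/
theorem H2Data.mul (h : H2Data O f p q) {ζ : Sp d → ℝ} (hζ : ContDiff ℝ ∞ ζ)
    (hζc : HasCompactSupport ζ) (hO : O' ∩ tsupport ζ ⊆ O) :
    H2Data O' (fun x => ζ x * f x) (fun v x => ζ x * p v x + fderiv ℝ ζ x v * f x)
      (fun v w x => (ζ x * q v w x + fderiv ℝ ζ x w * p v x) +
        (fderiv ℝ ζ x v * p w x + fderiv ℝ (fderiv ℝ ζ) x w v * f x)) := by
  have hζ1 : ContDiff ℝ 1 ζ := hζ.of_le one_le_infty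
  have hζ2 : ContDiff ℝ 2 ζ := hζ.of_le two_le_infty
  have hζv : ∀ v, ContDiff ℝ 1 fun x => fderiv ℝ ζ x v := fun v =>
    contDiff_fderiv_apply (n := 2) (m := 1) hζ2 (by norm_num) v
  have sv : ∀ v, HasCompactSupport fun x => fderiv ℝ ζ x v := fun v => hζc.fderiv_apply (𝕜 := ℝ) v
  have cvw : ∀ v w, Continuous fun x => fderiv ℝ (fderiv ℝ ζ) x w v := fun v w => by
    simp only [fderiv_fderiv_apply hζ2]
    exact continuous_fderiv_apply_const (hζv v) w
  have svw : ∀ v w, HasCompactSupport fun x => fderiv ℝ (fderiv ℝ ζ) x w v := fun v w => by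
    simp only [fderiv_fderiv_apply hζ2]
    exact (sv v).fderiv_apply (𝕜 := ℝ) w
  have m0 : ∀ {u : Sp d → ℝ}, MemLp u 2 → MemLp (fun x => ζ x * u x) 2 :=
    memLp_mul_of_hasCompactSupport hζ.continuous hζc
  have m1 : ∀ {u : Sp d → ℝ} v, MemLp u 2 → MemLp (fun x => fderiv ℝ ζ x v * u x) 2 :=
    fun v => memLp_mul_of_hasCompactSupport (hζv v).continuous (sv v)
  have m2 : ∀ {u : Sp d → ℝ} v w, MemLp u 2 →
      MemLp (fun x => fderiv ℝ (fderiv ℝ ζ) x w v * u x) 2 :=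
    fun v w => memLp_mul_of_hasCompactSupport (cvw v w) (svw v w)
  refine ⟨m0 h.memf, fun v => (m0 (h.memp v)).add (m1 v h.memf), fun v w =>
    ((m0 (h.memq v w)).add (m1 w (h.memp v))).add ((m1 v (h.memp w)).add (m2 v w h.memf)),
    fun v v' x => ?_, fun c v x => ?_, fun v w x => ?_, fun v v' w x => ?_, fun c v w x => ?_,
    fun v => ?_, fun v w => ?_⟩
  · rw [h.p_add, map_add]; ring
  · rw [h.p_smul, map_smul, smul_eq_mul]; ring
  · rw [h.q_symm, fderiv_fderiv_comm hζ2 x w v]; ring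
  · rw [h.q_add, h.p_add, map_add, map_add]; ring
  · rw [h.q_smul, h.p_smul, map_smul, map_smul, smul_eq_mul, smul_eq_mul]; ring
  · exact (h.weak_one v).mul h.memf (h.memp v) hζ1 (Set.subset_univ _)
  · have w1 := (h.weak_two v w).mul (h.memp v) (h.memq v w) hζ1 hO
    have w2 := (h.weak_one w).mul (O' := O') h.memf (h.memp w) (hζv v) (Set.subset_univ _)
    simp only [← fderiv_fderiv_apply hζ2] at w2
    exact w1.add w2 (m0 (h.memp v)) (m1 v h.memf) ((m0 (h.memq v w)).add (m1 w (h.memp v)))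
      ((m1 v (h.memp w)).add (m2 v w h.memf))

theorem SupportedIn.mul (ζ : Sp d → ℝ) {K : Set (Sp d)} (h : SupportedIn K f p q) :
    SupportedIn (K ∩ tsupport ζ) (fun x => ζ x * f x)
      (fun v x => ζ x * p v x + fderiv ℝ ζ x v * f x)
      (fun v w x => (ζ x * q v w x + fderiv ℝ ζ x w * p v x) +
        (fderiv ℝ ζ x v * p w x + fderiv ℝ (fderiv ℝ ζ) x w v * f x)) := by
  intro x hx
  by_cases hK : x ∈ K
  · have h0 : x ∉ tsupport ζ := fun h => hx ⟨hK, h⟩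
    have h1 : ζ x = 0 := image_eq_zero_of_notMem_tsupport h0
    have h2 : fderiv ℝ ζ x = 0 := image_eq_zero_of_notMem_tsupport
      fun h => h0 (tsupport_fderiv_subset ℝ h)
    have h3 : fderiv ℝ (fderiv ℝ ζ) x = 0 := image_eq_zero_of_notMem_tsupport
      fun h => h0 (tsupport_fderiv_subset ℝ (tsupport_fderiv_subset ℝ h))
    simp [h1, h2, h3]
  · obtain ⟨h1, h2, h3⟩ := h x hK
    simp [h1, h2, h3]

end WeakCalculus

/-! ### The volume preserving shear that flattens a graph -/

section Shear

variable {d : ℕ}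

/-- `γ` is a `C³` function invariant under translations along `e`. -/
structure ShearFn (γ : Sp d → ℝ) (e : Sp d) : Prop where
  smooth : ContDiff ℝ 3 γ
  inv : ∀ (x : Sp d) (τ : ℝ), γ (x + τ • e) = γ x

/-- The shear `x ↦ x - γ(x) e`. -/
def shear (γ : Sp d → ℝ) (e : Sp d) (x : Sp d) : Sp d := x - γ x • e

/-- The inverse shear `y ↦ y + γ(y) e`. -/
def unshear (γ : Sp d → ℝ) (e : Sp d) (y : Sp d) : Sp d := y + γ y • e

variable {γ : Sp d → ℝ} {e : Sp d}

theorem ShearFn.inv_sub (h : ShearFn γ e) (x : Sp d) (τ : ℝ) : γ (x - τ • e) = γ x := by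
  have := h.inv x (-τ)
  rwa [neg_smul, ← sub_eq_add_neg] at this

theorem ShearFn.shear_unshear (h : ShearFn γ e) (y : Sp d) : shear γ e (unshear γ e y) = y := by
  simp only [shear, unshear, h.inv, add_sub_cancel_right]

theorem ShearFn.unshear_shear (h : ShearFn γ e) (x : Sp d) : unshear γ e (shear γ e x) = x := by
  simp only [shear, unshear, h.inv_sub, sub_add_cancel]

theorem ShearFn.contDiff_shear (h : ShearFn γ e) : ContDiff ℝ 3 (shear γ e) :=
  contDiff_id.sub (h.smooth.smul contDiff_const)

theorem ShearFn.contDiff_unshear (h : ShearFn γ e) : ContDiff ℝ 3 (unshear γ e) :=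
  contDiff_id.add (h.smooth.smul contDiff_const)

/-- The shear as a homeomorphism. -/
def ShearFn.homeo (h : ShearFn γ e) : Sp d ≃ₜ Sp d where
  toFun := shear γ e
  invFun := unshear γ e
  left_inv := h.unshear_shear
  right_inv := h.shear_unshear
  continuous_toFun := h.contDiff_shear.continuous
  continuous_invFun := h.contDiff_unshear.continuous

theorem ShearFn.hasFDerivAt_shear (h : ShearFn γ e) (x : Sp d) :
    HasFDerivAt (shear γ e) (ContinuousLinearMap.id ℝ (Sp d) - (fderiv ℝ γ x).smulRight e) x :=
  (hasFDerivAt_id x).sub ((h.smooth.differentiable (by norm_num) x).hasFDerivAt.smul_const e)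

theorem fderiv_apply_eq_zero_of_inv {φ : Sp d → ℝ} (hφ : Differentiable ℝ φ)
    (h : ∀ (x : Sp d) (τ : ℝ), φ (x + τ • e) = φ x) (x : Sp d) : fderiv ℝ φ x e = 0 := by
  rw [← (hφ x).lineDeriv_eq_fderiv]
  unfold lineDeriv
  simp [h]

theorem ShearFn.fderiv_self (h : ShearFn γ e) (x : Sp d) : fderiv ℝ γ x e = 0 :=
  fderiv_apply_eq_zero_of_inv (h.smooth.differentiable (by norm_num)) h.inv x

theorem ShearFn.contDiff_fderiv_apply (h : ShearFn γ e) (v : Sp d) :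
    ContDiff ℝ 2 fun x => fderiv ℝ γ x v :=
  DGM.contDiff_fderiv_apply (n := 3) (m := 2) h.smooth (by norm_num) v

theorem ShearFn.fderiv_inv (h : ShearFn γ e) (x : Sp d) (τ : ℝ) :
    fderiv ℝ γ (x + τ • e) = fderiv ℝ γ x := by
  have : (fun y => γ (y + τ • e)) = γ := funext fun y => h.inv y τ
  conv_rhs => rw [← this]
  rw [fderiv_comp_add_right]

theorem ShearFn.fderiv_fderiv_self (h : ShearFn γ e) (v x : Sp d) :
    fderiv ℝ (fun x => fderiv ℝ γ x v) x e = 0 :=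
  fderiv_apply_eq_zero_of_inv ((h.contDiff_fderiv_apply v).differentiable (by norm_num))
    (fun x τ => by rw [h.fderiv_inv]) x

/-- The Jacobian is the transvection `v ↦ v - dγ(v) e`. Its determinant is `1 - dγ(e) = 1`, because
`γ` is invariant along `e`. -/
theorem ShearFn.measurePreserving (h : ShearFn γ e) :
    MeasurePreserving (shear γ e) volume volume := by
  have hinj : Function.Injective (shear γ e) := h.homeo.injective
  have hdet : ∀ x, (ContinuousLinearMap.id ℝ (Sp d) - (fderiv ℝ γ x).smulRight e).det = 1 := by
    intro x
    have e1 : ((ContinuousLinearMap.id ℝ (Sp d) - (fderiv ℝ γ x).smulRight e :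
        Sp d →L[ℝ] Sp d) : Sp d →ₗ[ℝ] Sp d) =
        LinearMap.transvection ((fderiv ℝ γ x : Sp d →L[ℝ] ℝ) : Sp d →ₗ[ℝ] ℝ) (-e) := by
      ext y : 1
      simp [LinearMap.transvection, sub_eq_add_neg]
    rw [ContinuousLinearMap.det, e1, LinearMap.transvection.det]
    simp [h.fderiv_self]
  have himg : ∀ s, MeasurableSet s → volume (shear γ e '' s) = volume s := by
    intro s hs
    rw [← lintegral_abs_det_fderiv_eq_addHaar_image volume hs
      (fun x _ => (h.hasFDerivAt_shear x).hasFDerivWithinAt) hinj.injOn]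
    simp [hdet]
  refine ⟨h.homeo.continuous.measurable, Measure.ext fun s hs => ?_⟩
  have hm : Measurable (shear γ e) := h.homeo.continuous.measurable
  rw [Measure.map_apply hm hs, ← himg _ (hm hs)]
  congr 1
  exact Set.image_preimage_eq s h.homeo.surjective

theorem ShearFn.measurePreserving_unshear (h : ShearFn γ e) :
    MeasurePreserving (unshear γ e) volume volume :=
  MeasurePreserving.symm (e := h.homeo.toMeasurableEquiv) h.measurePreserving

theorem ShearFn.integral_comp_unshear (h : ShearFn γ e) (G : Sp d → ℝ) :
    ∫ y, G (unshear γ e y) = ∫ x, G x :=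
  h.measurePreserving_unshear.integral_comp h.homeo.symm.measurableEmbedding G

theorem ShearFn.fderiv_comp_shear (h : ShearFn γ e) {χ : Sp d → ℝ} (hχ : Differentiable ℝ χ)
    (x v : Sp d) : fderiv ℝ (fun x => χ (shear γ e x)) x v =
      fderiv ℝ χ (shear γ e x) v - fderiv ℝ γ x v * fderiv ℝ χ (shear γ e x) e := by
  have := ((hχ (shear γ e x)).hasFDerivAt.comp x (h.hasFDerivAt_shear x)).fderiv
  have e1 : (fun x => χ (shear γ e x)) = χ ∘ shear γ e := rfl
  rw [e1, this]
  simp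

variable {O O' : Set (Sp d)} {u g ge : Sp d → ℝ} {v : Sp d}

/-- Weak derivatives of `u ∘ unshear`. -/
theorem WeakD.shear (h : ShearFn γ e) (hv : WeakD O u g v) (he : WeakD O u ge e)
    (hu : MemLp u 2) (hg : MemLp g 2) (hge : MemLp ge 2) (hO : ∀ x, shear γ e x ∈ O' → x ∈ O) :
    WeakD O' (fun y => u (unshear γ e y))
      (fun y => g (unshear γ e y) +
        fderiv ℝ γ (unshear γ e y) v * ge (unshear γ e y)) v := by
  intro χ hχ hχc hχO
  let χ' : Sp d → ℝ := fun x => χ (DGM.shear γ e x)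
  have hχ' : ContDiff ℝ 1 χ' := hχ.comp (h.contDiff_shear.of_le (by norm_num))
  have hχc' : HasCompactSupport χ' := hχc.comp_homeomorph h.homeo
  have hχO' : tsupport χ' ⊆ O := fun x hx => hO x (hχO (tsupport_comp_subset_preimage χ
    h.contDiff_shear.continuous hx))
  have hdiff := hχ.differentiable (by simp)
  have c1 : ContDiff ℝ 1 fun x => fderiv ℝ γ x v := (h.contDiff_fderiv_apply v).of_le (by norm_num)
  have k1 := hv χ' hχ' hχc' hχO'
  -- Leibniz rule in direction `e` with coefficient `∂_v γ`. This coefficient does not vary along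
  -- `e`, so no extra term appears.
  have k2 := (he.mul (O' := O) hu hge c1 Set.inter_subset_left) χ' hχ' hχc' hχO'
  simp only [h.fderiv_fderiv_self, zero_mul, add_zero] at k2
  -- The chain rule solved for the derivative of `χ`: a derivative in direction `v` in flat
  -- coordinates is a combination of derivatives in directions `v` and `e` upstairs.
  have e0 : ∀ y, fderiv ℝ χ y v = fderiv ℝ χ' (unshear γ e y) v +
      fderiv ℝ γ (unshear γ e y) v * fderiv ℝ χ' (unshear γ e y) e := by
    intro y
    simp only [χ', h.fderiv_comp_shear hdiff, h.shear_unshear, h.fderiv_self]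
    ring
  have e1 : ∫ y, u (unshear γ e y) * fderiv ℝ χ y v =
      ∫ x, (u x * fderiv ℝ χ' x v + fderiv ℝ γ x v * u x * fderiv ℝ χ' x e) := by
    refine Eq.trans ?_ (h.integral_comp_unshear _)
    refine integral_congr_ae (Eventually.of_forall fun y => ?_)
    simp only [e0]
    ring
  have e2 : ∫ y, (g (unshear γ e y) + fderiv ℝ γ (unshear γ e y) v * ge (unshear γ e y)) * χ y =
      ∫ x, (g x * χ' x + fderiv ℝ γ x v * ge x * χ' x) := by
    refine Eq.trans ?_ (h.integral_comp_unshear _)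
    refine integral_congr_ae (Eventually.of_forall fun y => ?_)
    simp only [χ', h.shear_unshear]
    ring
  have d1 := continuous_fderiv_apply_const hχ' v
  have d2 := continuous_fderiv_apply_const hχ' e
  have s1 := hχc'.fderiv_apply (𝕜 := ℝ) v
  have s2 := hχc'.fderiv_apply (𝕜 := ℝ) e
  have i1 : Integrable fun x => u x * fderiv ℝ χ' x v := integrable_mul_test hu d1 s1
  have i2 : Integrable fun x => u x * (fderiv ℝ γ x v * fderiv ℝ χ' x e) :=
    integrable_mul_test hu (c1.continuous.mul d2) s2.mul_left
  have i3 : Integrable fun x => g x * χ' x := integrable_mul_test hg hχ'.continuous hχc'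
  have i4 : Integrable fun x => ge x * (fderiv ℝ γ x v * χ' x) :=
    integrable_mul_test hge (c1.continuous.mul hχ'.continuous) hχc'.mul_left
  have r2 : (fun x => u x * (fderiv ℝ γ x v * fderiv ℝ χ' x e)) =
    fun x => fderiv ℝ γ x v * u x * fderiv ℝ χ' x e := funext fun x => by ring
  have r4 : (fun x => ge x * (fderiv ℝ γ x v * χ' x)) =
    fun x => fderiv ℝ γ x v * ge x * χ' x := funext fun x => by ring
  rw [r2] at i2
  rw [r4] at i4
  rw [e1, e2, integral_add i1 i2, integral_add i3 i4, k1, k2]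
  ring

variable {f : Sp d → ℝ} {p : Sp d → Sp d → ℝ} {q : Sp d → Sp d → Sp d → ℝ}

/-- The first derivatives of `f ∘ unshear`. -/
noncomputable def shearP (γ : Sp d → ℝ) (e : Sp d) (p : Sp d → Sp d → ℝ) (v y : Sp d) : ℝ :=
  p v (unshear γ e y) + fderiv ℝ γ (unshear γ e y) v * p e (unshear γ e y)

/-- The second derivatives of `f ∘ unshear`. -/
noncomputable def shearQ (γ : Sp d → ℝ) (e : Sp d) (p : Sp d → Sp d → ℝ)
    (q : Sp d → Sp d → Sp d → ℝ) (v w y : Sp d) : ℝ :=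
  (q v w (unshear γ e y) + (fderiv ℝ γ (unshear γ e y) v * q e w (unshear γ e y)
      + fderiv ℝ (fderiv ℝ γ) (unshear γ e y) w v * p e (unshear γ e y)))
    + fderiv ℝ γ (unshear γ e y) w * (q v e (unshear γ e y)
      + fderiv ℝ γ (unshear γ e y) v * q e e (unshear γ e y))

/-- The weak chain rule is used twice, first for `f` and then for the function `p v + ∂_v γ · p e`
that represents its derivative. The second use needs the domain condition, because second
derivatives exist only on one side of the graph. -/
theorem H2Data.shear (h : ShearFn γ e) (hf : H2Data O f p q) {K : Set (Sp d)} (hK : IsCompact K)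
    (hs : SupportedIn K f p q) (hO : ∀ x, DGM.shear γ e x ∈ O' → x ∈ O) :
    H2Data O' (fun y => f (unshear γ e y)) (shearP γ e p) (shearQ γ e p q) := by
  have hγ2 : ContDiff ℝ 2 γ := h.smooth.of_le (by norm_num)
  have c0 : ∀ v, Continuous fun x => fderiv ℝ γ x v := fun v => (h.contDiff_fderiv_apply v).continuous
  have c1 : ∀ v, ContDiff ℝ 1 fun x => fderiv ℝ γ x v := fun v =>
    (h.contDiff_fderiv_apply v).of_le (by norm_num)
  have c2 : ∀ v w, Continuous fun x => fderiv ℝ (fderiv ℝ γ) x w v := fun v w => by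
    simp only [fderiv_fderiv_apply hγ2]
    exact continuous_fderiv_apply_const (c1 v) w
  have hγe : ∀ x v, fderiv ℝ (fderiv ℝ γ) x e v = 0 := fun x v => by
    rw [fderiv_fderiv_apply hγ2]; exact h.fderiv_fderiv_self v x
  have mp : ∀ {F : Sp d → ℝ}, MemLp F 2 → MemLp (fun y => F (unshear γ e y)) 2 := fun hF =>
    hF.comp_measurePreserving h.measurePreserving_unshear
  have np : ∀ v v', MemLp (fun x => fderiv ℝ γ x v * p v' x) 2 := fun v v' =>
    memLp_continuous_mul (c0 v) (hf.memp v') hK fun x hx => (hs x hx).2.1 v'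
  have nq : ∀ v v' w', MemLp (fun x => fderiv ℝ γ x v * q v' w' x) 2 := fun v v' w' =>
    memLp_continuous_mul (c0 v) (hf.memq v' w') hK fun x hx => (hs x hx).2.2 v' w'
  have np2 : ∀ v w v', MemLp (fun x => fderiv ℝ (fderiv ℝ γ) x w v * p v' x) 2 := fun v w v' =>
    memLp_continuous_mul (c2 v w) (hf.memp v') hK fun x hx => (hs x hx).2.1 v'
  have mP : ∀ v, MemLp (fun x => p v x + fderiv ℝ γ x v * p e x) 2 := fun v =>
    (hf.memp v).add (np v e)
  have mU : ∀ v w, MemLp (fun x => q v w x + (fderiv ℝ γ x v * q e w x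
      + fderiv ℝ (fderiv ℝ γ) x w v * p e x)) 2 := fun v w =>
    (hf.memq v w).add ((nq v e w).add (np2 v w e))
  have mE : ∀ v, MemLp (fun x => q v e x + fderiv ℝ γ x v * q e e x) 2 := fun v =>
    (hf.memq v e).add (nq v e e)
  refine ⟨mp hf.memf, fun v => mp (mP v), fun v w => ?_, fun v v' x => ?_, fun c v x => ?_,
    fun v w x => ?_, fun v v' w x => ?_, fun c v w x => ?_, fun v => ?_, fun v w => ?_⟩
  · refine mp (F := fun x => (q v w x + (fderiv ℝ γ x v * q e w x
      + fderiv ℝ (fderiv ℝ γ) x w v * p e x)) + fderiv ℝ γ x w * (q v e x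
      + fderiv ℝ γ x v * q e e x)) ((mU v w).add (memLp_continuous_mul (c0 w) (mE v) hK
        fun x hx => ?_))
    simp [(hs x hx).2.2]
  · simp only [shearP, hf.p_add, map_add]; ring
  · simp only [shearP, hf.p_smul, map_smul, smul_eq_mul]; ring
  · simp only [shearQ, hf.q_symm e w, hf.q_symm v w, hf.q_symm v e, fderiv_fderiv_comm hγ2 _ w v]
    ring
  · simp only [shearQ, hf.q_add, map_add]; ring
  · simp only [shearQ, hf.q_smul, map_smul, smul_eq_mul]; ring
  · exact WeakD.shear h (hf.weak_one v) (hf.weak_one e) hf.memf (hf.memp v) (hf.memp e)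
      (fun _ _ => Set.mem_univ _)
  · have w1 : ∀ w, WeakD O (fun x => p v x + fderiv ℝ γ x v * p e x)
        (fun x => q v w x + (fderiv ℝ γ x v * q e w x
          + fderiv ℝ (fderiv ℝ γ) x w v * p e x)) w := by
      intro w
      have a2 := (hf.weak_two e w).mul (O' := O) (hf.memp e) (hf.memq e w) (c1 v)
        Set.inter_subset_left
      simp only [← fderiv_fderiv_apply hγ2] at a2
      exact (hf.weak_two v w).add a2 (hf.memp v) (np v e) (hf.memq v w)
        ((nq v e w).add (np2 v w e))
    -- In direction `e` the mixed derivative of `γ` vanishes, which leaves the shorter expression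
    -- that occurs in `shearQ`.
    have w2 := w1 e
    simp only [hγe, zero_mul, add_zero] at w2
    exact WeakD.shear h (w1 w) w2 (mP v) (mU v w) (mE v) hO

theorem SupportedIn.shear {K : Set (Sp d)} (hs : SupportedIn K f p q) :
    SupportedIn (unshear γ e ⁻¹' K) (fun y => f (unshear γ e y)) (shearP γ e p)
      (shearQ γ e p q) := by
  intro y hy
  obtain ⟨h1, h2, h3⟩ := hs _ hy
  simp [h1, h2, h3, shearP, shearQ]

end Shear

/-! ### Testing up to the boundary of a half space -/

section Reflection

theorem deriv_smoothTransition_of_one_lt {x : ℝ} (hx : 1 < x) :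
    deriv Real.smoothTransition x = 0 := by
  have : Real.smoothTransition =ᶠ[𝓝 x] fun _ => 1 := by
    filter_upwards [lt_mem_nhds hx] with y hy using Real.smoothTransition.one_of_one_le hy.le
  rw [this.deriv_eq, deriv_const]

theorem deriv_smoothTransition_of_neg {x : ℝ} (hx : x < 0) :
    deriv Real.smoothTransition x = 0 := by
  have : Real.smoothTransition =ᶠ[𝓝 x] fun _ => 0 := by
    filter_upwards [gt_mem_nhds hx] with y hy using Real.smoothTransition.zero_of_nonpos hy.le
  rw [this.deriv_eq, deriv_const]

theorem exists_bound_deriv_smoothTransition :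
    ∃ M, 0 ≤ M ∧ ∀ x, |deriv Real.smoothTransition x| ≤ M := by
  have hc : Continuous (deriv Real.smoothTransition) :=
    (Real.smoothTransition.contDiff (n := 1)).continuous_deriv (by simp)
  have hs : HasCompactSupport (deriv Real.smoothTransition) :=
    HasCompactSupport.intro (isCompact_Icc (a := (0 : ℝ)) (b := 1)) fun x hx => by
      rw [Set.mem_Icc, not_and_or, not_le, not_le] at hx
      exact hx.elim deriv_smoothTransition_of_neg deriv_smoothTransition_of_one_lt
  obtain ⟨M, hM⟩ := hs.exists_bound_of_continuous hc
  exact ⟨M, (norm_nonneg _).trans (hM 0), hM⟩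

variable {d : ℕ}

/-- A cutoff function vanishing near the half space `⟪e, y⟫ ≤ 0`. -/
noncomputable def halfCutoff (e : Sp d) (n : ℕ) (y : Sp d) : ℝ :=
  Real.smoothTransition (n * ⟪e, y⟫_ℝ - 1)

theorem contDiff_halfCutoff (e : Sp d) (n : ℕ) : ContDiff ℝ 1 (halfCutoff e n) :=
  Real.smoothTransition.contDiff.comp
    ((contDiff_const.mul (contDiff_const.inner ℝ contDiff_id)).sub contDiff_const)

theorem fderiv_halfCutoff (e : Sp d) (n : ℕ) (y w : Sp d) : fderiv ℝ (halfCutoff e n) y w =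
    deriv Real.smoothTransition (n * ⟪e, y⟫_ℝ - 1) * (n * ⟪e, w⟫_ℝ) := by
  have h1 : HasFDerivAt (fun y : Sp d => (n : ℝ) * ⟪e, y⟫_ℝ - 1) ((n : ℝ) • innerSL ℝ e) y :=
    ((innerSL ℝ e).hasFDerivAt.const_mul (n : ℝ)).sub_const 1
  have h2 := ((Real.smoothTransition.contDiff (n := 1)).differentiable (by simp)
    (n * ⟪e, y⟫_ℝ - 1)).hasDerivAt
  rw [HasFDerivAt.fderiv (f := halfCutoff e n) (h2.comp_hasFDerivAt y h1)]
  simp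

theorem halfCutoff_le_one (e : Sp d) (n : ℕ) (y : Sp d) : |halfCutoff e n y| ≤ 1 := by
  rw [halfCutoff, abs_of_nonneg (Real.smoothTransition.nonneg _)]
  exact Real.smoothTransition.le_one _

theorem eventually_lt_natCast_mul {a : ℝ} (ha : 0 < a) (C : ℝ) : ∀ᶠ n : ℕ in atTop, C < n * a := by
  have : Tendsto (fun n : ℕ => (n : ℝ) * a) atTop atTop :=
    tendsto_natCast_atTop_atTop.atTop_mul_const ha
  exact this.eventually_gt_atTop C

theorem tsupport_halfCutoff_mul (e : Sp d) (n : ℕ) (χ : Sp d → ℝ) :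
    tsupport (fun x => halfCutoff e n x * χ x) ⊆ {y | 0 < ⟪e, y⟫_ℝ} := by
  -- The shift by `-1` in the cutoff makes it vanish where `n ⟪e, y⟫ ≤ 1`, so the closed support
  -- stays away from the hyperplane.
  have hcl : IsClosed {y : Sp d | 1 ≤ n * ⟪e, y⟫_ℝ} :=
    isClosed_le continuous_const (continuous_const.mul (continuous_const.inner continuous_id))
  have hsub : tsupport (fun x => halfCutoff e n x * χ x) ⊆ {y | 1 ≤ n * ⟪e, y⟫_ℝ} := by
    refine closure_minimal (fun y hy => ?_) hcl
    by_contra hne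
    refine hy ?_
    have : halfCutoff e n y = 0 :=
      Real.smoothTransition.zero_of_nonpos (by simpa using (not_le.1 hne).le)
    simp [this]
  intro y hy
  have h1 : 1 ≤ n * ⟪e, y⟫_ℝ := hsub hy
  by_contra hne
  have : (n : ℝ) * ⟪e, y⟫_ℝ ≤ 0 := mul_nonpos_of_nonneg_of_nonpos n.cast_nonneg (not_lt.1 hne)
  linarith

/-- A function with a weak derivative in the half space may be tested with functions that vanish
at the boundary in the direction of derivation. -/
theorem WeakD.of_halfSpace {e w : Sp d} {u g : Sp d → ℝ} (h : WeakD {y | 0 < ⟪e, y⟫_ℝ} u g w)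
    (hu : MemLp u 2) (hg : MemLp g 2) (hu0 : ∀ y, ⟪e, y⟫_ℝ ≤ 0 → u y = 0)
    (hg0 : ∀ y, ⟪e, y⟫_ℝ ≤ 0 → g y = 0) {χ : Sp d → ℝ} (hχ : ContDiff ℝ 1 χ)
    (hχc : HasCompactSupport χ) {L : ℝ} (hL : ∀ y, |⟪e, w⟫_ℝ * χ y| ≤ L * |⟪e, y⟫_ℝ|) :
    ∫ x, u x * fderiv ℝ χ x w = - ∫ x, g x * χ x := by
  obtain ⟨M, hM0, hM⟩ := exists_bound_deriv_smoothTransition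
  have cw := continuous_fderiv_apply_const hχ w
  have sw := hχc.fderiv_apply (𝕜 := ℝ) w
  have ck : ∀ n, Continuous (halfCutoff e n) := fun n => (contDiff_halfCutoff e n).continuous
  have ckw : ∀ n, Continuous fun x => fderiv ℝ (halfCutoff e n) x w := fun n =>
    continuous_fderiv_apply_const (contDiff_halfCutoff e n) w
  have key : ∀ n : ℕ, ∫ x, (u x * (halfCutoff e n x * fderiv ℝ χ x w)
      + u x * (fderiv ℝ (halfCutoff e n) x w * χ x)) = - ∫ x, g x * (halfCutoff e n x * χ x) := by
    intro n
    rw [← h (fun x => halfCutoff e n x * χ x) ((contDiff_halfCutoff e n).mul hχ) hχc.mul_left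
      (tsupport_halfCutoff_mul e n χ)]
    refine integral_congr_ae (Eventually.of_forall fun x => ?_)
    simp only
    rw [fderiv_fun_mul ((contDiff_halfCutoff e n).differentiable (by simp) x)
      (hχ.differentiable (by simp) x)]
    simp only [_root_.add_apply, _root_.smul_apply, smul_eq_mul]
    ring
  have t1 : Tendsto (fun n : ℕ => ∫ x, u x * (halfCutoff e n x * fderiv ℝ χ x w)) atTop
      (𝓝 (∫ x, u x * fderiv ℝ χ x w)) := by
    refine tendsto_integral_of_dominated_convergence (fun x => ‖u x * fderiv ℝ χ x w‖)
      (fun n => hu.1.mul ((ck n).mul cw).aestronglyMeasurable)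
      (integrable_mul_test hu cw sw).norm (fun n => Eventually.of_forall fun x => ?_)
      (Eventually.of_forall fun x => ?_)
    · rw [mul_left_comm, norm_mul]
      exact mul_le_of_le_one_left (norm_nonneg _) (halfCutoff_le_one e n x)
    · by_cases hx : ⟪e, x⟫_ℝ ≤ 0
      · simp [hu0 x hx]
      · refine tendsto_const_nhds.congr' ?_
        filter_upwards [eventually_lt_natCast_mul (not_le.1 hx) 2] with n hn
        rw [halfCutoff, Real.smoothTransition.one_of_one_le (by linarith), one_mul]
  have t3 : Tendsto (fun n : ℕ => ∫ x, g x * (halfCutoff e n x * χ x)) atTop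
      (𝓝 (∫ x, g x * χ x)) := by
    refine tendsto_integral_of_dominated_convergence (fun x => ‖g x * χ x‖)
      (fun n => hg.1.mul ((ck n).mul hχ.continuous).aestronglyMeasurable)
      (integrable_mul_test hg hχ.continuous hχc).norm (fun n => Eventually.of_forall fun x => ?_)
      (Eventually.of_forall fun x => ?_)
    · rw [mul_left_comm, norm_mul]
      exact mul_le_of_le_one_left (norm_nonneg _) (halfCutoff_le_one e n x)
    · by_cases hx : ⟪e, x⟫_ℝ ≤ 0
      · simp [hg0 x hx]
      · refine tendsto_const_nhds.congr' ?_
        filter_upwards [eventually_lt_natCast_mul (not_le.1 hx) 2] with n hn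
        rw [halfCutoff, Real.smoothTransition.one_of_one_le (by linarith), one_mul]
  -- Dominating function for the term with the differentiated cutoff. That derivative is of size `n`
  -- but lives where `n ⟪e, y⟫ ≤ 2`, and there `|⟪e, w⟫ χ|` is at most `2 |L| / n`.
  have iK : Integrable fun x => ‖(tsupport χ).indicator u x‖ * (2 * |L| * M) := by
    have hm : MeasurableSet (tsupport χ) := (isClosed_tsupport χ).measurableSet
    have : IsFiniteMeasure (volume.restrict (tsupport χ)) :=
      ⟨by simpa using hχc.isCompact.measure_lt_top⟩
    have : IntegrableOn u (tsupport χ) := (hu.restrict (tsupport χ)).integrable (by norm_num)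
    exact (this.integrable_indicator hm).norm.mul_const _
  have t2 : Tendsto (fun n : ℕ => ∫ x, u x * (fderiv ℝ (halfCutoff e n) x w * χ x)) atTop
      (𝓝 (∫ _ : Sp d, (0 : ℝ))) := by
    refine tendsto_integral_of_dominated_convergence _
      (fun n => hu.1.mul ((ckw n).mul hχ.continuous).aestronglyMeasurable) iK
      (fun n => Eventually.of_forall fun x => ?_) (Eventually.of_forall fun x => ?_)
    · by_cases hx : ⟪e, x⟫_ℝ ≤ 0
      · rw [hu0 x hx, zero_mul, norm_zero]; positivity
      by_cases hxs : x ∈ tsupport χ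
      · rw [Set.indicator_of_mem hxs, norm_mul]
        refine mul_le_mul_of_nonneg_left ?_ (norm_nonneg _)
        rw [fderiv_halfCutoff]
        have e1 : deriv Real.smoothTransition (n * ⟪e, x⟫_ℝ - 1) * (n * ⟪e, w⟫_ℝ) * χ x =
          deriv Real.smoothTransition (n * ⟪e, x⟫_ℝ - 1) * (n * (⟪e, w⟫_ℝ * χ x)) := by ring
        rw [e1, Real.norm_eq_abs, abs_mul]
        by_cases h2 : 1 < n * ⟪e, x⟫_ℝ - 1
        · rw [deriv_smoothTransition_of_one_lt h2, abs_zero, zero_mul]; positivity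
        · have h3 : n * ⟪e, x⟫_ℝ ≤ 2 := by linarith
          have h4 : |(n : ℝ) * (⟪e, w⟫_ℝ * χ x)| ≤ 2 * |L| := by
            rw [abs_mul, Nat.abs_cast]
            calc (n : ℝ) * |⟪e, w⟫_ℝ * χ x| ≤ n * (|L| * ⟪e, x⟫_ℝ) := by
                  have hp := (not_le.1 hx).le
                  refine mul_le_mul_of_nonneg_left ((hL x).trans ?_) n.cast_nonneg
                  rw [abs_of_nonneg hp]
                  exact mul_le_mul_of_nonneg_right (le_abs_self L) hp
              _ = |L| * (n * ⟪e, x⟫_ℝ) := by ring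
              _ ≤ |L| * 2 := mul_le_mul_of_nonneg_left h3 (abs_nonneg L)
              _ = 2 * |L| := mul_comm _ _
          rw [mul_comm]
          exact mul_le_mul h4 (hM _) (abs_nonneg _) (by positivity)
      · rw [image_eq_zero_of_notMem_tsupport hxs]
        simp only [mul_zero, norm_zero]
        positivity
    · by_cases hx : ⟪e, x⟫_ℝ ≤ 0
      · simp [hu0 x hx]
      · refine tendsto_const_nhds.congr' ?_
        filter_upwards [eventually_lt_natCast_mul (not_le.1 hx) 2] with n hn
        rw [fderiv_halfCutoff, deriv_smoothTransition_of_one_lt (by linarith)]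
        simp
  have t12 := t1.add t2
  rw [integral_zero, add_zero] at t12
  refine tendsto_nhds_unique t12 (t3.neg.congr fun n => ?_)
  rw [← key n]
  exact integral_add (integrable_mul_test hu ((ck n).mul cw) sw.mul_left)
    (integrable_mul_test hu ((ckw n).mul hχ.continuous) hχc.mul_left)

end Reflection

/-! ### Odd reflection preserves `H²` for functions vanishing on the hyperplane -/

section OddReflection

variable {d : ℕ}

/-- The reflection in the hyperplane orthogonal to `e`. -/
noncomputable def flip (e : Sp d) : Sp d ≃ₗᵢ[ℝ] Sp d := (ℝ ∙ e)ᗮ.reflection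

theorem flip_flip (e y : Sp d) : flip e (flip e y) = y := Submodule.reflection_reflection _ y

theorem flip_apply {e : Sp d} (he : ‖e‖ = 1) (y : Sp d) :
    flip e y = y - (2 * ⟪e, y⟫_ℝ) • e := by
  rw [flip, Submodule.reflection_orthogonal_apply, Submodule.reflection_singleton_apply]
  simp [he, two_mul, add_smul, two_smul]

theorem inner_flip {e : Sp d} (he : ‖e‖ = 1) (y : Sp d) : ⟪e, flip e y⟫_ℝ = - ⟪e, y⟫_ℝ := by
  rw [flip_apply he, inner_sub_right, inner_smul_right, real_inner_self_eq_norm_sq, he]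
  ring

theorem flip_of_inner_eq_zero {e : Sp d} (he : ‖e‖ = 1) {y : Sp d} (h : ⟪e, y⟫_ℝ = 0) :
    flip e y = y := by
  rw [flip_apply he, h, mul_zero, zero_smul, sub_zero]

theorem integral_comp_flip (e : Sp d) (G : Sp d → ℝ) : ∫ y, G (flip e y) = ∫ y, G y :=
  (flip e).measurePreserving.integral_comp (flip e).toHomeomorph.measurableEmbedding G

theorem fderiv_comp_flip (e : Sp d) {χ : Sp d → ℝ} (hχ : Differentiable ℝ χ) (y v : Sp d) :
    fderiv ℝ (fun y => χ (flip e y)) y v = fderiv ℝ χ (flip e y) (flip e v) := by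
  have h1 : HasFDerivAt (flip e) ((flip e : Sp d ≃L[ℝ] Sp d) : Sp d →L[ℝ] Sp d) y :=
    (flip e : Sp d ≃L[ℝ] Sp d).hasFDerivAt
  have h2 := ((hχ (flip e y)).hasFDerivAt.comp y h1).fderiv
  have e1 : (fun y => χ (flip e y)) = χ ∘ flip e := rfl
  rw [e1, h2]
  rfl

theorem contDiff_comp_flip (e : Sp d) {n : WithTop ℕ∞} {χ : Sp d → ℝ} (hχ : ContDiff ℝ n χ) :
    ContDiff ℝ n fun y => χ (flip e y) :=
  hχ.comp (flip e).contDiff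

theorem hasCompactSupport_comp_flip (e : Sp d) {χ : Sp d → ℝ} (hχ : HasCompactSupport χ) :
    HasCompactSupport fun y => χ (flip e y) :=
  hχ.comp_homeomorph (flip e).toHomeomorph

theorem fderiv_fderiv_comp_flip (e : Sp d) {χ : Sp d → ℝ} (hχ : ContDiff ℝ 2 χ) (y v w : Sp d) :
    fderiv ℝ (fderiv ℝ fun y => χ (flip e y)) y w v =
      fderiv ℝ (fderiv ℝ χ) (flip e y) (flip e w) (flip e v) := by
  rw [fderiv_fderiv_apply (contDiff_comp_flip e hχ), fderiv_fderiv_apply hχ]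
  simp only [fderiv_comp_flip e (hχ.differentiable (by simp))]
  exact fderiv_comp_flip e (χ := fun y => fderiv ℝ χ y (flip e v))
    ((contDiff_fderiv_apply (n := 2) (m := 1) hχ (by norm_num) _).differentiable (by simp)) y w

/-- A function on `ℝ^d` with first and second weak derivatives in `L²`. -/
structure SobolevJet (f : Sp d → ℝ) (p : Sp d → Sp d → ℝ) (q : Sp d → Sp d → Sp d → ℝ) :
    Prop where
  memf : MemLp f 2
  memp : ∀ v, MemLp (p v) 2
  memq : ∀ v w, MemLp (q v w) 2
  weak_one : ∀ v, WeakD Set.univ f (p v) v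
  weak_two : ∀ v w, WeakD₂ f (q v w) v w

variable {O : Set (Sp d)} {f : Sp d → ℝ} {p : Sp d → Sp d → ℝ} {q : Sp d → Sp d → Sp d → ℝ}

theorem H2Data.sobolevJet (h : H2Data Set.univ f p q) : SobolevJet f p q := by
  refine ⟨h.memf, h.memp, h.memq, h.weak_one, fun v w χ hχ hχc => ?_⟩
  have hχ2 : ContDiff ℝ 2 χ := hχ.of_le two_le_infty
  have hw : ContDiff ℝ 1 fun x => fderiv ℝ χ x w :=
    contDiff_fderiv_apply (n := 2) (m := 1) hχ2 (by norm_num) w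
  have := h.weak_one v _ hw (hχc.fderiv_apply (𝕜 := ℝ) w) (Set.subset_univ _)
  simp only [fderiv_fderiv_comm hχ2 _ w v, fderiv_fderiv_apply hχ2]
  rw [this, h.weak_two v w χ (hχ.of_le one_le_infty) hχc (Set.subset_univ _), neg_neg]

/-- The defect in the second weak derivative. -/
noncomputable def secondDefect (f : Sp d → ℝ) (q : Sp d → Sp d → Sp d → ℝ) (χ : Sp d → ℝ)
    (v w : Sp d) : ℝ :=
  (∫ x, f x * fderiv ℝ (fderiv ℝ χ) x w v) - ∫ x, q v w x * χ x

theorem continuous_fderiv_fderiv_apply {χ : Sp d → ℝ} (hχ : ContDiff ℝ 2 χ) (v w : Sp d) :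
    Continuous fun x => fderiv ℝ (fderiv ℝ χ) x w v := by
  simp only [fderiv_fderiv_apply hχ]
  exact continuous_fderiv_apply_const
    (contDiff_fderiv_apply (n := 2) (m := 1) hχ (by norm_num) v) w

theorem hasCompactSupport_fderiv_fderiv_apply {χ : Sp d → ℝ} (hχ : ContDiff ℝ 2 χ)
    (hχc : HasCompactSupport χ) (v w : Sp d) :
    HasCompactSupport fun x => fderiv ℝ (fderiv ℝ χ) x w v := by
  simp only [fderiv_fderiv_apply hχ]
  exact (hχc.fderiv_apply (𝕜 := ℝ) v).fderiv_apply (𝕜 := ℝ) w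

theorem H2Data.integrable_fderiv_fderiv (h : H2Data O f p q) {χ : Sp d → ℝ} (hχ : ContDiff ℝ 2 χ)
    (hχc : HasCompactSupport χ) (v w : Sp d) :
    Integrable fun x => f x * fderiv ℝ (fderiv ℝ χ) x w v :=
  integrable_mul_test h.memf (continuous_fderiv_fderiv_apply hχ v w)
    (hasCompactSupport_fderiv_fderiv_apply hχ hχc v w)

theorem H2Data.secondDefect_comm (h : H2Data O f p q) {χ : Sp d → ℝ} (hχ : ContDiff ℝ 2 χ)
    (v w : Sp d) : secondDefect f q χ v w = secondDefect f q χ w v := by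
  simp only [secondDefect, h.q_symm v w, fderiv_fderiv_comm hχ _ w v]

theorem H2Data.secondDefect_add (h : H2Data O f p q) {χ : Sp d → ℝ} (hχ : ContDiff ℝ 2 χ)
    (hχc : HasCompactSupport χ) (v v' w : Sp d) :
    secondDefect f q χ (v + v') w = secondDefect f q χ v w + secondDefect f q χ v' w := by
  simp only [secondDefect, h.q_add, map_add, mul_add, add_mul]
  rw [integral_add (h.integrable_fderiv_fderiv hχ hχc _ _)
    (h.integrable_fderiv_fderiv hχ hχc _ _), integral_add
    (integrable_mul_test (h.memq _ _) hχ.continuous hχc)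
    (integrable_mul_test (h.memq _ _) hχ.continuous hχc)]
  ring

theorem H2Data.secondDefect_smul (h : H2Data O f p q) (χ : Sp d → ℝ) (c : ℝ) (v w : Sp d) :
    secondDefect f q χ (c • v) w = c * secondDefect f q χ v w := by
  simp only [secondDefect, h.q_smul, map_smul, smul_eq_mul, mul_left_comm _ c, mul_assoc,
    integral_const_mul]
  ring

theorem H2Data.secondDefect_sub (h : H2Data O f p q) {χ χ' : Sp d → ℝ} (hχ : ContDiff ℝ 2 χ)
    (hχc : HasCompactSupport χ) (hχ' : ContDiff ℝ 2 χ') (hχc' : HasCompactSupport χ')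
    (v w : Sp d) : secondDefect f q (fun x => χ x - χ' x) v w =
      secondDefect f q χ v w - secondDefect f q χ' v w := by
  have e1 : ∀ x, fderiv ℝ (fderiv ℝ fun x => χ x - χ' x) x w v =
      fderiv ℝ (fderiv ℝ χ) x w v - fderiv ℝ (fderiv ℝ χ') x w v := by
    intro x
    have d1 : ∀ x, fderiv ℝ (fun x => χ x - χ' x) x = fderiv ℝ χ x - fderiv ℝ χ' x := fun x =>
      fderiv_fun_sub (hχ.differentiable (by simp) x) (hχ'.differentiable (by simp) x)
    rw [funext d1, fderiv_fun_sub
      ((hχ.fderiv_right (m := 1) le_rfl).differentiable (by norm_num) x)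
      ((hχ'.fderiv_right (m := 1) le_rfl).differentiable (by norm_num) x)]
    rfl
  simp only [secondDefect, e1, mul_sub]
  rw [integral_sub (h.integrable_fderiv_fderiv hχ hχc _ _)
    (h.integrable_fderiv_fderiv hχ' hχc' _ _), integral_sub
    (integrable_mul_test (h.memq _ _) hχ.continuous hχc)
    (integrable_mul_test (h.memq _ _) hχ'.continuous hχc')]
  ring

variable {e : Sp d}

/-- The first derivative may be moved across the hyperplane freely. The second may be moved when no
boundary contribution arises, that is, when `w` is tangential or `χ` vanishes on the hyperplane; the
bound with `L` covers both cases. -/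
theorem H2Data.secondDefect_eq_zero (h : H2Data {y | 0 < ⟪e, y⟫_ℝ} f p q)
    (hs : SupportedIn {y | 0 < ⟪e, y⟫_ℝ} f p q) {χ : Sp d → ℝ} (hχ : ContDiff ℝ 2 χ)
    (hχc : HasCompactSupport χ) {v w : Sp d} {L : ℝ}
    (hL : ∀ y, |⟪e, w⟫_ℝ * χ y| ≤ L * |⟪e, y⟫_ℝ|) : secondDefect f q χ v w = 0 := by
  have hw : ContDiff ℝ 1 fun x => fderiv ℝ χ x w :=
    contDiff_fderiv_apply (n := 2) (m := 1) hχ (by norm_num) w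
  have h1 := h.weak_one v _ hw (hχc.fderiv_apply (𝕜 := ℝ) w) (Set.subset_univ _)
  have h2 := (h.weak_two v w).of_halfSpace (h.memp v) (h.memq v w)
    (fun y hy => (hs y (not_lt.2 hy)).2.1 v) (fun y hy => (hs y (not_lt.2 hy)).2.2 v w)
    (hχ.of_le (by norm_num)) hχc hL
  simp only [secondDefect, fderiv_fderiv_comm hχ _ w v, fderiv_fderiv_apply hχ]
  rw [h1, h2]
  ring

/-- The defect is a symmetric bilinear form in the directions, and it vanishes as soon as one of
them is tangential, so only normal components contribute. -/
theorem H2Data.secondDefect_eq (he : ‖e‖ = 1) (h : H2Data {y | 0 < ⟪e, y⟫_ℝ} f p q)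
    (hs : SupportedIn {y | 0 < ⟪e, y⟫_ℝ} f p q) {χ : Sp d → ℝ} (hχ : ContDiff ℝ 2 χ)
    (hχc : HasCompactSupport χ) (v w : Sp d) :
    secondDefect f q χ v w = ⟪e, v⟫_ℝ * ⟪e, w⟫_ℝ * secondDefect f q χ e e := by
  have key : ∀ v w, secondDefect f q χ v w = ⟪e, v⟫_ℝ * secondDefect f q χ e w := by
    intro v w
    have h0 : ⟪e, v - ⟪e, v⟫_ℝ • e⟫_ℝ = 0 := by
      rw [inner_sub_right, inner_smul_right, real_inner_self_eq_norm_sq, he]; ring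
    have hz : secondDefect f q χ (v - ⟪e, v⟫_ℝ • e) w = 0 := by
      rw [h.secondDefect_comm hχ]
      exact h.secondDefect_eq_zero hs hχ hχc (L := 0) (by simp [h0])
    have : secondDefect f q χ (⟪e, v⟫_ℝ • e + (v - ⟪e, v⟫_ℝ • e)) w = _ :=
      h.secondDefect_add hχ hχc _ _ w
    rw [add_sub_cancel, hz, add_zero, h.secondDefect_smul] at this
    exact this
  rw [key v w, h.secondDefect_comm hχ e w, key w e, h.secondDefect_comm hχ e e]
  ring

/-- The odd reflections of `f` and of its first and second derivatives. -/
noncomputable def oddF (e : Sp d) (f : Sp d → ℝ) (y : Sp d) : ℝ := f y - f (flip e y)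

noncomputable def oddP (e : Sp d) (p : Sp d → Sp d → ℝ) (v y : Sp d) : ℝ :=
  p v y - p (flip e v) (flip e y)

noncomputable def oddQ (e : Sp d) (q : Sp d → Sp d → Sp d → ℝ) (v w y : Sp d) : ℝ :=
  q v w y - q (flip e v) (flip e w) (flip e y)

/-- Odd reflection of a function which vanishes at the boundary of a half space. -/
theorem H2Data.odd (he : ‖e‖ = 1) (h : H2Data {y | 0 < ⟪e, y⟫_ℝ} f p q)
    (hs : SupportedIn {y | 0 < ⟪e, y⟫_ℝ} f p q) :
    SobolevJet (oddF e f) (oddP e p) (oddQ e q) := by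
  have mp : ∀ {F : Sp d → ℝ}, MemLp F 2 → MemLp (fun y => F (flip e y)) 2 := fun hF =>
    hF.comp_measurePreserving (flip e).measurePreserving
  refine ⟨h.memf.sub (mp h.memf), fun v => (h.memp v).sub (mp (h.memp _)),
    fun v w => (h.memq v w).sub (mp (h.memq _ _)), fun v χ hχ hχc _ => ?_, fun v w χ hχ hχc => ?_⟩
  · have cv := continuous_fderiv_apply_const hχ v
    have sv := hχc.fderiv_apply (𝕜 := ℝ) v
    have hχR := contDiff_comp_flip e hχ
    have hχRc := hasCompactSupport_comp_flip e hχc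
    simp only [oddF, oddP, sub_mul]
    rw [integral_sub (integrable_mul_test h.memf cv sv) (integrable_mul_test (mp h.memf) cv sv),
      integral_sub (integrable_mul_test (h.memp v) hχ.continuous hχc)
        (integrable_mul_test (mp (h.memp _)) hχ.continuous hχc),
      h.weak_one v χ hχ hχc (Set.subset_univ _)]
    have e1 := h.weak_one (flip e v) _ hχR hχRc (Set.subset_univ _)
    simp only [fderiv_comp_flip e (hχ.differentiable (by simp)), flip_flip] at e1
    rw [← integral_comp_flip e, ← integral_comp_flip e (fun x => p (flip e v) x * _)] at e1
    simp only [flip_flip] at e1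
    rw [e1]
    ring
  · have hχ2 : ContDiff ℝ 2 χ := hχ.of_le two_le_infty
    have hχR := contDiff_comp_flip e hχ2
    have hχRc := hasCompactSupport_comp_flip e hχc
    have cv := continuous_fderiv_fderiv_apply hχ2 v w
    have sv := hasCompactSupport_fderiv_fderiv_apply hχ2 hχc v w
    have hψ : ContDiff ℝ 2 fun y => χ y - χ (flip e y) := hχ2.sub hχR
    have hψc : HasCompactSupport fun y => χ y - χ (flip e y) := hχc.sub hχRc
    obtain ⟨L, hL⟩ := (hψc.fderiv (𝕜 := ℝ)).exists_bound_of_continuous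
      (hψ.continuous_fderiv (by simp))
    -- The antisymmetrized test function vanishes on the hyperplane. The mean value inequality
    -- between `y` and its projection bounds it by `L |⟪e, y⟫|`, as required for a vanishing defect.
    have hE : secondDefect f q (fun y => χ y - χ (flip e y)) e e = 0 := by
      refine h.secondDefect_eq_zero hs hψ hψc (L := L) fun y => ?_
      have h0 : ⟪e, y - ⟪e, y⟫_ℝ • e⟫_ℝ = 0 := by
        rw [inner_sub_right, inner_smul_right, real_inner_self_eq_norm_sq, he]; ring
      have := (convex_univ (𝕜 := ℝ)).norm_image_sub_le_of_norm_fderiv_le (𝕜 := ℝ)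
        (fun x _ => hψ.differentiable (by simp) x) (fun x _ => hL x)
        (Set.mem_univ (y - ⟪e, y⟫_ℝ • e)) (Set.mem_univ y)
      rw [flip_of_inner_eq_zero he h0, sub_self, sub_zero, sub_sub_cancel, norm_smul, he,
        mul_one] at this
      rw [real_inner_self_eq_norm_sq, he, one_pow, one_mul]
      exact this
    rw [h.secondDefect_sub hχ2 hχc hχR hχRc] at hE
    -- Reflecting both directions changes the sign of both normal components, so their product is
    -- unchanged. The defects of `f` and of its mirror image therefore agree and cancel in the odd
    -- extension.
    have hD : secondDefect f q χ v w =
        secondDefect f q (fun y => χ (flip e y)) (flip e v) (flip e w) := by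
      rw [h.secondDefect_eq he hs hχ2 hχc, h.secondDefect_eq he hs hχR hχRc, inner_flip he,
        inner_flip he, sub_eq_zero.1 hE]
      ring
    simp only [secondDefect, fderiv_fderiv_comp_flip e hχ2, flip_flip] at hD
    rw [← integral_comp_flip e (fun x => f x * fderiv ℝ (fderiv ℝ χ) (flip e x) w v),
      ← integral_comp_flip e (fun x => q (flip e v) (flip e w) x * _)] at hD
    simp only [flip_flip] at hD
    simp only [oddF, oddQ, sub_mul]
    rw [integral_sub (integrable_mul_test h.memf cv sv) (integrable_mul_test (mp h.memf) cv sv),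
      integral_sub (integrable_mul_test (h.memq v w) hχ.continuous hχc)
        (integrable_mul_test (mp (h.memq _ _)) hχ.continuous hχc)]
    linarith

/-- The mollification of an odd function is odd. -/
theorem moll_oddF_flip (e : Sp d) (ε : ℝ) (f : Sp d → ℝ) (y : Sp d) :
    moll (mollifier ε) (oddF e f) (flip e y) = - moll (mollifier ε) (oddF e f) y := by
  unfold moll
  rw [← integral_comp_flip e, ← integral_neg]
  refine integral_congr_ae (Eventually.of_forall fun t => ?_)
  simp only [oddF, ← map_sub, flip_flip,
    mollifier_congr_norm ε (LinearIsometryEquiv.norm_map (flip e) t)]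
  ring

theorem moll_oddF_eq_zero (he : ‖e‖ = 1) (ε : ℝ) (f : Sp d → ℝ) {y : Sp d}
    (hy : ⟪e, y⟫_ℝ = 0) : moll (mollifier ε) (oddF e f) y = 0 := by
  have := moll_oddF_flip e ε f y
  rw [flip_of_inner_eq_zero he hy] at this
  linarith

end OddReflection

/-! ### Weak limits of mollifications in sheared coordinates -/

section WeakLimits

variable {d : ℕ}

/-- Weak convergence `u ε → u₀` as `ε → 0`, tested with functions in `L²` vanishing outside `B`. -/
def WeakLim (B : Set (Sp d)) (u : ℝ → Sp d → ℝ) (u₀ : Sp d → ℝ) : Prop :=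
  ∀ m : Sp d → ℝ, MemLp m 2 → (∀ x, x ∉ B → m x = 0) →
    (∀ ε, 0 < ε → Integrable fun x => m x * u ε x) ∧ (Integrable fun x => m x * u₀ x) ∧
    Tendsto (fun ε => ∫ x, m x * u ε x) (𝓝[>] 0) (𝓝 (∫ x, m x * u₀ x))

variable {B : Set (Sp d)} {u u' : ℝ → Sp d → ℝ} {u₀ u₀' : Sp d → ℝ}

theorem WeakLim.add (h : WeakLim B u u₀) (h' : WeakLim B u' u₀') :
    WeakLim B (fun ε x => u ε x + u' ε x) (fun x => u₀ x + u₀' x) := by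
  intro m hm h0
  obtain ⟨a1, a2, a3⟩ := h m hm h0
  obtain ⟨b1, b2, b3⟩ := h' m hm h0
  simp only [mul_add]
  refine ⟨fun ε hε => (a1 ε hε).add (b1 ε hε), a2.add b2, ?_⟩
  rw [integral_add a2 b2]
  refine (a3.add b3).congr' ?_
  filter_upwards [self_mem_nhdsWithin] with ε hε
  rw [integral_add (a1 ε hε) (b1 ε hε)]

theorem WeakLim.continuous_mul (hB : IsCompact B) (h : WeakLim B u u₀) {c : Sp d → ℝ}
    (hc : Continuous c) : WeakLim B (fun ε x => c x * u ε x) (fun x => c x * u₀ x) := by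
  intro m hm h0
  have := h (fun x => c x * m x) (memLp_continuous_mul hc hm hB h0) fun x hx => by
    simp [h0 x hx]
  simpa only [mul_left_comm, mul_assoc, mul_comm] using this

theorem WeakLim.sub (hB : IsCompact B) (h : WeakLim B u u₀) (h' : WeakLim B u' u₀') :
    WeakLim B (fun ε x => u ε x - u' ε x) (fun x => u₀ x - u₀' x) := by
  have := h.add (h'.continuous_mul hB (continuous_const (y := (-1 : ℝ))))
  simpa only [neg_one_mul, ← sub_eq_add_neg] using this

theorem WeakLim.congr (h : WeakLim B u u₀) (hu : ∀ ε, 0 < ε → ∀ x, u ε x = u' ε x) :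
    WeakLim B u' u₀ := by
  intro m hm h0
  obtain ⟨a1, a2, a3⟩ := h m hm h0
  refine ⟨fun ε hε => ?_, a2, a3.congr' ?_⟩
  · simpa only [hu ε hε] using a1 ε hε
  · filter_upwards [self_mem_nhdsWithin] with ε hε
    simp only [hu ε hε]

theorem integrable_of_memLp_two_of_compact {m : Sp d → ℝ} (hm : MemLp m 2) (hB : IsCompact B)
    (h0 : ∀ x, x ∉ B → m x = 0) : Integrable m := by
  have : IsFiniteMeasure (volume.restrict B) := ⟨by simpa using hB.measure_lt_top⟩
  have h1 : IntegrableOn m B := (hm.restrict B).integrable (by norm_num)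
  have h2 := h1.integrable_indicator hB.measurableSet
  rwa [Set.indicator_eq_self.2 fun x hx => by_contra fun h => hx (h0 x h)] at h2

theorem integrable_mul_continuous {m c : Sp d → ℝ} (hm : MemLp m 2) (hB : IsCompact B)
    (h0 : ∀ x, x ∉ B → m x = 0) (hc : Continuous c) : Integrable fun x => m x * c x := by
  refine (integrable_of_memLp_two_of_compact (memLp_continuous_mul hc hm hB h0) hB fun x hx => by
    simp [h0 x hx]).congr (Eventually.of_forall fun x => mul_comm _ _)

theorem locallyIntegrable_of_memLp_two {q : Sp d → ℝ} (hq : MemLp q 2) : LocallyIntegrable q :=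
  hq.locallyIntegrable (by norm_num)

theorem contDiff_moll_mollifier {ε : ℝ} (hε : 0 < ε) {q : Sp d → ℝ} (hq : MemLp q 2) :
    ContDiff ℝ ∞ (moll (mollifier ε) q) :=
  contDiff_moll (contDiff_mollifier ε) (hasCompactSupport_mollifier hε)
    (locallyIntegrable_of_memLp_two hq)

variable {γ : Sp d → ℝ} {e : Sp d}

/-- The shear preserves volume, so it can be transferred to the test function, which leaves an
ordinary mollification limit. -/
theorem weakLim_moll_shear (hγ : ShearFn γ e) (hB : IsCompact B) {q : Sp d → ℝ}
    (hq : MemLp q 2) :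
    WeakLim B (fun ε x => moll (mollifier ε) q (shear γ e x)) (fun x => q (shear γ e x)) := by
  intro m hm h0
  refine ⟨fun ε hε => ?_, ?_, ?_⟩
  · exact integrable_mul_continuous hm hB h0
      ((contDiff_moll_mollifier hε hq).continuous.comp hγ.contDiff_shear.continuous)
  · exact integrable_mul_of_memLp_two hm (hq.comp_measurePreserving hγ.measurePreserving)
  · have key : ∀ r : Sp d → ℝ, ∫ x, m x * r (shear γ e x) = ∫ y, m (unshear γ e y) * r y := by
      intro r
      rw [← hγ.integral_comp_unshear]
      simp only [hγ.shear_unshear]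
    simp only [key]
    exact tendsto_integral_mul_moll (hm.comp_measurePreserving hγ.measurePreserving_unshear) hq

variable {f : Sp d → ℝ} {p : Sp d → Sp d → ℝ} {q : Sp d → Sp d → Sp d → ℝ}

/-- The first derivatives of `f ∘ shear`. -/
noncomputable def unshearP (γ : Sp d → ℝ) (e : Sp d) (p : Sp d → Sp d → ℝ) (v x : Sp d) : ℝ :=
  p v (shear γ e x) - fderiv ℝ γ x v * p e (shear γ e x)

/-- The second derivatives of `f ∘ shear`. -/
noncomputable def unshearQ (γ : Sp d → ℝ) (e : Sp d) (p : Sp d → Sp d → ℝ)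
    (q : Sp d → Sp d → Sp d → ℝ) (v w x : Sp d) : ℝ :=
  (q v w (shear γ e x) - fderiv ℝ γ x w * q v e (shear γ e x))
    - (fderiv ℝ γ x v * (q e w (shear γ e x) - fderiv ℝ γ x w * q e e (shear γ e x))
      + fderiv ℝ (fderiv ℝ γ) x w v * p e (shear γ e x))

theorem ShearFn.contDiff_comp (h : ShearFn γ e) {n : WithTop ℕ∞} (hn : n ≤ 3) {g : Sp d → ℝ}
    (hg : ContDiff ℝ n g) : ContDiff ℝ n fun x => g (shear γ e x) :=
  hg.comp (h.contDiff_shear.of_le (hn))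

/-- The second derivatives of the smooth approximations have the same formula as the candidate
limit, which is a sum of continuous coefficients times weakly convergent factors. -/
theorem ShearFn.fderiv_fderiv_comp_shear (h : ShearFn γ e) {g : Sp d → ℝ} (hg : ContDiff ℝ 2 g)
    (x v w : Sp d) : fderiv ℝ (fderiv ℝ fun x => g (shear γ e x)) x w v =
      unshearQ γ e (fun v y => fderiv ℝ g y v) (fun v w y => fderiv ℝ (fderiv ℝ g) y w v) v w x := by
  have hgv : ∀ v, ContDiff ℝ 1 fun y => fderiv ℝ g y v := fun v =>
    DGM.contDiff_fderiv_apply (n := 2) (m := 1) hg (by norm_num) v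
  have hgd : ∀ v, Differentiable ℝ fun x => fderiv ℝ g (shear γ e x) v := fun v =>
    (h.contDiff_comp (n := 1) (by norm_num) (hgv v)).differentiable (by simp)
  have hγv : Differentiable ℝ fun x => fderiv ℝ γ x v :=
    (h.contDiff_fderiv_apply v).differentiable (by norm_num)
  rw [fderiv_fderiv_apply (h.contDiff_comp (n := 2) (by norm_num) hg)]
  simp only [h.fderiv_comp_shear (hg.differentiable (by simp))]
  have hm : Differentiable ℝ fun x => fderiv ℝ γ x v * fderiv ℝ g (shear γ e x) e :=
    hγv.mul (hgd e)
  rw [fderiv_fun_sub (hgd v x) (hm x), fderiv_fun_mul (hγv x) (hgd e x)]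
  simp only [_root_.sub_apply, _root_.add_apply, _root_.smul_apply, smul_eq_mul]
  rw [h.fderiv_comp_shear (χ := fun y => fderiv ℝ g y v) ((hgv v).differentiable (by simp)),
    h.fderiv_comp_shear (χ := fun y => fderiv ℝ g y e) ((hgv e).differentiable (by simp))]
  simp only [unshearQ, fderiv_fderiv_apply hg,
    fderiv_fderiv_apply (h.smooth.of_le (by norm_num : (2 : WithTop ℕ∞) ≤ 3))]
  ring

/-- The linear combination, with coefficients `n α`, of a function and its derivatives of order
at most two. -/
noncomputable def jetForm (n : Idx d 2 → Sp d → ℝ) (f : Sp d → ℝ) (p : Sp d → Sp d → ℝ)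
    (q : Sp d → Sp d → Sp d → ℝ) (x : Sp d) : ℝ :=
  n (idx0 d 2) x * f x + ∑ i, n ⟨1, ![i]⟩ x * p (bv i) x
    + ∑ i, ∑ j, n ⟨2, ![i, j]⟩ x * q (bv j) (bv i) x

theorem sum_mul_partialD (n : Idx d 2 → Sp d → ℝ) (f : Sp d → ℝ) (x : Sp d) :
    ∑ α, n α x * partialD α f x = jetForm n f (fun v x => fderiv ℝ f x v)
      (fun v w x => fderiv ℝ (fderiv ℝ f) x w v) x := by
  rw [sum_idx_two fun α => n α x * partialD α f x]
  simp only [jetForm, partialD_idx0, partialD_one, partialD_two]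

theorem WeakLim.jetForm {n : Idx d 2 → Sp d → ℝ} (hn : ∀ α, MemLp (n α) 2)
    (hn0 : ∀ α x, x ∉ B → n α x = 0) {F : ℝ → Sp d → ℝ} {P : ℝ → Sp d → Sp d → ℝ}
    {Q : ℝ → Sp d → Sp d → Sp d → ℝ} (hF : WeakLim B F f)
    (hP : ∀ v, WeakLim B (fun ε => P ε v) (p v))
    (hQ : ∀ v w, WeakLim B (fun ε => Q ε v w) (q v w)) :
    Tendsto (fun ε => ∫ x, jetForm n (F ε) (P ε) (Q ε) x) (𝓝[>] 0)
      (𝓝 (∫ x, DGM.jetForm n f p q x)) := by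
  have e : ∀ {f p q}, (Integrable fun x => n (idx0 d 2) x * f x) →
      (∀ i, Integrable fun x => n ⟨1, ![i]⟩ x * p (bv i) x) →
      (∀ i j, Integrable fun x => n ⟨2, ![i, j]⟩ x * q (bv j) (bv i) x) →
      ∫ x, DGM.jetForm n f p q x = (∫ x, n (idx0 d 2) x * f x)
        + ∑ i, (∫ x, n ⟨1, ![i]⟩ x * p (bv i) x)
        + ∑ i, ∑ j, (∫ x, n ⟨2, ![i, j]⟩ x * q (bv j) (bv i) x) := by
    intro f p q h0 h1 h2
    simp only [DGM.jetForm]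
    have s1 : Integrable fun x => ∑ i, n ⟨1, ![i]⟩ x * p (bv i) x :=
      integrable_finsetSum _ fun i _ => h1 i
    have s2 : ∀ i, Integrable fun x => ∑ j, n ⟨2, ![i, j]⟩ x * q (bv j) (bv i) x := fun i =>
      integrable_finsetSum _ fun j _ => h2 i j
    have s01 : Integrable fun x => n (idx0 d 2) x * f x + ∑ i, n ⟨1, ![i]⟩ x * p (bv i) x :=
      h0.add s1
    rw [integral_add s01 (integrable_finsetSum _ fun i _ => s2 i), integral_add h0 s1,
      integral_finsetSum _ fun i _ => h1 i, integral_finsetSum _ fun i _ => s2 i]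
    congr 1
    refine Finset.sum_congr rfl fun i _ => ?_
    rw [integral_finsetSum _ fun j _ => h2 i j]
  have h0 := hF (n (idx0 d 2)) (hn _) (hn0 _)
  have h1 := fun i => hP (bv i) (n ⟨1, ![i]⟩) (hn _) (hn0 _)
  have h2 := fun i j => hQ (bv j) (bv i) (n ⟨2, ![i, j]⟩) (hn _) (hn0 _)
  rw [e h0.2.1 (fun i => (h1 i).2.1) (fun i j => (h2 i j).2.1)]
  refine ((h0.2.2.add (tendsto_finsetSum Finset.univ fun i _ => (h1 i).2.2)).add
    (tendsto_finsetSum Finset.univ fun i _ => tendsto_finsetSum Finset.univ fun j _ => (h2 i j).2.2)).congr' ?_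
  filter_upwards [self_mem_nhdsWithin] with ε hε
  exact (e (h0.1 ε hε) (fun i => (h1 i).1 ε hε) (fun i j => (h2 i j).1 ε hε)).symm

/-- Mollifying in sheared coordinates approximates the derivatives up to order two weakly. -/
theorem SobolevJet.tendsto_moll_shear (hJ : SobolevJet f p q) (hγ : ShearFn γ e)
    (hB : IsCompact B) {n : Idx d 2 → Sp d → ℝ} (hn : ∀ α, MemLp (n α) 2)
    (hn0 : ∀ α x, x ∉ B → n α x = 0) :
    Tendsto (fun ε => ∫ x, ∑ α, n α x *
        partialD α (fun x => moll (mollifier ε) f (shear γ e x)) x) (𝓝[>] 0)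
      (𝓝 (∫ x, jetForm n (fun x => f (shear γ e x)) (unshearP γ e p) (unshearQ γ e p q) x)) := by
  simp only [sum_mul_partialD]
  have hγ2 : ContDiff ℝ 2 γ := hγ.smooth.of_le (by norm_num)
  have c0 : ∀ v, Continuous fun x => fderiv ℝ γ x v := fun v =>
    (hγ.contDiff_fderiv_apply v).continuous
  have c2 : ∀ v w, Continuous fun x => fderiv ℝ (fderiv ℝ γ) x w v :=
    continuous_fderiv_fderiv_apply hγ2
  have lP : ∀ v, WeakLim B (fun ε x => moll (mollifier ε) (p v) (shear γ e x))
    (fun x => p v (shear γ e x)) := fun v => weakLim_moll_shear hγ hB (hJ.memp v)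
  have lQ : ∀ v w, WeakLim B (fun ε x => moll (mollifier ε) (q v w) (shear γ e x))
    (fun x => q v w (shear γ e x)) := fun v w => weakLim_moll_shear hγ hB (hJ.memq v w)
  have fP : ∀ ε, 0 < ε → ∀ v y, fderiv ℝ (moll (mollifier ε) f) y v =
      moll (mollifier ε) (p v) y := fun ε hε v y =>
    fderiv_moll_of_weakD (contDiff_mollifier ε) (hasCompactSupport_mollifier hε)
      (locallyIntegrable_of_memLp_two hJ.memf) (hJ.weak_one v) y
  -- Classical derivatives of the mollified function are mollifications of the weak derivatives, for
  -- which weak limits are available.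
  have fQ : ∀ ε, 0 < ε → ∀ v w y, fderiv ℝ (fderiv ℝ (moll (mollifier ε) f)) y w v =
      moll (mollifier ε) (q v w) y := fun ε hε v w y =>
    fderiv_fderiv_moll_of_weakD₂ (contDiff_mollifier ε) (hasCompactSupport_mollifier hε)
      (locallyIntegrable_of_memLp_two hJ.memf) (hJ.weak_two v w) y
  refine WeakLim.jetForm hn hn0 (weakLim_moll_shear hγ hB hJ.memf) (fun v => ?_) fun v w => ?_
  · refine WeakLim.congr ((lP v).sub hB ((lP e).continuous_mul hB (c0 v))) fun ε hε x => ?_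
    rw [hγ.fderiv_comp_shear ((contDiff_moll_mollifier hε hJ.memf).differentiable (by simp)),
      fP ε hε, fP ε hε]
  · refine WeakLim.congr (((lQ v w).sub hB ((lQ v e).continuous_mul hB (c0 w))).sub hB
      ((((lQ e w).sub hB ((lQ e e).continuous_mul hB (c0 w))).continuous_mul hB (c0 v)).add
        ((lP e).continuous_mul hB (c2 v w)))) fun ε hε x => ?_
    rw [hγ.fderiv_fderiv_comp_shear ((contDiff_moll_mollifier hε hJ.memf).of_le two_le_infty)]
    simp only [unshearQ, fP ε hε, fQ ε hε]

end WeakLimits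

/-! ### Flattening the boundary and dividing by the normal coordinate -/

section Division

variable {d : ℕ}

/-- Integrals over `[0, 1]` depend smoothly on parameters. -/
theorem contDiff_integral_param {h : Sp d × ℝ → ℝ} {n : ℕ∞} (hh : ContDiff ℝ n h) :
    ContDiff ℝ n fun p => ∫ t in (0 : ℝ)..1, h (p, t) := by
  -- The integral is written as a convolution at `0` with the indicator of `(0, 1]`, which needs a
  -- compactly supported kernel. This cutoff equals `1` for `|x| ≤ 1` and vanishes outside `[-2,
  -- 2]`.
  let χ : ℝ → ℝ := fun x => Real.smoothTransition (3 - x ^ 2)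
  have hχ : ContDiff ℝ n χ :=
    Real.smoothTransition.contDiff.comp (contDiff_const.sub (contDiff_id.pow 2))
  let g : Sp d → ℝ → ℝ := fun p x => χ x * h (p, -x)
  have hg : ContDiff ℝ n ↿g := by
    have e : ↿g = fun q : Sp d × ℝ => χ q.2 * h (q.1, -q.2) := rfl
    rw [e]
    exact (hχ.comp contDiff_snd).mul (hh.comp (contDiff_fst.prodMk contDiff_snd.neg))
  have hf : LocallyIntegrable (Set.indicator (Set.Ioc (0 : ℝ) 1) fun _ => (1 : ℝ)) :=
    ((integrable_indicator_iff measurableSet_Ioc).2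
      (integrableOn_const (by simp) (by simp))).locallyIntegrable
  have key := contDiffOn_convolution_right_with_param (μ := volume)
    (ContinuousLinearMap.mul ℝ ℝ) (g := g) (s := Set.univ) (k := Set.Icc (-2 : ℝ) 2) isOpen_univ
    isCompact_Icc (fun p x _ hx => by
      have : 3 - x ^ 2 ≤ 0 := by
        by_contra hne
        exact hx ⟨by nlinarith, by nlinarith⟩
      simp [g, χ, Real.smoothTransition.zero_of_nonpos this]) hf hg.contDiffOn
  rw [Set.univ_prod_univ, contDiffOn_univ] at key
  have k2 : ContDiff ℝ n fun p : Sp d => ((p, (0 : ℝ)) : Sp d × ℝ) :=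
    contDiff_id.prodMk contDiff_const
  have := key.comp k2
  convert this using 1
  funext p
  simp only [Function.comp, convolution, ContinuousLinearMap.mul_apply']
  rw [intervalIntegral.integral_of_le zero_le_one, ← integral_indicator measurableSet_Ioc]
  refine integral_congr_ae (Eventually.of_forall fun t => ?_)
  by_cases ht : t ∈ Set.Ioc (0 : ℝ) 1
  · have h1 : χ (0 - t) = 1 := Real.smoothTransition.one_of_one_le (by nlinarith [ht.1, ht.2])
    simp only [Set.indicator_of_mem ht, g, h1]
    simp
  · simp [Set.indicator_of_notMem ht]

/-- Division by a linear function. -/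
theorem exists_contDiff_quotient {g : Sp d → ℝ} (hg : ContDiff ℝ 3 g) (e : Sp d) :
    ∃ q : Sp d → ℝ, ContDiff ℝ 2 q ∧
      (∀ y, g y - g (y - ⟪e, y⟫_ℝ • e) = ⟪e, y⟫_ℝ * q y) ∧
      ∀ y, ⟪e, y⟫_ℝ = 0 → q y = fderiv ℝ g y e := by
  have hge : ContDiff ℝ 2 fun y => fderiv ℝ g y e :=
    contDiff_fderiv_apply (n := 3) (m := 2) hg (by norm_num) e
  have hl : ContDiff ℝ 2 fun y : Sp d => ⟪e, y⟫_ℝ := contDiff_const.inner ℝ contDiff_id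
  -- For `t` from `0` to `1` this runs along the segment from the projection of `y` on the
  -- hyperplane to `y`. The quotient is the mean of `∂_e g` on it, hence one order less smooth than
  -- `g`.
  let P : Sp d × ℝ → Sp d := fun p => p.1 - ((1 - p.2) * ⟪e, p.1⟫_ℝ) • e
  have hP : ContDiff ℝ 2 P := contDiff_fst.sub
    (((contDiff_const.sub contDiff_snd).mul (hl.comp contDiff_fst)).smul contDiff_const)
  refine ⟨fun y => ∫ t in (0 : ℝ)..1, fderiv ℝ g (P (y, t)) e,
    contDiff_integral_param (n := 2) (hge.comp hP), fun y => ?_, fun y hy => ?_⟩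
  · rw [← intervalIntegral.integral_const_mul]
    have hd : ∀ t ∈ Set.uIcc (0 : ℝ) 1, HasDerivAt (fun t => g (P (y, t)))
        (⟪e, y⟫_ℝ * fderiv ℝ g (P (y, t)) e) t := by
      intro t _
      have h1 : HasDerivAt (fun t : ℝ => P (y, t)) (⟪e, y⟫_ℝ • e) t := by
        have := ((((hasDerivAt_id t).const_sub 1).mul_const ⟪e, y⟫_ℝ).smul_const e).const_sub y
        simpa [P] using this
      have h2 : HasDerivAt (fun t => g (P (y, t))) (fderiv ℝ g (P (y, t)) (⟪e, y⟫_ℝ • e)) t :=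
        (hg.differentiable (by norm_num) (P (y, t))).hasFDerivAt.comp_hasDerivAt t h1
      rwa [map_smul, smul_eq_mul] at h2
    have hc : Continuous fun t : ℝ => ⟪e, y⟫_ℝ * fderiv ℝ g (P (y, t)) e :=
      continuous_const.mul (hge.continuous.comp (hP.continuous.comp (Continuous.prodMk_right y)))
    rw [intervalIntegral.integral_eq_sub_of_hasDerivAt hd (hc.intervalIntegrable _ _)]
    simp [P]
  · simp [P, hy]

variable {Ω : Set (Sp d)} {γ η : Sp d → ℝ} {e x₀ : Sp d} {ρ : ℝ}

theorem inner_shear (he : ‖e‖ = 1) (x : Sp d) : ⟪e, shear γ e x⟫_ℝ = ⟪e, x⟫_ℝ - γ x := by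
  rw [shear, inner_sub_right, inner_smul_right, real_inner_self_eq_norm_sq, he]; ring

theorem inner_unshear (he : ‖e‖ = 1) (y : Sp d) : ⟪e, unshear γ e y⟫_ℝ = ⟪e, y⟫_ℝ + γ y := by
  rw [unshear, inner_add_right, inner_smul_right, real_inner_self_eq_norm_sq, he]; ring

theorem inner_sub_proj (he : ‖e‖ = 1) (y : Sp d) : ⟪e, y - ⟪e, y⟫_ℝ • e⟫_ℝ = 0 := by
  rw [inner_sub_right, inner_smul_right, real_inner_self_eq_norm_sq, he]; ring

/-- Flattening of the boundary. -/
theorem ShearFn.exists_ball_iff (hγ : ShearFn γ e) (he : ‖e‖ = 1) (hρ : 0 < ρ)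
    (hball : ∀ x ∈ Metric.ball x₀ ρ, (x ∈ Ω ↔ γ x < ⟪e, x⟫_ℝ)) :
    ∃ δ, 0 < δ ∧ ∀ y ∈ Metric.ball (shear γ e x₀) δ, (unshear γ e y ∈ Ω ↔ 0 < ⟪e, y⟫_ℝ) := by
  have hc : Continuous (unshear γ e) := hγ.contDiff_unshear.continuous
  have hn : unshear γ e ⁻¹' Metric.ball x₀ ρ ∈ 𝓝 (shear γ e x₀) :=
    hc.continuousAt.preimage_mem_nhds (by
      rw [hγ.unshear_shear]; exact Metric.ball_mem_nhds _ hρ)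
  obtain ⟨δ, hδ, hsub⟩ := Metric.mem_nhds_iff.1 hn
  refine ⟨δ, hδ, fun y hy => ?_⟩
  rw [hball _ (hsub hy), inner_unshear he, unshear, hγ.inv]
  constructor <;> intro h <;> linarith

/-- A boundary point of an open set does not belong to it, so the normal coordinate is not positive;
it is a limit of points of `Ω`, so the coordinate is not negative. -/
theorem ShearFn.inner_shear_eq_zero (hγ : ShearFn γ e) (hΩ : IsOpen Ω) (hx₀ : x₀ ∈ frontier Ω)
    {δ : ℝ} (hδ : 0 < δ)
    (hb : ∀ y ∈ Metric.ball (shear γ e x₀) δ, (unshear γ e y ∈ Ω ↔ 0 < ⟪e, y⟫_ℝ)) :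
    ⟪e, shear γ e x₀⟫_ℝ = 0 := by
  have hx : x₀ ∉ Ω := by
    rw [hΩ.frontier_eq] at hx₀; exact hx₀.2
  refine le_antisymm ?_ ?_
  · have := (hb _ (Metric.mem_ball_self hδ)).not.1 (by rwa [hγ.unshear_shear])
    exact not_lt.1 this
  · by_contra hne
    have hl : Continuous fun x => ⟪e, shear γ e x⟫_ℝ :=
      continuous_const.inner hγ.contDiff_shear.continuous
    have h1 : ∀ᶠ x in 𝓝 x₀, ⟪e, shear γ e x⟫_ℝ < 0 :=
      hl.continuousAt.eventually_lt continuousAt_const (not_le.1 hne)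
    have h2 : ∀ᶠ x in 𝓝 x₀, shear γ e x ∈ Metric.ball (shear γ e x₀) δ :=
      hγ.contDiff_shear.continuous.continuousAt (Metric.ball_mem_nhds _ hδ)
    have h3 := mem_closure_iff_frequently.1 (frontier_subset_closure hx₀)
    obtain ⟨x, hxΩ, hx1, hx2⟩ := (h3.and_eventually (h1.and h2)).exists
    have := (hb _ hx2).1 (by rwa [hγ.unshear_shear])
    linarith

/-- A point of the hyperplane is excluded from `Ω` by the chart, but it is the limit of the points
`y + τ • e`, `τ > 0`, which are included. -/
theorem ShearFn.unshear_mem_frontier (hγ : ShearFn γ e) (he : ‖e‖ = 1) (hΩ : IsOpen Ω)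
    {y₀ : Sp d} {δ : ℝ}
    (hb : ∀ y ∈ Metric.ball y₀ δ, (unshear γ e y ∈ Ω ↔ 0 < ⟪e, y⟫_ℝ)) {y : Sp d}
    (hy : y ∈ Metric.ball y₀ δ) (hy0 : ⟪e, y⟫_ℝ = 0) : unshear γ e y ∈ frontier Ω := by
  rw [hΩ.frontier_eq]
  refine ⟨?_, fun h => by have := (hb y hy).1 h; linarith⟩
  have hc : Continuous fun τ : ℝ => y + τ • e := by fun_prop
  have ht : Tendsto (fun τ : ℝ => unshear γ e (y + τ • e)) (𝓝[>] 0) (𝓝 (unshear γ e y)) := by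
    have := (hγ.contDiff_unshear.continuous.comp hc).tendsto 0
    simp only [Function.comp, zero_smul, add_zero] at this
    exact this.mono_left nhdsWithin_le_nhds
  refine mem_closure_of_tendsto ht ?_
  have h1 : ∀ᶠ τ : ℝ in 𝓝[>] 0, y + τ • e ∈ Metric.ball y₀ δ := by
    have : Tendsto (fun τ : ℝ => y + τ • e) (𝓝[>] 0) (𝓝 y) := by
      have := hc.tendsto 0
      simp only [zero_smul, add_zero] at this
      exact this.mono_left nhdsWithin_le_nhds
    exact this (Metric.isOpen_ball.mem_nhds hy)
  filter_upwards [h1, self_mem_nhdsWithin] with τ hτ hτ0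
  refine (hb _ hτ).2 ?_
  rw [inner_add_right, inner_smul_right, real_inner_self_eq_norm_sq, he, hy0]
  simpa using hτ0

/-- In flat coordinates `η` vanishes on the hyperplane, so its tangential derivatives are zero. If
the normal derivative vanished too, the whole differential of `η` at `x₀` would vanish. -/
theorem ShearFn.fderiv_unshear_ne_zero (hγ : ShearFn γ e) (he : ‖e‖ = 1) (hΩ : IsOpen Ω)
    {δ : ℝ} (hδ : 0 < δ)
    (hb : ∀ y ∈ Metric.ball (shear γ e x₀) δ, (unshear γ e y ∈ Ω ↔ 0 < ⟪e, y⟫_ℝ))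
    (h0 : ⟪e, shear γ e x₀⟫_ℝ = 0) (hη : ContDiff ℝ 3 η) (hηz : ∀ x ∈ frontier Ω, η x = 0)
    (hηd : fderiv ℝ η x₀ ≠ 0) :
    fderiv ℝ (fun y => η (unshear γ e y)) (shear γ e x₀) e ≠ 0 := by
  intro hz
  refine hηd ?_
  set χ : Sp d → ℝ := fun y => η (unshear γ e y) with hχdef
  have hχ : Differentiable ℝ χ := (hη.comp hγ.contDiff_unshear).differentiable (by norm_num)
  have hall : ∀ v, fderiv ℝ χ (shear γ e x₀) v = 0 := by
    intro v
    have hv : fderiv ℝ χ (shear γ e x₀) (v - ⟪e, v⟫_ℝ • e) = 0 := by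
      have h1 := ((hχ (shear γ e x₀)).hasFDerivAt.hasLineDerivAt (v - ⟪e, v⟫_ℝ • e))
      have h2 : (fun t : ℝ => χ (shear γ e x₀ + t • (v - ⟪e, v⟫_ℝ • e))) =ᶠ[𝓝 0] fun _ => 0 := by
        have hc : Continuous fun t : ℝ => shear γ e x₀ + t • (v - ⟪e, v⟫_ℝ • e) := by fun_prop
        have := hc.continuousAt.preimage_mem_nhds (x := 0)
          (t := Metric.ball (shear γ e x₀) δ) (by simpa using Metric.ball_mem_nhds _ hδ)
        filter_upwards [this] with t ht
        refine hηz _ (hγ.unshear_mem_frontier he hΩ hb ht ?_)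
        rw [inner_add_right, inner_smul_right, inner_sub_proj he, h0]; ring
      exact h1.unique ((hasDerivAt_const (0 : ℝ) (0 : ℝ)).congr_of_eventuallyEq h2)
    rw [map_sub, map_smul, hz, smul_zero, sub_zero] at hv
    exact hv
  have e1 : η = fun x => χ (shear γ e x) := by
    funext x; simp only [hχdef, hγ.unshear_shear]
  ext v
  rw [e1, hγ.fderiv_comp_shear hχ, hall, hall]
  simp

theorem norm_sub_proj_le (he : ‖e‖ = 1) (z : Sp d) : ‖z - ⟪e, z⟫_ℝ • e‖ ≤ ‖z‖ := by
  have h1 : ‖z - ⟪e, z⟫_ℝ • e‖ ^ 2 = ‖z‖ ^ 2 - ⟪e, z⟫_ℝ ^ 2 := by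
    rw [norm_sub_sq_real, inner_smul_right, norm_smul, he, real_inner_comm, Real.norm_eq_abs,
      mul_one, sq_abs]
    ring
  exact abs_le_of_sq_le_sq' (by nlinarith [sq_nonneg ⟪e, z⟫_ℝ]) (norm_nonneg _) |>.2

/-- In flattened coordinates, `η` is the distance to the boundary times a non-vanishing
`C²` function. -/
theorem ShearFn.exists_factor (hγ : ShearFn γ e) (he : ‖e‖ = 1) (hΩ : IsOpen Ω) (hρ : 0 < ρ)
    (hball : ∀ x ∈ Metric.ball x₀ ρ, (x ∈ Ω ↔ γ x < ⟪e, x⟫_ℝ)) (hx₀ : x₀ ∈ frontier Ω)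
    (hη : ContDiff ℝ 3 η) (hηz : ∀ x ∈ frontier Ω, η x = 0) (hηd : fderiv ℝ η x₀ ≠ 0) :
    ⟪e, shear γ e x₀⟫_ℝ = 0 ∧ ∃ δ, 0 < δ ∧
      (∀ y ∈ Metric.ball (shear γ e x₀) δ, (unshear γ e y ∈ Ω ↔ 0 < ⟪e, y⟫_ℝ)) ∧
      ∃ θ : Sp d → ℝ, ContDiff ℝ 2 θ ∧ ∀ y ∈ Metric.ball (shear γ e x₀) δ,
        θ y ≠ 0 ∧ η (unshear γ e y) = ⟪e, y⟫_ℝ * θ y := by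
  obtain ⟨δ₁, hδ₁, hb⟩ := hγ.exists_ball_iff he hρ hball
  have h0 := hγ.inner_shear_eq_zero hΩ hx₀ hδ₁ hb
  obtain ⟨θ, hθ, hθ1, hθ2⟩ := exists_contDiff_quotient (hη.comp hγ.contDiff_unshear) e
  have hne : θ (shear γ e x₀) ≠ 0 := by
    rw [hθ2 _ h0]
    exact hγ.fderiv_unshear_ne_zero he hΩ hδ₁ hb h0 hη hηz hηd
  obtain ⟨δ₂, hδ₂, hsub⟩ := Metric.mem_nhds_iff.1
    (hθ.continuous.continuousAt.eventually_ne hne : {y | θ y ≠ 0} ∈ 𝓝 (shear γ e x₀))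
  refine ⟨h0, min δ₁ δ₂, lt_min hδ₁ hδ₂, fun y hy => hb y (Metric.ball_subset_ball
    (min_le_left _ _) hy), θ, hθ, fun y hy => ⟨hsub (Metric.ball_subset_ball
    (min_le_right _ _) hy), ?_⟩⟩
  have hy1 : y ∈ Metric.ball (shear γ e x₀) δ₁ := Metric.ball_subset_ball (min_le_left _ _) hy
  -- The centre lies on the hyperplane, so orthogonal projection does not increase the distance to
  -- it; hence `η` is zero at the projected point.
  have hy2 : y - ⟪e, y⟫_ℝ • e ∈ Metric.ball (shear γ e x₀) δ₁ := by
    rw [mem_ball_iff_norm] at hy1 ⊢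
    refine lt_of_le_of_lt ?_ hy1
    have := norm_sub_proj_le he (y - shear γ e x₀)
    rw [inner_sub_right, h0, sub_zero] at this
    rwa [sub_right_comm]
  have h3 := hηz _ (hγ.unshear_mem_frontier he hΩ hb hy2 (inner_sub_proj he y))
  have h4 := hθ1 y
  simp only [Function.comp] at h4
  rw [h3, sub_zero] at h4
  exact h4

end Division

/-! ### Annihilation of localized `H²` functions -/

section Patches

variable {d : ℕ}

theorem contDiff_div_of_tsupport {g θ : Sp d → ℝ} {n : WithTop ℕ∞} (hg : ContDiff ℝ n g)
    (hθ : ContDiff ℝ n θ) {V : Set (Sp d)} (hne : ∀ y ∈ V, θ y ≠ 0) (hs : tsupport g ⊆ V) :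
    ContDiff ℝ n fun y => g y / θ y := by
  refine contDiff_iff_contDiffAt.2 fun y => ?_
  by_cases hy : y ∈ tsupport g
  · exact hg.contDiffAt.div hθ.contDiffAt (hne y (hs hy))
  · refine contDiffAt_const (c := (0 : ℝ)) |>.congr_of_eventuallyEq ?_
    filter_upwards [notMem_tsupport_iff_eventuallyEq.1 hy] with z hz
    simp [hz]

/-- On the hyperplane the quotient equals the normal derivative of `g`, so it also vanishes outside
the closed support of `g`. The support control keeps the later division by `θ` inside the patch. -/
theorem exists_quotient_of_vanishing {g : Sp d → ℝ} (hg : ContDiff ℝ ∞ g) {e : Sp d}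
    (he : ‖e‖ = 1) (h0 : ∀ y, ⟪e, y⟫_ℝ = 0 → g y = 0) :
    ∃ q : Sp d → ℝ, ContDiff ℝ 2 q ∧ (∀ y, g y = ⟪e, y⟫_ℝ * q y) ∧ tsupport q ⊆ tsupport g := by
  obtain ⟨q, hq, hq1, hq2⟩ := exists_contDiff_quotient (hg.of_le three_le_infty) e
  have h1 : ∀ y, g y = ⟪e, y⟫_ℝ * q y := fun y => by
    rw [← hq1 y, h0 _ (inner_sub_proj he y), sub_zero]
  refine ⟨q, hq, h1, closure_minimal (fun y hy => ?_) (isClosed_tsupport _)⟩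
  by_contra hne
  refine hy ?_
  by_cases hy0 : ⟪e, y⟫_ℝ = 0
  · rw [hq2 y hy0, image_eq_zero_of_notMem_tsupport fun h => hne (tsupport_fderiv_subset ℝ h)]
    rfl
  · have := h1 y
    rw [image_eq_zero_of_notMem_tsupport hne] at this
    exact (mul_eq_zero.1 this.symm).resolve_left hy0

variable {Ω B : Set (Sp d)} {γ η : Sp d → ℝ} {e x₀ : Sp d} {ρ : ℝ} {n : Idx d 2 → Sp d → ℝ}

/-- `n` annihilates all `η φ` with `φ ∈ C_c²`. -/
def Annihilates (n : Idx d 2 → Sp d → ℝ) (η : Sp d → ℝ) : Prop :=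
  ∀ φ : Sp d → ℝ, ContDiff ℝ 2 φ → HasCompactSupport φ →
    ∫ x, ∑ α, n α x * partialD α (fun x => η x * φ x) x = 0

/-- If `n` annihilates all `η φ`, it annihilates functions supported inside `Ω`. -/
theorem Annihilates.interior (h : Annihilates n η) (hΩ : IsOpen Ω) (hη : ContDiff ℝ 3 η)
    (hηp : ∀ x ∈ Ω, 0 < η x) (hB : IsCompact B) (hn : ∀ α, MemLp (n α) 2)
    (hn0 : ∀ α x, x ∉ B → n α x = 0) {K : Set (Sp d)} (hK : IsCompact K) (hKΩ : K ⊆ Ω)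
    {f : Sp d → ℝ} {p : Sp d → Sp d → ℝ} {q : Sp d → Sp d → Sp d → ℝ}
    (hf : SobolevJet f p q) (hs : ∀ x, x ∉ K → f x = 0) : ∫ x, jetForm n f p q x = 0 := by
  -- The trivial shear turns the sheared limit into an ordinary mollification limit.
  have hγ : ShearFn (fun _ : Sp d => (0 : ℝ)) (0 : Sp d) := ⟨contDiff_const, fun _ _ => rfl⟩
  have key := hf.tendsto_moll_shear hγ hB hn hn0
  have e1 : ∀ x : Sp d, shear (fun _ => 0) 0 x = x := fun x => by simp [shear]
  have e2 : unshearP (fun _ => 0) 0 p = p := by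
    funext v x; simp [unshearP, e1]
  have e3 : unshearQ (fun _ => 0) 0 p q = q := by
    funext v w x
    have : fderiv ℝ (fun _ : Sp d => (0 : ℝ)) = fun _ => 0 := funext fun x => by simp
    simp [unshearQ, e1, this]
  simp only [e1, e2, e3] at key
  have hts : tsupport f ⊆ K := closure_minimal (fun x hx => by_contra fun h => hx (hs x h))
    hK.isClosed
  have hfc : HasCompactSupport f := HasCompactSupport.intro hK hs
  obtain ⟨δ, hδ, hδO⟩ := hfc.exists_cthickening_subset_open hΩ (hts.trans hKΩ)
  refine tendsto_nhds_unique (key.congr' ?_) tendsto_const_nhds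
  filter_upwards [Ioo_mem_nhdsGT hδ] with ε hε
  have hg := contDiff_moll_mollifier hε.1 hf.memf
  have hgs : tsupport (moll (mollifier ε) f) ⊆ Ω :=
    (tsupport_moll_subset hε.1).trans ((Metric.cthickening_mono hε.2.le _).trans hδO)
  -- The mollification is still supported in `Ω`, where `η > 0`, so it is `η` times the `C²`
  -- function obtained by division.
  have hq := contDiff_div_of_tsupport (hg.of_le two_le_infty) (hη.of_le (by norm_num))
    (fun y hy => (hηp y hy).ne') hgs
  have hqc : HasCompactSupport fun y => moll (mollifier ε) f y / η y := by
    simp only [div_eq_mul_inv]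
    exact (hasCompactSupport_moll hε.1 hfc).mul_right
  have := h _ hq hqc
  have e4 : (fun x => η x * (moll (mollifier ε) f x / η x)) = moll (mollifier ε) f := by
    funext x
    by_cases hx : x ∈ Ω
    · exact mul_div_cancel₀ _ (hηp x hx).ne'
    · rw [image_eq_zero_of_notMem_tsupport fun h => hx (hgs h)]; simp
  rwa [e4] at this

/-- If `n` annihilates all `η φ`, it annihilates functions in `H²` supported near a boundary point
which vanish at the boundary. -/
theorem Annihilates.boundary (h : Annihilates n η) (hγ : ShearFn γ e) (he : ‖e‖ = 1)
    (hΩ : IsOpen Ω) (hρ : 0 < ρ) (hball : ∀ x ∈ Metric.ball x₀ ρ, (x ∈ Ω ↔ γ x < ⟪e, x⟫_ℝ))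
    (hx₀ : x₀ ∈ frontier Ω) (hη : ContDiff ℝ 3 η) (hηz : ∀ x ∈ frontier Ω, η x = 0)
    (hηd : fderiv ℝ η x₀ ≠ 0) (hB : IsCompact B) (hn : ∀ α, MemLp (n α) 2)
    (hn0 : ∀ α x, x ∉ Ω → n α x = 0) (hΩB : Ω ⊆ B) :
    ∃ U, IsOpen U ∧ x₀ ∈ U ∧ (∀ x ∈ U, γ x < ⟪e, x⟫_ℝ → x ∈ Ω) ∧
      ∀ K, IsCompact K → K ⊆ U → ∀ f p q, H2Data {x | γ x < ⟪e, x⟫_ℝ} f p q →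
        SupportedIn (Ω ∩ K) f p q → ∫ x, jetForm n f p q x = 0 := by
  obtain ⟨h0, δ, hδ, hb, θ, hθ, hθη⟩ := hγ.exists_factor he hΩ hρ hball hx₀ hη hηz hηd
  obtain ⟨V, hV⟩ : ∃ V, V = Metric.ball (shear γ e x₀) δ := ⟨_, rfl⟩
  have hVo : IsOpen V := hV ▸ Metric.isOpen_ball
  rw [← hV] at hb hθη
  have hΨc : Continuous (shear γ e) := hγ.contDiff_shear.continuous
  have hx₀V : shear γ e x₀ ∈ V := hV ▸ Metric.mem_ball_self hδ
  -- A ball centred on the hyperplane is symmetric under the reflection, so the odd extension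
  -- remains in the patch.
  have hflipV : ∀ y ∈ V, flip e y ∈ V := by
    intro y hy
    rw [hV, Metric.mem_ball] at hy ⊢
    have h1 : dist (flip e y) (flip e (shear γ e x₀)) = dist y (shear γ e x₀) :=
      (flip e).dist_map _ _
    rw [flip_of_inner_eq_zero he h0] at h1
    rwa [h1]
  refine ⟨shear γ e ⁻¹' V, hVo.preimage hΨc, hx₀V,
    fun x hx hlt => ?_, fun K hK hKU f p q hf hs => ?_⟩
  · have := (hb _ hx).2 (by rw [inner_shear he]; linarith)
    rwa [hγ.unshear_shear] at this
  have hG := hf.shear hγ (K := K) hK (fun x hx => hs x fun h => hx h.2)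
    (O' := {y | 0 < ⟪e, y⟫_ℝ}) (fun x hx => by
      have : 0 < ⟪e, shear γ e x⟫_ℝ := hx
      rw [inner_shear he] at this
      exact sub_pos.1 this)
  have hpos : ∀ y, unshear γ e y ∈ Ω ∩ K → y ∈ V ∧ 0 < ⟪e, y⟫_ℝ := by
    intro y hy
    have h1 : y ∈ V := by
      have := hKU hy.2
      rwa [Set.mem_preimage, hγ.shear_unshear] at this
    exact ⟨h1, (hb y h1).1 hy.1⟩
  have hsG := hs.shear (γ := γ) (e := e)
  have hJ := hG.odd he fun y hy => hsG y fun h => hy (hpos y h).2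
  have key := hJ.tendsto_moll_shear hγ hB hn fun α x hx => hn0 α x fun h => hx (hΩB h)
  obtain ⟨F, hF⟩ : ∃ F, F = oddF e fun y => f (unshear γ e y) := ⟨_, rfl⟩
  rw [← hF] at key hJ
  have hK' : IsCompact (shear γ e '' K) := hK.image hΨc
  have hK'' : IsCompact (shear γ e '' K ∪ flip e '' (shear γ e '' K)) :=
    hK'.union (hK'.image (flip e).continuous)
  have hK'V : shear γ e '' K ⊆ V := Set.image_subset_iff.2 hKU
  have hF0 : ∀ y, y ∉ shear γ e '' K ∪ flip e '' (shear γ e '' K) → F y = 0 := by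
    intro y hy
    rw [Set.mem_union, not_or] at hy
    have h1 : f (unshear γ e y) = 0 := (hs _ fun h => hy.1 ⟨_, h.2, hγ.shear_unshear y⟩).1
    have h2 : f (unshear γ e (flip e y)) = 0 := (hs _ fun h => hy.2
      ⟨flip e y, ⟨_, h.2, hγ.shear_unshear _⟩, flip_flip e y⟩).1
    simp [hF, oddF, h1, h2]
  have hFc : HasCompactSupport F := HasCompactSupport.intro hK'' hF0
  have hFV : tsupport F ⊆ V :=
    (closure_minimal (Function.support_subset_iff'.2 hF0) hK''.isClosed).trans
      (Set.union_subset hK'V (Set.image_subset_iff.2 fun y hy => hflipV y (hK'V hy)))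
  obtain ⟨δ', hδ', hδO⟩ := hFc.exists_cthickening_subset_open hVo hFV
  have hlim : ∫ x, jetForm n (fun x => F (shear γ e x)) (unshearP γ e (oddP e (shearP γ e p)))
      (unshearQ γ e (oddP e (shearP γ e p)) (oddQ e (shearQ γ e p q))) x = 0 := by
    refine tendsto_nhds_unique (key.congr' ?_) tendsto_const_nhds
    filter_upwards [Ioo_mem_nhdsGT hδ'] with ε hε
    have hg := contDiff_moll_mollifier hε.1 hJ.memf
    -- The mollified odd function is zero on the hyperplane, hence equals `⟪e, y⟫ r`. With `η = ⟪e,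
    -- y⟫ θ` in these coordinates it is `η` times `r / θ`, to which the hypothesis applies.
    obtain ⟨r, hr, hr1, hr2⟩ := exists_quotient_of_vanishing hg he
      fun y hy => by rw [hF]; exact moll_oddF_eq_zero he ε _ hy
    have hrV : tsupport r ⊆ V := hr2.trans ((tsupport_moll_subset hε.1).trans
      ((Metric.cthickening_mono hε.2.le _).trans hδO))
    have hrc : HasCompactSupport r := (hasCompactSupport_moll hε.1 hFc).of_isClosed_subset
      (isClosed_tsupport _) hr2
    have hq := contDiff_div_of_tsupport hr hθ (fun y hy => (hθη y hy).1) hrV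
    have hqc : HasCompactSupport fun y => r y / θ y := by
      simp only [div_eq_mul_inv]
      exact hrc.mul_right
    have := h _ (hγ.contDiff_comp (by norm_num) hq) (hqc.comp_homeomorph hγ.homeo)
    refine Eq.trans ?_ this
    have e4 : (fun x => η x * (r (shear γ e x) / θ (shear γ e x))) =
        fun x => moll (mollifier ε) F (shear γ e x) := by
      funext x
      have hF' : moll (mollifier ε) F (shear γ e x) = _ := hr1 (shear γ e x)
      rw [hF']
      by_cases hx : shear γ e x ∈ V
      · obtain ⟨h1, h2⟩ := hθη _ hx
        rw [hγ.unshear_shear] at h2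
        rw [h2]
        field_simp
      · rw [image_eq_zero_of_notMem_tsupport fun h => hx (hrV h)]; simp
    rw [← e4]
  rw [← hlim]
  refine integral_congr_ae (Eventually.of_forall fun x => ?_)
  by_cases hx : x ∈ Ω
  -- At points of `Ω` the mirror image contributes nothing, and undoing the shear returns the
  -- original derivatives; outside `Ω` the coefficients `n` vanish.
  · have hnot : unshear γ e (flip e (shear γ e x)) ∉ Ω ∩ K := by
      intro hmem
      obtain ⟨h1, h2⟩ := hpos _ hmem
      have h3 := hflipV _ h1
      rw [flip_flip] at h3
      have h4 := (hb _ h3).1 (by rwa [hγ.unshear_shear])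
      rw [inner_flip he] at h2
      linarith
    obtain ⟨z1, z2, z3⟩ := hsG _ hnot
    have hγ2 : ContDiff ℝ 2 γ := hγ.smooth.of_le (by norm_num)
    have hee : ∀ v, fderiv ℝ (fderiv ℝ γ) x e v = 0 := fun v => by
      rw [fderiv_fderiv_apply hγ2]; exact hγ.fderiv_fderiv_self v x
    have hee' : ∀ v, fderiv ℝ (fderiv ℝ γ) x v e = 0 := fun v => by
      rw [fderiv_fderiv_comm hγ2]; exact hee v
    have e1 : F (shear γ e x) = f x := by
      simp only [hF, oddF, z1, hγ.unshear_shear, sub_zero]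
    have e2 : ∀ v, unshearP γ e (oddP e (shearP γ e p)) v x = p v x := fun v => by
      simp only [unshearP, oddP, z2, sub_zero]
      simp only [shearP, hγ.unshear_shear, hγ.fderiv_self]
      ring
    have e3 : ∀ v w, unshearQ γ e (oddP e (shearP γ e p)) (oddQ e (shearQ γ e p q)) v w x =
        q v w x := fun v w => by
      simp only [unshearQ, oddP, oddQ, z2, z3, sub_zero]
      simp only [shearP, shearQ, hγ.unshear_shear, hγ.fderiv_self, hee, hee']
      ring
    simp only [jetForm, e1, e2, e3]
  · simp [jetForm, hn0 _ x hx]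

end Patches

/-! ### Density of the functions `η φ` in dual form -/

section Density

variable {d : ℕ} {Ω B : Set (Sp d)} {η : Sp d → ℝ} {n : Idx d 2 → Sp d → ℝ} {x₀ : Sp d}
  {f : Sp d → ℝ} {p : Sp d → Sp d → ℝ} {q : Sp d → Sp d → Sp d → ℝ}

/-- The first derivatives of `ζ f`. -/
noncomputable def mulP (ζ f : Sp d → ℝ) (p : Sp d → Sp d → ℝ) (v x : Sp d) : ℝ :=
  ζ x * p v x + fderiv ℝ ζ x v * f x

/-- The second derivatives of `ζ f`. -/
noncomputable def mulQ (ζ f : Sp d → ℝ) (p : Sp d → Sp d → ℝ) (q : Sp d → Sp d → Sp d → ℝ)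
    (v w x : Sp d) : ℝ :=
  (ζ x * q v w x + fderiv ℝ ζ x w * p v x) +
    (fderiv ℝ ζ x v * p w x + fderiv ℝ (fderiv ℝ ζ) x w v * f x)

/-- With the cutoff supported inside `Ω` the second weak derivatives are global, so neither
flattening nor reflection is needed. -/
theorem exists_patch_interior (h : Annihilates n η) (hΩ : IsOpen Ω) (hη : IsAuxiliary Ω η)
    (hB : IsCompact B) (hΩB : Ω ⊆ B) (hn : ∀ α, MemLp (n α) 2) (hn0 : ∀ α x, x ∉ Ω → n α x = 0)
    (hf : H2Data Ω f p q) {ζ : Sp d → ℝ}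
    (hζ : ContDiff ℝ ∞ ζ) (hζc : HasCompactSupport ζ) (hζΩ : tsupport ζ ⊆ Ω) :
    ∫ x, jetForm n (fun x => ζ x * f x) (mulP ζ f p) (mulQ ζ f p q) x = 0 :=
  h.interior hΩ hη.smooth.1 hη.pos hB hn (fun α x hx => hn0 α x fun h => hx (hΩB h))
    hζc.isCompact hζΩ (hf.mul hζ hζc (O' := Set.univ) (Set.inter_subset_right.trans hζΩ)).sobolevJet
    fun x hx => by rw [image_eq_zero_of_notMem_tsupport hx, zero_mul]

theorem exists_patch_boundary (h : Annihilates n η) (hΩ : IsOpen Ω) {r : ℝ≥0}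
    (hbd : HasHolderBoundary Ω 3 r) (hη : IsAuxiliary Ω η)
    (hB : IsCompact B) (hΩB : Ω ⊆ B) (hn : ∀ α, MemLp (n α) 2) (hn0 : ∀ α x, x ∉ Ω → n α x = 0)
    (hf : H2Data Ω f p q) (hs : SupportedIn Ω f p q) (hx₀ : x₀ ∈ frontier Ω) :
    ∃ U, IsOpen U ∧ x₀ ∈ U ∧ ∀ ζ : Sp d → ℝ, ContDiff ℝ ∞ ζ → HasCompactSupport ζ →
      tsupport ζ ⊆ U → ∫ x, jetForm n (fun x => ζ x * f x) (mulP ζ f p) (mulQ ζ f p q) x = 0 := by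
  obtain ⟨ρ, hρ, i, s, γ, hs1, hinv, hγ, -, hball⟩ := hbd x₀ hx₀
  -- With the orientation sign built into the unit vector, `⟪e, x⟫ = s * x i`, so the local
  -- description becomes `γ x < ⟪e, x⟫`; invariance of `γ` along the axis is invariance along `e`.
  let e : Sp d := EuclideanSpace.single i s
  have he : ‖e‖ = 1 := by
    rcases hs1 with rfl | rfl <;> simp [e]
  have hin : ∀ x : Sp d, ⟪e, x⟫_ℝ = s * x i := fun x => by
    simp [e, EuclideanSpace.inner_single_left]
  have hsh : ShearFn γ e := ⟨hγ, fun x τ => by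
    have : τ • e = EuclideanSpace.single i (τ * s) := by
      ext j; by_cases hj : j = i <;> simp [e, hj]
    rw [this, hinv]⟩
  obtain ⟨U, hU, hxU, hUΩ, hall⟩ := h.boundary hsh he hΩ hρ (fun x hx => by
    rw [hin]; exact hball x hx) hx₀ hη.smooth.1 hη.zero (hη.deriv_ne x₀ hx₀) hB hn hn0 hΩB
  refine ⟨U, hU, hxU, fun ζ hζ hζc hζU => ?_⟩
  exact hall (tsupport ζ) hζc.isCompact hζU _ _ _
    (hf.mul hζ hζc fun x hx => hUΩ x (hζU hx.2) hx.1) (hs.mul ζ)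

theorem integrable_jetForm (hn : ∀ α, MemLp (n α) 2) (hf : MemLp f 2) (hp : ∀ v, MemLp (p v) 2)
    (hq : ∀ v w, MemLp (q v w) 2) : Integrable (jetForm n f p q) :=
  ((integrable_mul_of_memLp_two (hn _) hf).add (integrable_finsetSum _ fun _ _ =>
    integrable_mul_of_memLp_two (hn _) (hp _))).add (integrable_finsetSum _ fun _ _ =>
      integrable_finsetSum _ fun _ _ => integrable_mul_of_memLp_two (hn _) (hq _ _))

theorem sum_jetForm {ι : Type*} (t : Finset ι) (n : Idx d 2 → Sp d → ℝ) (F : ι → Sp d → ℝ)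
    (P : ι → Sp d → Sp d → ℝ) (Q : ι → Sp d → Sp d → Sp d → ℝ) (x : Sp d) :
    ∑ k ∈ t, jetForm n (F k) (P k) (Q k) x = jetForm n (fun x => ∑ k ∈ t, F k x)
      (fun v x => ∑ k ∈ t, P k v x) (fun v w x => ∑ k ∈ t, Q k v w x) x := by
  simp only [jetForm, Finset.mul_sum, Finset.sum_add_distrib]
  congr 1
  · congr 1
    exact Finset.sum_comm
  · rw [Finset.sum_comm]
    exact Finset.sum_congr rfl fun i _ => Finset.sum_comm

/-- A finite smooth partition of unity on a compact set, subordinate to a cover with small sets. -/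
theorem exists_partition {K : Set (Sp d)} (hK : IsCompact K) (U : Sp d → Set (Sp d))
    (hU : ∀ x ∈ K, IsOpen (U x) ∧ x ∈ U x) :
    ∃ (t : Finset K) (ζ : t → Sp d → ℝ), (∀ i, ContDiff ℝ ∞ (ζ i)) ∧
      (∀ i, HasCompactSupport (ζ i)) ∧ (∀ i, tsupport (ζ i) ⊆ U i) ∧
      ∀ x ∈ K, ∑ i, ζ i x = 1 := by
  -- Intersecting with unit balls forces the members of the partition to have compact support.
  let V : K → Set (Sp d) := fun x => U x ∩ Metric.ball (x : Sp d) 1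
  have hV : ∀ x, IsOpen (V x) := fun x => (hU x x.2).1.inter Metric.isOpen_ball
  obtain ⟨t, ht⟩ := hK.elim_finite_subcover V hV fun x hx =>
    Set.mem_iUnion.2 ⟨⟨x, hx⟩, (hU x hx).2, Metric.mem_ball_self one_pos⟩
  obtain ⟨ψ, hψ⟩ := SmoothPartitionOfUnity.exists_isSubordinate (modelWithCornersSelf ℝ (Sp d)) hK.isClosed
    (fun i : t => V i) (fun i => hV i) (by
      intro x hx
      obtain ⟨i, hi, hx'⟩ := Set.mem_iUnion₂.1 (ht hx)
      exact Set.mem_iUnion.2 ⟨⟨i, hi⟩, hx'⟩)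
  refine ⟨t, fun i => ψ i, fun i => (ψ i).contMDiff.contDiff, fun i => ?_,
    fun i => (hψ i).trans Set.inter_subset_left, fun x hx => ?_⟩
  · exact (isCompact_closedBall ((i : K) : Sp d) 1).of_isClosed_subset (isClosed_tsupport _)
      ((hψ i).trans (Set.inter_subset_right.trans Metric.ball_subset_closedBall))
  · rw [← ψ.sum_eq_one hx, finsum_eq_sum_of_fintype]

/-- If `n` annihilates all `η φ` with `φ ∈ C_c²`, then it annihilates all functions in `H²` which
vanish at the boundary. -/
theorem Annihilates.integral_jetForm_eq_zero (h : Annihilates n η) (hΩ : IsOpen Ω)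
    (hΩb : Bornology.IsBounded Ω) {r : ℝ≥0}
    (hbd : HasHolderBoundary Ω 3 r) (hη : IsAuxiliary Ω η)
    (hn : ∀ α, MemLp (n α) 2) (hn0 : ∀ α x, x ∉ Ω → n α x = 0)
    (hf : H2Data Ω f p q) (hs : SupportedIn Ω f p q) : ∫ x, jetForm n f p q x = 0 := by
  have hB : IsCompact (closure Ω) := hΩb.isCompact_closure
  have hΩB : Ω ⊆ closure Ω := subset_closure
  have hpatch : ∀ x ∈ closure Ω, ∃ U, IsOpen U ∧ x ∈ U ∧ ∀ ζ : Sp d → ℝ, ContDiff ℝ ∞ ζ →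
      HasCompactSupport ζ → tsupport ζ ⊆ U →
      ∫ x, jetForm n (fun x => ζ x * f x) (mulP ζ f p) (mulQ ζ f p q) x = 0 := by
    intro x hx
    by_cases hxΩ : x ∈ Ω
    · exact ⟨Ω, hΩ, hxΩ, fun ζ h1 h2 h3 =>
        exists_patch_interior h hΩ hη hB hΩB hn hn0 hf h1 h2 h3⟩
    · exact exists_patch_boundary h hΩ hbd hη hB hΩB hn hn0 hf hs
        (by rw [hΩ.frontier_eq]; exact ⟨hx, hxΩ⟩)
  choose! U hUo hxU hUζ using hpatch
  obtain ⟨t, ζ, hζ, hζc, hζU, hsum⟩ := exists_partition hB U fun x hx => ⟨hUo x hx, hxU x hx⟩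
  have hz : ∀ i, ∫ x, jetForm n (fun x => ζ i x * f x) (mulP (ζ i) f p) (mulQ (ζ i) f p q) x = 0 :=
    fun i => hUζ i i.1.2 (ζ i) (hζ i) (hζc i) (hζU i)
  have hi : ∀ i, Integrable (jetForm n (fun x => ζ i x * f x) (mulP (ζ i) f p)
      (mulQ (ζ i) f p q)) := fun i => by
    have := hf.mul (O' := Ω) (hζ i) (hζc i) Set.inter_subset_left
    exact integrable_jetForm hn this.memf this.memp this.memq
  have e : ∀ x, jetForm n f p q x =
      ∑ i, jetForm n (fun x => ζ i x * f x) (mulP (ζ i) f p) (mulQ (ζ i) f p q) x := by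
    intro x
    by_cases hx : x ∈ Ω
    · have hd1 : ∀ i, Differentiable ℝ (ζ i) := fun i => (hζ i).differentiable (by simp)
      -- Near a point of the open set `Ω` the cutoffs sum to one identically, so their first and
      -- second derivatives sum to zero and the Leibniz terms disappear.
      have hev : (fun y => ∑ i, ζ i y) =ᶠ[𝓝 x] fun _ => 1 := by
        filter_upwards [hΩ.mem_nhds hx] with y hy using hsum y (hΩB hy)
      have f1 : fderiv ℝ (fun y => ∑ i, ζ i y) = fun y => ∑ i, fderiv ℝ (ζ i) y :=
        funext fun y => fderiv_fun_sum fun i _ => hd1 i y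
      have s0 : ∑ i, ζ i x = 1 := hsum x (hΩB hx)
      have s1 : ∑ i, fderiv ℝ (ζ i) x = 0 := by
        rw [← congrFun f1 x, hev.fderiv_eq]; simp
      have s2 : ∑ i, fderiv ℝ (fderiv ℝ (ζ i)) x = 0 := by
        have : fderiv ℝ (fun y => ∑ i, fderiv ℝ (ζ i) y) x = 0 := by
          rw [← f1, hev.fderiv.fderiv_eq]
          simp
        rw [← this, fderiv_fun_sum fun i _ => ((((hζ i).of_le two_le_infty).fderiv_right
          (m := 1) le_rfl).differentiable (by norm_num) x)]
      have s1' : ∀ v, ∑ i, fderiv ℝ (ζ i) x v = 0 := fun v => by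
        rw [← _root_.sum_apply, s1]; rfl
      have s2' : ∀ w v, ∑ i, fderiv ℝ (fderiv ℝ (ζ i)) x w v = 0 := fun w v => by
        have := congrArg (fun L => L w v) s2
        simpa [_root_.sum_apply] using this
      have a0 : ∑ i, ζ i x * f x = f x := by rw [← Finset.sum_mul, s0, one_mul]
      have a1 : ∀ v, ∑ i, mulP (ζ i) f p v x = p v x := fun v => by
        simp only [mulP, Finset.sum_add_distrib, ← Finset.sum_mul, s0, s1']; ring
      have a2 : ∀ v w, ∑ i, mulQ (ζ i) f p q v w x = q v w x := fun v w => by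
        simp only [mulQ, Finset.sum_add_distrib, ← Finset.sum_mul, s0, s1', s2']; ring
      rw [sum_jetForm]
      simp only [jetForm, a0, a1, a2]
    · simp [jetForm, hn0 _ x hx]
  simp only [e]
  rw [integral_finsetSum _ fun i _ => hi i]
  simp only [hz, Finset.sum_const_zero]

end Density

/-! ### Comparison of `μ` with Lebesgue measure -/

section SamplingDensity

variable {d : ℕ} {Ω : Set (Sp d)} {μ : Measure (Sp d)} {ρ : Sp d → ℝ≥0}

/-- `μ` has density `ρ` on `Ω`, where `ρ` is bounded above and away from zero. -/
structure HasDensity (Ω : Set (Sp d)) (μ : Measure (Sp d)) (ρ : Sp d → ℝ≥0) : Prop where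
  meas : Measurable ρ
  lower : ∃ c : ℝ≥0, c ≠ 0 ∧ ∀ x, c ≤ ρ x
  upper : ∃ C : ℝ≥0, ∀ x, ρ x ≤ C
  eq : μ = (volume.restrict Ω).withDensity fun x => (ρ x : ℝ≥0∞)

/-- The bound on the logarithm confines the Radon–Nikodym derivative to `[exp(-C), exp C]` almost
everywhere. Clamping to this interval changes nothing almost everywhere and makes the bounds hold at
every point. -/
theorem IsSamplingMeasure.exists_density (h : IsSamplingMeasure Ω μ) :
    ∃ ρ : Sp d → ℝ≥0, HasDensity Ω μ ρ := by
  have := h.finite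
  obtain ⟨C, hC⟩ := h.log_bdd
  let c : ℝ≥0 := ⟨Real.exp (-C), (Real.exp_pos _).le⟩
  let c' : ℝ≥0 := ⟨Real.exp C, (Real.exp_pos _).le⟩
  let ρ : Sp d → ℝ≥0 := fun x => max c (min c' (μ.rnDeriv (volume.restrict Ω) x).toNNReal)
  refine ⟨ρ, ?_, ⟨c, ?_, fun x => le_max_left _ _⟩, ⟨max c c', fun x =>
    max_le_max le_rfl (min_le_left _ _)⟩, ?_⟩
  · exact measurable_const.max (measurable_const.min
      (Measure.measurable_rnDeriv _ _).ennreal_toNNReal)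
  · intro h0
    exact (Real.exp_pos (-C)).ne' (congrArg NNReal.toReal h0)
  · conv_lhs => rw [← Measure.withDensity_rnDeriv_eq μ (volume.restrict Ω) h.ac]
    refine withDensity_congr_ae ?_
    filter_upwards [hC, Measure.rnDeriv_lt_top μ (volume.restrict Ω),
      Measure.rnDeriv_pos' h.ac'] with x h1 h2 h3
    set r := μ.rnDeriv (volume.restrict Ω) x with hr
    have hpos : 0 < r.toReal := ENNReal.toReal_pos h3.ne' h2.ne
    have e1 : c ≤ r.toNNReal := by
      rw [← NNReal.coe_le_coe]
      exact (Real.le_log_iff_exp_le hpos).1 (neg_le_of_abs_le h1)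
    have e2 : r.toNNReal ≤ c' := by
      rw [← NNReal.coe_le_coe]
      exact (Real.log_le_iff_le_exp hpos).1 (le_of_abs_le h1)
    change r = ((max c (min c' r.toNNReal) : ℝ≥0) : ℝ≥0∞)
    rw [min_eq_right e2, max_eq_right e1, ENNReal.coe_toNNReal h2.ne]

theorem HasDensity.le_smul (h : HasDensity Ω μ ρ) :
    ∃ C : ℝ≥0, μ ≤ (C : ℝ≥0∞) • volume.restrict Ω := by
  obtain ⟨C, hC⟩ := h.upper
  refine ⟨C, ?_⟩
  rw [← withDensity_const]
  conv_lhs => rw [h.eq]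
  exact withDensity_mono (Eventually.of_forall fun x => ENNReal.coe_le_coe.2 (hC x))

theorem HasDensity.restrict_le_smul (h : HasDensity Ω μ ρ) :
    ∃ C : ℝ≥0, volume.restrict Ω ≤ (C : ℝ≥0∞) • μ := by
  obtain ⟨c, hc, hcρ⟩ := h.lower
  refine ⟨c⁻¹, ?_⟩
  have h1 : (c : ℝ≥0∞) • volume.restrict Ω ≤ μ := by
    rw [← withDensity_const]
    conv_rhs => rw [h.eq]
    exact withDensity_mono (Eventually.of_forall fun x => ENNReal.coe_le_coe.2 (hcρ x))
  calc volume.restrict Ω = ((c⁻¹ : ℝ≥0) : ℝ≥0∞) • (c : ℝ≥0∞) • volume.restrict Ω := by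
        rw [smul_smul, ← ENNReal.coe_mul, inv_mul_cancel₀ hc, ENNReal.coe_one, one_smul]
    _ ≤ _ := by gcongr

theorem HasDensity.ac (h : HasDensity Ω μ ρ) : μ ≪ volume.restrict Ω := by
  obtain ⟨C, hC⟩ := h.le_smul
  exact Measure.absolutelyContinuous_of_le_smul hC

theorem HasDensity.ac' (h : HasDensity Ω μ ρ) : volume.restrict Ω ≪ μ := by
  obtain ⟨C, hC⟩ := h.restrict_le_smul
  exact Measure.absolutelyContinuous_of_le_smul hC

theorem HasDensity.memLp_restrict (h : HasDensity Ω μ ρ) {f : Sp d → ℝ} (hf : MemLp f 2 μ) :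
    MemLp f 2 (volume.restrict Ω) := by
  obtain ⟨C, hC⟩ := h.restrict_le_smul
  exact hf.of_measure_le_smul ENNReal.coe_ne_top hC

theorem HasDensity.memLp (h : HasDensity Ω μ ρ) {f : Sp d → ℝ}
    (hf : MemLp f 2 (volume.restrict Ω)) : MemLp f 2 μ := by
  obtain ⟨C, hC⟩ := h.le_smul
  exact hf.of_measure_le_smul ENNReal.coe_ne_top hC

theorem HasDensity.integral_eq (h : HasDensity Ω μ ρ) (f : Sp d → ℝ) :
    ∫ x, f x ∂μ = ∫ x in Ω, ρ x * f x := by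
  rw [h.eq, integral_withDensity_eq_integral_smul h.meas]
  rfl

theorem HasDensity.memLp_indicator (h : HasDensity Ω μ ρ) (hΩ : MeasurableSet Ω) {f : Sp d → ℝ}
    (hf : MemLp f 2 μ) : MemLp (Ω.indicator f) 2 :=
  (memLp_indicator_iff_restrict hΩ).2 (h.memLp_restrict hf)

theorem HasDensity.ae_mem (h : HasDensity Ω μ ρ) (hΩ : MeasurableSet Ω) : ∀ᵐ x ∂μ, x ∈ Ω :=
  h.ac.ae_le (ae_restrict_mem hΩ)

/-- Lebesgue integrals against `m ∈ L²` are continuous functionals on `L²(μ)`. -/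
theorem HasDensity.exists_inner (h : HasDensity Ω μ ρ) {m : Sp d → ℝ} (hm : MemLp m 2) :
    ∃ k : Lp ℝ 2 μ, ∀ g : Lp ℝ 2 μ, ⟪k, g⟫_ℝ = ∫ x in Ω, (g : Sp d → ℝ) x * m x := by
  obtain ⟨c, hc, hcρ⟩ := h.lower
  -- The representing element divides by the density, which converts the pairing in `L²(μ)` into a
  -- Lebesgue integral.
  have hmem : MemLp (fun x => ((ρ x)⁻¹ : ℝ) * m x) 2 μ := by
    refine MemLp.of_le_mul (c := (c⁻¹ : ℝ)) (h.memLp (hm.restrict Ω))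
      (h.meas.coe_nnreal_real.inv.aestronglyMeasurable.mul (h.memLp (hm.restrict Ω)).1)
      (Eventually.of_forall fun x => ?_)
    rw [norm_mul, Real.norm_of_nonneg (by positivity)]
    have hc0 : (0 : ℝ) < c := by exact_mod_cast pos_iff_ne_zero.2 hc
    have : ((ρ x)⁻¹ : ℝ) ≤ (c⁻¹ : ℝ) := inv_anti₀ hc0 (by exact_mod_cast hcρ x)
    gcongr
  refine ⟨hmem.toLp _, fun g => ?_⟩
  rw [L2.inner_def]
  have e1 : ∫ x, ⟪(hmem.toLp _ : Sp d → ℝ) x, (g : Sp d → ℝ) x⟫_ℝ ∂μ =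
      ∫ x, (g : Sp d → ℝ) x * (((ρ x)⁻¹ : ℝ) * m x) ∂μ := by
    refine integral_congr_ae ?_
    filter_upwards [hmem.coeFn_toLp] with x hx
    rw [hx]; rfl
  rw [e1, h.integral_eq]
  refine integral_congr_ae (Eventually.of_forall fun x => ?_)
  have hρ : (ρ x : ℝ) ≠ 0 := by
    have := (pos_iff_ne_zero.2 hc).trans_le (hcρ x)
    exact_mod_cast this.ne'
  simp only
  field_simp

end SamplingDensity

/-! ### Sobolev jets and their extension by zero -/

section SobolevJets

variable {d : ℕ} {Ω : Set (Sp d)} {μ : Measure (Sp d)} {ρ : Sp d → ℝ≥0}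

theorem idx_two_cases (α : Idx d 2) :
    α = idx0 d 2 ∨ (∃ i, α = ⟨1, ![i]⟩) ∨ ∃ i j, α = ⟨2, ![i, j]⟩ := by
  obtain ⟨k, v⟩ := α
  fin_cases k
  · exact Or.inl (by unfold idx0; congr; funext m; exact m.elim0)
  · refine Or.inr (Or.inl ⟨v 0, ?_⟩)
    congr
    funext m
    fin_cases m
    rfl
  · refine Or.inr (Or.inr ⟨v 0, v 1, ?_⟩)
    congr
    funext m
    fin_cases m <;> rfl

theorem sum_coord (v : Sp d) : ∑ i, v i • bv i = v := by
  have := (EuclideanSpace.basisFun (Fin d) ℝ).sum_repr v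
  simpa using this

theorem apply_eq_sum (L : Sp d →L[ℝ] ℝ) (v : Sp d) : L v = ∑ i, v i * L (bv i) := by
  conv_lhs => rw [← sum_coord v]
  simp only [map_sum, map_smul, smul_eq_mul]

theorem apply_apply_eq_sum (L : Sp d →L[ℝ] Sp d →L[ℝ] ℝ) (v w : Sp d) :
    L v w = ∑ i, ∑ j, v i * w j * L (bv i) (bv j) := by
  have h1 : L v = ∑ i, v i • L (bv i) := by
    conv_lhs => rw [← sum_coord v]
    simp only [map_sum, map_smul]
  rw [h1, _root_.sum_apply]
  refine Finset.sum_congr rfl fun i _ => ?_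
  rw [_root_.smul_apply, apply_eq_sum (L (bv i)) w, smul_eq_mul, Finset.mul_sum]
  exact Finset.sum_congr rfl fun j _ => by ring

/-- The component `u α` of a jet, as a continuous linear map. -/
noncomputable def jetProj {p : ℕ} (μ : Measure (Sp d)) (α : Idx d p) : Jet p μ →L[ℝ] Lp ℝ 2 μ :=
  PiLp.proj (𝕜 := ℝ) 1 (fun _ : Idx d p => Lp ℝ 2 μ) α

theorem memLp_partialD {p : ℕ} (α : Idx d p) {φ : Sp d → ℝ} (hφ : ContDiff ℝ p φ)
    (hφc : HasCompactSupport φ) : MemLp (partialD α φ) 2 :=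
  (continuous_partialD α hφ).memLp_of_hasCompactSupport (hasCompactSupport_partialD α hφc)

/-- Membership in the Sobolev space is tested by continuous linear functionals. -/
theorem HasDensity.exists_weak_functional (h : HasDensity Ω μ ρ) {p : ℕ} (α : Idx d p)
    {φ : Sp d → ℝ} (hφ : IsTestFunction Ω φ) : ∃ l : Jet p μ →L[ℝ] ℝ, ∀ u : Jet p μ,
      l u = (∫ x in Ω, (u.fn : Sp d → ℝ) x * partialD α φ x) -
        (-1 : ℝ) ^ (α.1 : ℕ) * ∫ x in Ω, (u α : Sp d → ℝ) x * φ x := by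
  obtain ⟨k₁, hk₁⟩ := h.exists_inner (memLp_partialD α (hφ.1.of_le (natCast_le_infty p)) hφ.2.1)
  obtain ⟨k₂, hk₂⟩ := h.exists_inner (hφ.1.continuous.memLp_of_hasCompactSupport (p := 2) hφ.2.1)
  refine ⟨(innerSL ℝ k₁).comp (jetProj μ (idx0 d p)) -
    ((-1 : ℝ) ^ (α.1 : ℕ)) • (innerSL ℝ k₂).comp (jetProj μ α), fun u => ?_⟩
  rw [← hk₁, ← hk₂]
  rfl

/-- Functions in `L²(μ)` are determined by their integrals against test functions. -/
theorem HasDensity.eq_of_integral_test (h : HasDensity Ω μ ρ) (hΩ : IsOpen Ω) {g g' : Lp ℝ 2 μ}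
    (hg : ∀ φ, IsTestFunction Ω φ →
      ∫ x in Ω, (g : Sp d → ℝ) x * φ x = ∫ x in Ω, (g' : Sp d → ℝ) x * φ x) : g = g' := by
  have m : ∀ g : Lp ℝ 2 μ, MemLp (Ω.indicator (g : Sp d → ℝ)) 2 := fun g =>
    h.memLp_indicator hΩ.measurableSet (Lp.memLp g)
  have key := hΩ.ae_eq_zero_of_integral_contDiff_smul_eq_zero (μ := volume)
    (f := fun x => Ω.indicator (g : Sp d → ℝ) x - Ω.indicator (g' : Sp d → ℝ) x)
    ((locallyIntegrable_of_memLp_two ((m g).sub (m g'))).locallyIntegrableOn Ω)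
    (fun φ h1 h2 h3 => by
      have e : ∀ g : Lp ℝ 2 μ, ∫ x, Ω.indicator (g : Sp d → ℝ) x * φ x =
          ∫ x in Ω, (g : Sp d → ℝ) x * φ x := fun g => by
        rw [← integral_indicator hΩ.measurableSet]
        refine integral_congr_ae (Eventually.of_forall fun x => ?_)
        by_cases hx : x ∈ Ω <;> simp [hx]
      have e2 : ∀ x, φ x • (Ω.indicator (g : Sp d → ℝ) x - Ω.indicator (g' : Sp d → ℝ) x) =
          Ω.indicator (g : Sp d → ℝ) x * φ x - Ω.indicator (g' : Sp d → ℝ) x * φ x := fun x => by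
        rw [smul_eq_mul]; ring
      simp only [e2]
      rw [integral_sub (integrable_mul_test (m g) h1.continuous h2)
        (integrable_mul_test (m g') h1.continuous h2), e, e, hg φ ⟨h1, h2, h3⟩, sub_self])
  refine Lp.ext (h.ac.ae_le ?_)
  refine (ae_restrict_iff' hΩ.measurableSet).2 ?_
  filter_upwards [key] with x hx hxΩ
  have := hx hxΩ
  rw [Set.indicator_of_mem hxΩ, Set.indicator_of_mem hxΩ] at this
  linarith

/-- Weak derivatives are determined by the function through integration against test functions. This
later identifies the velocity of the flow, known only through its values, with an image of the
network operator. -/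
theorem sobolev_eq_of_fn_eq (h : HasDensity Ω μ ρ) (hΩ : IsOpen Ω) {p : ℕ} {u u' : Jet p μ}
    (hu : u ∈ sobolev p Ω μ) (hu' : u' ∈ sobolev p Ω μ) (hfn : u.fn = u'.fn) : u = u' := by
  ext1 α
  refine h.eq_of_integral_test hΩ fun φ hφ => ?_
  have h1 := hu α φ hφ
  have h2 := hu' α φ hφ
  rw [hfn, h2] at h1
  exact (mul_left_cancel₀ (pow_ne_zero _ (by norm_num)) h1).symm

theorem sobolev_second_symm (h : HasDensity Ω μ ρ) (hΩ : IsOpen Ω) {u : Jet 2 μ}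
    (hu : u ∈ sobolev 2 Ω μ) (i j : Fin d) : u ⟨2, ![i, j]⟩ = u ⟨2, ![j, i]⟩ := by
  refine h.eq_of_integral_test hΩ fun φ hφ => ?_
  have h1 := hu ⟨2, ![i, j]⟩ φ hφ
  have h2 := hu ⟨2, ![j, i]⟩ φ hφ
  have e : partialD (⟨2, ![i, j]⟩ : Idx d 2) φ = partialD (⟨2, ![j, i]⟩ : Idx d 2) φ := by
    funext x
    rw [partialD_two, partialD_two, fderiv_fderiv_comm (hφ.1.of_le two_le_infty)]
  rw [e, h2] at h1
  exact (mul_left_cancel₀ (pow_ne_zero _ (by norm_num)) h1).symm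

theorem partialD_one' (i : Fin d) (f : Sp d → ℝ) (x : Sp d) :
    partialD (⟨1, ![i]⟩ : Idx d 1) f x = fderiv ℝ f x (bv i) := by
  unfold partialD
  exact iteratedFDeriv_one_apply _

theorem integral_restrict_eq_of_support {g c : Sp d → ℝ} (hΩ : MeasurableSet Ω)
    (hc : tsupport c ⊆ Ω) : ∫ x in Ω, g x * c x = ∫ x, g x * c x := by
  rw [← integral_indicator hΩ]
  refine integral_congr_ae (Eventually.of_forall fun x => ?_)
  by_cases hx : x ∈ Ω
  · simp [hx]
  · have : c x = 0 := image_eq_zero_of_notMem_tsupport fun h => hx (hc h)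
    simp [hx, this]

/-- Functions in `H¹₀` may be integrated by parts against arbitrary test functions. -/
theorem integral_sobolevOneZero (h : HasDensity Ω μ ρ) (hΩ : IsOpen Ω) {w : Jet 1 μ}
    (hw : w ∈ sobolevOneZero Ω μ) {χ : Sp d → ℝ} (hχ : ContDiff ℝ 1 χ) (hχc : HasCompactSupport χ)
    (i : Fin d) : ∫ x in Ω, (w (idx0 d 1) : Sp d → ℝ) x * fderiv ℝ χ x (bv i) =
      - ∫ x in Ω, (w ⟨1, ![i]⟩ : Sp d → ℝ) x * χ x := by
  obtain ⟨k₁, hk₁⟩ := h.exists_inner ((continuous_fderiv_apply_const hχ (bv i)).memLp_of_hasCompactSupport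
    (p := 2) (hχc.fderiv_apply (𝕜 := ℝ) (bv i)))
  obtain ⟨k₂, hk₂⟩ := h.exists_inner (hχ.continuous.memLp_of_hasCompactSupport (p := 2) hχc)
  let l : Jet 1 μ →L[ℝ] ℝ := (innerSL ℝ k₁).comp (jetProj μ (idx0 d 1)) +
    (innerSL ℝ k₂).comp (jetProj μ (⟨1, ![i]⟩ : Idx d 1))
  have hl : ∀ w : Jet 1 μ, l w = (∫ x in Ω, (w (idx0 d 1) : Sp d → ℝ) x * fderiv ℝ χ x (bv i)) +
      ∫ x in Ω, (w ⟨1, ![i]⟩ : Sp d → ℝ) x * χ x := fun w => by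
    rw [← hk₁, ← hk₂]; rfl
  -- The identity is the vanishing of a continuous functional, so it passes from test functions,
  -- where it is classical integration by parts, to their closure.
  have hcl : IsClosed {w | l w = 0} := isClosed_eq l.continuous continuous_const
  have hsub : sobolevOneZero Ω μ ⊆ {w | l w = 0} := by
    refine closure_minimal ?_ hcl
    rintro v ⟨φ, ⟨hφ, hφc, hφΩ⟩, hv⟩
    have hφ1 : ContDiff ℝ 1 φ := hφ.of_le one_le_infty
    change l v = 0
    rw [hl]
    have e1 : ∫ x in Ω, (v (idx0 d 1) : Sp d → ℝ) x * fderiv ℝ χ x (bv i) =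
        ∫ x, φ x * fderiv ℝ χ x (bv i) := by
      simp only [mul_comm (φ _)]
      rw [← integral_restrict_eq_of_support hΩ.measurableSet hφΩ]
      refine integral_congr_ae (h.ac'.ae_le ?_)
      filter_upwards [hv (idx0 d 1)] with x hx
      rw [hx, partialD_idx0, mul_comm]
    have e2 : ∫ x in Ω, (v ⟨1, ![i]⟩ : Sp d → ℝ) x * χ x =
        ∫ x, fderiv ℝ φ x (bv i) * χ x := by
      simp only [mul_comm (fderiv ℝ φ _ _)]
      rw [← integral_restrict_eq_of_support hΩ.measurableSet
        ((tsupport_fderiv_apply_subset ℝ (bv i)).trans hφΩ)]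
      refine integral_congr_ae (h.ac'.ae_le ?_)
      filter_upwards [hv ⟨1, ![i]⟩] with x hx
      rw [hx, partialD_one', mul_comm]
    rw [e1, e2, weakD_of_classical hφ1 hφc (bv i) χ hχ hχc (Set.subset_univ _)]
    ring
  have := hsub hw
  have h0 : l w = 0 := this
  rw [hl] at h0
  linarith

/-- The first derivatives of a jet. -/
noncomputable def jetP (Ω : Set (Sp d)) (u : Jet 2 μ) (v x : Sp d) : ℝ :=
  ∑ i, v i * Ω.indicator (u ⟨1, ![i]⟩ : Sp d → ℝ) x

/-- The second derivatives of a jet. -/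
noncomputable def jetQ (Ω : Set (Sp d)) (u : Jet 2 μ) (v w x : Sp d) : ℝ :=
  ∑ i, ∑ j, v i * w j * ((Ω.indicator (u ⟨2, ![i, j]⟩ : Sp d → ℝ) x +
    Ω.indicator (u ⟨2, ![j, i]⟩ : Sp d → ℝ) x) / 2)

/-- Membership in `H¹₀` makes the extension by zero weakly differentiable across `∂Ω`, which is
where the boundary condition enters; second derivatives are only available in `Ω`. Averaging over
the order of differentiation in `jetQ` gives symmetry at every point and not just almost everywhere.
-/
theorem h2Data_of_sobolevZero (h : HasDensity Ω μ ρ) (hΩ : IsOpen Ω) {u : Jet 2 μ}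
    (hu : u ∈ sobolevZero Ω μ) :
    H2Data Ω (Ω.indicator (u.fn : Sp d → ℝ)) (jetP Ω u) (jetQ Ω u) := by
  have m : ∀ g : Lp ℝ 2 μ, MemLp (Ω.indicator (g : Sp d → ℝ)) 2 := fun g =>
    h.memLp_indicator hΩ.measurableSet (Lp.memLp g)
  have ei : ∀ (g : Lp ℝ 2 μ) (c : Sp d → ℝ), ∫ x, Ω.indicator (g : Sp d → ℝ) x * c x =
      ∫ x in Ω, (g : Sp d → ℝ) x * c x := fun g c => by
    rw [← integral_indicator hΩ.measurableSet]
    refine integral_congr_ae (Eventually.of_forall fun x => ?_)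
    by_cases hx : x ∈ Ω <;> simp [hx]
  have mP : ∀ v, MemLp (jetP Ω u v) 2 := fun v => by
    have := memLp_finsetSum (μ := volume) (p := 2) Finset.univ
      (f := fun i x => v i * Ω.indicator (u ⟨1, ![i]⟩ : Sp d → ℝ) x) fun i _ => (m _).const_mul (v i)
    exact this
  have m2 : ∀ (v w : Sp d) (i j : Fin d), MemLp (fun x => v i * w j * ((Ω.indicator (u ⟨2, ![i, j]⟩ : Sp d → ℝ) x +
    Ω.indicator (u ⟨2, ![j, i]⟩ : Sp d → ℝ) x) / 2)) 2 := fun v w i j => by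
    simp only [div_eq_inv_mul]
    exact (((m _).add (m _)).const_mul _).const_mul _
  have mQ : ∀ v w, MemLp (jetQ Ω u v w) 2 := fun v w =>
    memLp_finsetSum (μ := volume) (p := 2) Finset.univ (f := fun i x => ∑ j, v i * w j *
      ((Ω.indicator (u ⟨2, ![i, j]⟩ : Sp d → ℝ) x +
      Ω.indicator (u ⟨2, ![j, i]⟩ : Sp d → ℝ) x) / 2)) fun i _ =>
      memLp_finsetSum Finset.univ fun j _ => m2 v w i j
  have w1 : ∀ v, WeakD Set.univ (Ω.indicator (u.fn : Sp d → ℝ)) (jetP Ω u v) v := by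
    intro v χ hχ hχc _
    have key : ∀ i, ∫ x, Ω.indicator (u.fn : Sp d → ℝ) x * fderiv ℝ χ x (bv i) =
        - ∫ x, Ω.indicator (u ⟨1, ![i]⟩ : Sp d → ℝ) x * χ x := fun i => by
      rw [ei, ei]
      exact integral_sobolevOneZero h hΩ hu.2 hχ hχc i
    have e1 : ∀ x, Ω.indicator (u.fn : Sp d → ℝ) x * fderiv ℝ χ x v =
        ∑ i, v i * (Ω.indicator (u.fn : Sp d → ℝ) x * fderiv ℝ χ x (bv i)) := fun x => by
      rw [apply_eq_sum (fderiv ℝ χ x) v, Finset.mul_sum]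
      exact Finset.sum_congr rfl fun i _ => by ring
    simp only [e1, jetP, Finset.sum_mul, mul_assoc]
    rw [integral_finsetSum _ fun i _ => (integrable_mul_test (m _)
      (continuous_fderiv_apply_const hχ (bv i)) (hχc.fderiv_apply (𝕜 := ℝ) (bv i))).const_mul _,
      integral_finsetSum _ fun i _ => (integrable_mul_test (m _) hχ.continuous hχc).const_mul _,
      ← Finset.sum_neg_distrib]
    refine Finset.sum_congr rfl fun i _ => ?_
    rw [integral_const_mul, integral_const_mul, key]
    ring
  refine ⟨m _, mP, mQ, fun v v' x => ?_, fun c v x => ?_, fun v w x => ?_, fun v v' w x => ?_,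
    fun c v w x => ?_, w1, fun v w => weakD_of_smooth hΩ (mP v) (mQ v w) fun χ hχ hχc hχΩ => ?_⟩
  · simp only [jetP, PiLp.add_apply, add_mul, Finset.sum_add_distrib]
  · simp only [jetP, PiLp.smul_apply, smul_eq_mul, Finset.mul_sum, mul_assoc]
  · simp only [jetQ]
    rw [Finset.sum_comm]
    exact Finset.sum_congr rfl fun i _ => Finset.sum_congr rfl fun j _ => by ring
  · simp only [jetQ, PiLp.add_apply, add_mul, Finset.sum_add_distrib]
  · simp only [jetQ, PiLp.smul_apply, smul_eq_mul, Finset.mul_sum, mul_assoc]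
  · have hχ2 : ContDiff ℝ 2 χ := hχ.of_le two_le_infty
    have hw : ContDiff ℝ 1 fun x => fderiv ℝ χ x w :=
      contDiff_fderiv_apply (n := 2) (m := 1) hχ2 (by norm_num) w
    have h1 := w1 v _ hw (hχc.fderiv_apply (𝕜 := ℝ) w) (Set.subset_univ _)
    simp only [← fderiv_fderiv_apply hχ2] at h1
    have key : ∀ i j, ∫ x, Ω.indicator (u.fn : Sp d → ℝ) x *
        fderiv ℝ (fderiv ℝ χ) x (bv i) (bv j) =
        ∫ x, Ω.indicator (u ⟨2, ![i, j]⟩ : Sp d → ℝ) x * χ x := fun i j => by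
      rw [ei, ei]
      have := hu.1 ⟨2, ![i, j]⟩ χ ⟨hχ, hχc, hχΩ⟩
      simp only [partialD_two] at this
      rw [this]
      norm_num
    have key' : ∀ i j, ∫ x, Ω.indicator (u.fn : Sp d → ℝ) x *
        fderiv ℝ (fderiv ℝ χ) x (bv i) (bv j) =
        ∫ x, (Ω.indicator (u ⟨2, ![i, j]⟩ : Sp d → ℝ) x +
          Ω.indicator (u ⟨2, ![j, i]⟩ : Sp d → ℝ) x) / 2 * χ x := fun i j => by
      have k2 := key j i
      simp only [fderiv_fderiv_comm hχ2 _ (bv j) (bv i)] at k2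
      have e : ∀ x, (Ω.indicator (u ⟨2, ![i, j]⟩ : Sp d → ℝ) x +
          Ω.indicator (u ⟨2, ![j, i]⟩ : Sp d → ℝ) x) / 2 * χ x =
          2⁻¹ * (Ω.indicator (u ⟨2, ![i, j]⟩ : Sp d → ℝ) x * χ x) +
          2⁻¹ * (Ω.indicator (u ⟨2, ![j, i]⟩ : Sp d → ℝ) x * χ x) := fun x => by ring
      simp only [e]
      rw [integral_add ((integrable_mul_test (m _) hχ.continuous hχc).const_mul _)
        ((integrable_mul_test (m _) hχ.continuous hχc).const_mul _), integral_const_mul,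
        integral_const_mul, ← key, ← k2]
      ring
    rw [← neg_eq_iff_eq_neg] at h1
    rw [← h1, neg_inj]
    have e1 : ∀ x, Ω.indicator (u.fn : Sp d → ℝ) x * fderiv ℝ (fderiv ℝ χ) x v w =
        ∑ i, ∑ j, v i * w j * (Ω.indicator (u.fn : Sp d → ℝ) x *
          fderiv ℝ (fderiv ℝ χ) x (bv i) (bv j)) := fun x => by
      rw [apply_apply_eq_sum (fderiv ℝ (fderiv ℝ χ) x) v w, Finset.mul_sum]
      refine Finset.sum_congr rfl fun i _ => ?_
      rw [Finset.mul_sum]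
      exact Finset.sum_congr rfl fun j _ => by ring
    have i1 : ∀ i j, Integrable fun x => v i * w j * (Ω.indicator (u.fn : Sp d → ℝ) x *
          fderiv ℝ (fderiv ℝ χ) x (bv i) (bv j)) := fun i j =>
      (integrable_mul_test (m _) (continuous_fderiv_fderiv_apply hχ2 _ _)
        (hasCompactSupport_fderiv_fderiv_apply hχ2 hχc _ _)).const_mul _
    have i2 : ∀ i j, Integrable fun x => v i * w j * (((Ω.indicator (u ⟨2, ![i, j]⟩ : Sp d → ℝ) x +
          Ω.indicator (u ⟨2, ![j, i]⟩ : Sp d → ℝ) x) / 2) * χ x) := fun i j => by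
      have := integrable_mul_test (m2 v w i j) hχ.continuous hχc
      simpa only [mul_assoc] using this
    simp only [e1, jetQ, Finset.sum_mul, mul_assoc (_ * _)]
    rw [integral_finsetSum _ fun i _ => integrable_finsetSum _ fun j _ => i1 i j,
      integral_finsetSum _ fun i _ => integrable_finsetSum _ fun j _ => i2 i j]
    refine Finset.sum_congr rfl fun i _ => ?_
    rw [integral_finsetSum _ fun j _ => i1 i j, integral_finsetSum _ fun j _ => i2 i j]
    refine Finset.sum_congr rfl fun j _ => ?_
    rw [integral_const_mul, integral_const_mul, key']

end SobolevJets

/-! ### Boundedness of the coefficients of the operator -/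

section Coefficients

variable {d : ℕ} {Ω : Set (Sp d)} {μ : Measure (Sp d)} {ρ : Sp d → ℝ≥0} {η : Sp d → ℝ}
  {n : Idx d 2 → Sp d → ℝ} {a : Coeff d}

/-- Density of the functions `η φ` in `H²_{(0)}`, for functionals given by `L²` functions. -/
theorem Annihilates.sobolevZero (h : Annihilates n η) (hρ : HasDensity Ω μ ρ) (hΩ : IsOpen Ω)
    (hΩb : Bornology.IsBounded Ω) {r : ℝ≥0} (hbd : HasHolderBoundary Ω 3 r)
    (hη : IsAuxiliary Ω η) (hn : ∀ α, MemLp (n α) 2) (hn0 : ∀ α x, x ∉ Ω → n α x = 0)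
    {u : Jet 2 μ} (hu : u ∈ DGM.sobolevZero Ω μ) :
    ∫ x in Ω, ∑ α, n α x * (u α : Sp d → ℝ) x = 0 := by
  have key := h.integral_jetForm_eq_zero hΩ hΩb hbd hη hn hn0 (h2Data_of_sobolevZero hρ hΩ hu)
    fun x hx => ⟨Set.indicator_of_notMem hx _, fun v => by simp [jetP, hx], fun v w => by
      simp [jetQ, hx]⟩
  rw [← key, ← integral_indicator hΩ.measurableSet]
  refine integral_congr_ae (Eventually.of_forall fun x => ?_)
  have hsy := sobolev_second_symm hρ hΩ hu.1
  have hP : ∀ i, jetP Ω u (bv i) x = Ω.indicator (u ⟨1, ![i]⟩ : Sp d → ℝ) x := fun i => by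
    simp [jetP]
  have hQ : ∀ i j, jetQ Ω u (bv j) (bv i) x = Ω.indicator (u ⟨2, ![i, j]⟩ : Sp d → ℝ) x :=
    fun i j => by
      simp only [jetQ]
      rw [Finset.sum_eq_single j (fun k _ hk => Finset.sum_eq_zero fun l _ => by simp [hk])
        (fun h => absurd (Finset.mem_univ j) h), Finset.sum_eq_single i
        (fun k _ hk => by simp [hk]) (fun h => absurd (Finset.mem_univ i) h), hsy j i]
      simp
  simp only [jetForm, hP, hQ]
  by_cases hx : x ∈ Ω
  · simp only [Set.indicator_of_mem hx]
    exact sum_idx_two fun α => n α x * (u α : Sp d → ℝ) x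
  · simp [hx]

/-- The jet of a classical `C²` function. -/
noncomputable def classicalJet (μ : Measure (Sp d)) (g : Sp d → ℝ) : Jet 2 μ :=
  open Classical in
  WithLp.toLp 1 fun α => if h : MemLp (partialD α g) 2 μ then h.toLp _ else 0

theorem exists_bound_partialD (hΩb : Bornology.IsBounded Ω) {g : Sp d → ℝ} (hg : ContDiff ℝ 2 g)
    (α : Idx d 2) : ∃ C, 0 ≤ C ∧ ∀ x ∈ Ω, |partialD α g x| ≤ C := by
  obtain ⟨C, hC⟩ := hΩb.isCompact_closure.exists_bound_of_continuousOn
    (continuous_partialD α hg).continuousOn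
  exact ⟨max C 0, le_max_right _ _, fun x hx => (hC x (subset_closure hx)).trans (le_max_left _ _)⟩

theorem HasDensity.isFiniteMeasure (h : HasDensity Ω μ ρ) (hΩb : Bornology.IsBounded Ω) :
    IsFiniteMeasure μ := by
  obtain ⟨C, hC⟩ := h.le_smul
  refine ⟨(hC Set.univ).trans_lt ?_⟩
  rw [Measure.smul_apply, Measure.restrict_apply_univ]
  exact ENNReal.mul_lt_top ENNReal.coe_lt_top hΩb.measure_lt_top

theorem HasDensity.memLp_of_bound (h : HasDensity Ω μ ρ) (hΩ : IsOpen Ω)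
    (hΩb : Bornology.IsBounded Ω) {g : Sp d → ℝ} (hg : AEStronglyMeasurable g μ) {C : ℝ}
    (hC : ∀ x ∈ Ω, |g x| ≤ C) : MemLp g 2 μ := by
  have := h.isFiniteMeasure hΩb
  refine MemLp.of_bound hg C ?_
  filter_upwards [h.ae_mem hΩ.measurableSet] with x hx using hC x hx

theorem HasDensity.memLp_partialD (h : HasDensity Ω μ ρ) (hΩ : IsOpen Ω)
    (hΩb : Bornology.IsBounded Ω) {g : Sp d → ℝ} (hg : ContDiff ℝ 2 g) (α : Idx d 2) :
    MemLp (partialD α g) 2 μ := by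
  obtain ⟨C, _, hC⟩ := exists_bound_partialD hΩb hg α
  exact h.memLp_of_bound hΩ hΩb (continuous_partialD α hg).aestronglyMeasurable hC

theorem classicalJet_coe (h : HasDensity Ω μ ρ) (hΩ : IsOpen Ω) (hΩb : Bornology.IsBounded Ω)
    {g : Sp d → ℝ} (hg : ContDiff ℝ 2 g) (α : Idx d 2) :
    (classicalJet μ g α : Sp d → ℝ) =ᵐ[μ] partialD α g := by
  have hm := h.memLp_partialD hΩ hΩb hg α
  have : classicalJet μ g α = hm.toLp _ := by
    rw [classicalJet]
    exact dif_pos hm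
  rw [this]
  exact hm.coeFn_toLp

theorem integral_by_parts {g φ : Sp d → ℝ} (hg : ContDiff ℝ 1 g) (hφ : ContDiff ℝ 1 φ)
    (hφc : HasCompactSupport φ) (v : Sp d) :
    ∫ x, g x * fderiv ℝ φ x v = - ∫ x, fderiv ℝ g x v * φ x :=
  integral_mul_fderiv_eq_neg_fderiv_mul_of_integrable
    (((continuous_fderiv_apply_const hg v).mul hφ.continuous).integrable_of_hasCompactSupport
      hφc.mul_left)
    ((hg.continuous.mul (continuous_fderiv_apply_const hφ v)).integrable_of_hasCompactSupport
      (hφc.fderiv_apply (𝕜 := ℝ) v).mul_left)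
    ((hg.continuous.mul hφ.continuous).integrable_of_hasCompactSupport hφc.mul_left)
    (fun x _ => hg.differentiable (by simp) x) (fun x _ => hφ.differentiable (by simp) x)

theorem tsupport_partialD_subset {p : ℕ} (α : Idx d p) (φ : Sp d → ℝ) :
    tsupport (partialD α φ) ⊆ tsupport φ := by
  refine closure_minimal (fun x hx => ?_) (isClosed_tsupport _)
  refine support_iteratedFDeriv_subset (𝕜 := ℝ) (α.1 : ℕ) fun h => hx ?_
  simp [partialD, h]

theorem classicalJet_mem (h : HasDensity Ω μ ρ) (hΩ : IsOpen Ω) (hΩb : Bornology.IsBounded Ω)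
    {g : Sp d → ℝ} (hg : ContDiff ℝ 2 g) : classicalJet μ g ∈ sobolev 2 Ω μ := by
  intro α φ hφ
  have hg1 : ContDiff ℝ 1 g := hg.of_le (by norm_num)
  have hφ1 : ContDiff ℝ 1 φ := hφ.1.of_le one_le_infty
  have hφ2 : ContDiff ℝ 2 φ := hφ.1.of_le two_le_infty
  have e1 : ∫ x in Ω, ((classicalJet μ g).fn : Sp d → ℝ) x * partialD α φ x =
      ∫ x, g x * partialD α φ x := by
    rw [← integral_restrict_eq_of_support hΩ.measurableSet
      ((tsupport_partialD_subset α φ).trans hφ.2.2)]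
    refine integral_congr_ae (h.ac'.ae_le ?_)
    filter_upwards [classicalJet_coe h hΩ hΩb hg (idx0 d 2)] with x hx
    have hx' : ((classicalJet μ g).fn : Sp d → ℝ) x = g x := by
      rw [← partialD_idx0 (p := 2) g x]; exact hx
    rw [hx']
  have e2 : ∫ x in Ω, (classicalJet μ g α : Sp d → ℝ) x * φ x =
      ∫ x, partialD α g x * φ x := by
    rw [← integral_restrict_eq_of_support hΩ.measurableSet hφ.2.2]
    refine integral_congr_ae (h.ac'.ae_le ?_)
    filter_upwards [classicalJet_coe h hΩ hΩb hg α] with x hx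
    rw [hx]
  rw [e1, e2]
  rcases idx_two_cases α with rfl | ⟨i, rfl⟩ | ⟨i, j, rfl⟩
  · simp only [partialD_idx0]
    rw [show (-1 : ℝ) ^ (((idx0 d 2).1 : Fin 3) : ℕ) = 1 from pow_zero _, one_mul]
  · simp only [partialD_one]
    rw [integral_by_parts hg1 hφ1 hφ.2.1]
    simp
  · simp only [partialD_two]
    have c1 : ContDiff ℝ 1 fun x => fderiv ℝ φ x (bv j) :=
      contDiff_fderiv_apply (n := 2) (m := 1) hφ2 (by norm_num) _
    have c2 : ContDiff ℝ 1 fun x => fderiv ℝ g x (bv i) :=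
      contDiff_fderiv_apply (n := 2) (m := 1) hg (by norm_num) _
    simp only [fderiv_fderiv_comm hg _ (bv i) (bv j), fderiv_fderiv_apply hφ2,
      fderiv_fderiv_apply hg]
    rw [integral_by_parts hg1 c1 (hφ.2.1.fderiv_apply (𝕜 := ℝ) (bv j)),
      integral_by_parts c2 hφ1 hφ.2.1]
    norm_num

theorem zero_mem_sobolev (h : HasDensity Ω μ ρ) (p : ℕ) : (0 : Jet p μ) ∈ sobolev p Ω μ := by
  intro α φ hφ
  obtain ⟨l, hl⟩ := h.exists_weak_functional α hφ
  have := hl 0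
  rw [map_zero] at this
  exact sub_eq_zero.1 this.symm

theorem opWeak_zero : opWeak a (0 : Jet 2 μ) =ᵐ[μ] fun _ => 0 := by
  have : ∀ α : Idx d 2, (((0 : Jet 2 μ) α : Lp ℝ 2 μ) : Sp d → ℝ) =ᵐ[μ] 0 := fun α =>
    Lp.coeFn_zero _ _ _
  filter_upwards [ae_all_iff.2 this] with x hx
  exact Finset.sum_eq_zero fun α _ => by rw [hx α, Pi.zero_apply, mul_zero]

theorem opWeak_classicalJet (h : HasDensity Ω μ ρ) (hΩ : IsOpen Ω) (hΩb : Bornology.IsBounded Ω)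
    {g : Sp d → ℝ} (hg : ContDiff ℝ 2 g) :
    opWeak a (classicalJet μ g) =ᵐ[μ] opClassical a g := by
  filter_upwards [ae_all_iff.2 fun α => classicalJet_coe h hΩ hΩb hg α] with x hx
  simp only [opWeak, opClassical, hx]

/-- The Lipschitz condition is compared with the zero jet; on the bounded set `Ω` the derivatives of
a `C²` function are bounded. -/
theorem exists_bound_opClassical (h : HasDensity Ω μ ρ) (hΩ : IsOpen Ω)
    (hΩb : Bornology.IsBounded Ω) (ha : OpLipschitz Ω μ a) {g : Sp d → ℝ} (hg : ContDiff ℝ 2 g) :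
    ∃ C, ∀ᵐ x ∂μ, |opClassical a g x| ≤ C := by
  obtain ⟨k, hk, hlip⟩ := ha
  choose C hC0 hC using exists_bound_partialD hΩb hg
  refine ⟨k * ∑ α, C α, ?_⟩
  have hz : ∀ α : Idx d 2, (((0 : Jet 2 μ) α : Lp ℝ 2 μ) : Sp d → ℝ) =ᵐ[μ] 0 := fun α =>
    Lp.coeFn_zero _ _ _
  filter_upwards [hlip _ (classicalJet_mem h hΩ hΩb hg) _ (zero_mem_sobolev h 2),
    opWeak_zero (a := a) (μ := μ), opWeak_classicalJet (a := a) h hΩ hΩb hg, ae_all_iff.2 hz,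
    ae_all_iff.2 fun α => classicalJet_coe h hΩ hΩb hg α, h.ae_mem hΩ.measurableSet]
    with x h1 h2 h3 h4 h5 hx
  rw [h2, h3, sub_zero] at h1
  refine h1.trans (mul_le_mul_of_nonneg_left (Finset.sum_le_sum fun α _ => ?_) hk.le)
  rw [h4, h5, Pi.zero_apply, sub_zero]
  exact hC α x hx

theorem opClassical_eq_jetForm (a : Coeff d) (g : Sp d → ℝ) (x : Sp d) :
    opClassical a g x = jetForm a g (fun v x => fderiv ℝ g x v)
      (fun v w x => fderiv ℝ (fderiv ℝ g) x w v) x :=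
  sum_mul_partialD a g x

theorem hasFDerivAt_coord (i : Fin d) (x : Sp d) :
    HasFDerivAt (fun x : Sp d => x i) (EuclideanSpace.proj i : Sp d →L[ℝ] ℝ) x :=
  (EuclideanSpace.proj i : Sp d →L[ℝ] ℝ).hasFDerivAt

theorem fderiv_coord (i : Fin d) (x v : Sp d) : fderiv ℝ (fun x : Sp d => x i) x v = v i := by
  rw [(hasFDerivAt_coord i x).fderiv]; rfl

theorem contDiff_coord (i : Fin d) {m : WithTop ℕ∞} : ContDiff ℝ m fun x : Sp d => x i :=
  (EuclideanSpace.proj i : Sp d →L[ℝ] ℝ).contDiff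

theorem fderiv_coord_mul (i j : Fin d) (x v : Sp d) :
    fderiv ℝ (fun x : Sp d => x i * x j) x v = x i * v j + x j * v i := by
  have h : HasFDerivAt (fun x : Sp d => x i * x j) _ x :=
    (hasFDerivAt_coord i x).mul (hasFDerivAt_coord j x)
  rw [h.fderiv]
  rfl

/-- The operator applied to `1`, `x_i` and `x_i x_j` reveals its coefficients, those of second order
only up to symmetrization. -/
theorem opClassical_one (x : Sp d) : opClassical a (fun _ => 1) x = a (idx0 d 2) x := by
  have e1 : fderiv ℝ (fun _ : Sp d => (1 : ℝ)) = fun _ => 0 := funext fun x => by simp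
  rw [opClassical_eq_jetForm]
  simp [jetForm, e1]

theorem opClassical_coord (i : Fin d) (x : Sp d) :
    opClassical a (fun x => x i) x = a (idx0 d 2) x * x i + a ⟨1, ![i]⟩ x := by
  have e1 : ∀ v w, fderiv ℝ (fderiv ℝ fun x : Sp d => x i) x w v = 0 := fun v w => by
    rw [fderiv_fderiv_apply (contDiff_coord i)]
    simp [fderiv_coord]
  rw [opClassical_eq_jetForm]
  simp only [jetForm, e1, fderiv_coord]
  simp [PiLp.single_apply]

theorem opClassical_coord_mul (i j : Fin d) (x : Sp d) :
    opClassical a (fun x => x i * x j) x = a (idx0 d 2) x * (x i * x j)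
      + (a ⟨1, ![j]⟩ x * x i + a ⟨1, ![i]⟩ x * x j) + (a ⟨2, ![i, j]⟩ x + a ⟨2, ![j, i]⟩ x) := by
  have e1 : ∀ v w, fderiv ℝ (fderiv ℝ fun x : Sp d => x i * x j) x w v =
      w i * v j + w j * v i := fun v w => by
    rw [fderiv_fderiv_apply ((contDiff_coord i).mul (contDiff_coord j))]
    simp only [fderiv_coord_mul]
    have h : HasFDerivAt (fun y : Sp d => y i * v j + y j * v i) _ x :=
      ((hasFDerivAt_coord i x).mul_const (v j)).add ((hasFDerivAt_coord j x).mul_const (v i))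
    rw [h.fderiv]
    simp [mul_comm]
  rw [opClassical_eq_jetForm]
  simp only [jetForm, e1, fderiv_coord_mul, mul_add, Finset.sum_add_distrib]
  simp [PiLp.single_apply]

/-- Symmetrized coefficients. -/
noncomputable def symCoeff (a : Coeff d) : Coeff d := fun α x =>
  (a α x + a ⟨α.1, α.2 ∘ Fin.rev⟩ x) / 2

theorem symCoeff_zero (x : Sp d) : symCoeff a (idx0 d 2) x = a (idx0 d 2) x := by
  have : (⟨(idx0 d 2).1, (idx0 d 2).2 ∘ Fin.rev⟩ : Idx d 2) = idx0 d 2 := by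
    unfold idx0; congr
  rw [symCoeff, this]; ring

theorem symCoeff_one (i : Fin d) (x : Sp d) : symCoeff a ⟨1, ![i]⟩ x = a ⟨1, ![i]⟩ x := by
  have : (⟨1, ![i] ∘ Fin.rev⟩ : Idx d 2) = ⟨1, ![i]⟩ := by
    congr; funext m; fin_cases m; rfl
  change (a ⟨1, ![i]⟩ x + a ⟨1, ![i] ∘ Fin.rev⟩ x) / 2 = _
  rw [this]; ring

theorem symCoeff_two (i j : Fin d) (x : Sp d) :
    symCoeff a ⟨2, ![i, j]⟩ x = (a ⟨2, ![i, j]⟩ x + a ⟨2, ![j, i]⟩ x) / 2 := by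
  have h : (![i, j] ∘ Fin.rev : Fin 2 → Fin d) = ![j, i] := by
    funext m; fin_cases m <;> rfl
  have : (⟨2, ![i, j] ∘ Fin.rev⟩ : Idx d 2) = ⟨2, ![j, i]⟩ :=
    congrArg (fun v : Fin 2 → Fin d => (⟨2, v⟩ : Idx d 2)) h
  change (a ⟨2, ![i, j]⟩ x + a ⟨2, ![i, j] ∘ Fin.rev⟩ x) / 2 = _
  rw [this]

theorem sum_symCoeff_mul (f : Idx d 2 → ℝ) (hf : ∀ i j, f ⟨2, ![i, j]⟩ = f ⟨2, ![j, i]⟩)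
    (x : Sp d) : ∑ α, symCoeff a α x * f α = ∑ α, a α x * f α := by
  rw [sum_idx_two fun α => symCoeff a α x * f α, sum_idx_two fun α => a α x * f α]
  simp only [symCoeff_zero, symCoeff_one, symCoeff_two]
  congr 1
  have e : ∀ i j, (a ⟨2, ![i, j]⟩ x + a ⟨2, ![j, i]⟩ x) / 2 * f ⟨2, ![i, j]⟩ =
      2⁻¹ * (a ⟨2, ![i, j]⟩ x * f ⟨2, ![i, j]⟩) + 2⁻¹ * (a ⟨2, ![j, i]⟩ x * f ⟨2, ![j, i]⟩) :=
    fun i j => by rw [hf j i]; ring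
  simp only [e, Finset.sum_add_distrib, ← Finset.mul_sum]
  rw [Finset.sum_comm (f := fun i j => a ⟨2, ![j, i]⟩ x * f ⟨2, ![j, i]⟩)]
  ring

/-- Solve successively for the coefficients of order zero, one and two from the values of the
operator on quadratic monomials, which are bounded almost everywhere on `Ω`. Antisymmetric second
order parts act trivially and cannot be controlled this way, hence the symmetrization. -/
theorem exists_bound_symCoeff (h : HasDensity Ω μ ρ) (hΩ : IsOpen Ω)
    (hΩb : Bornology.IsBounded Ω) (ha : OpLipschitz Ω μ a) (α : Idx d 2) :
    ∃ C, ∀ᵐ x ∂μ, |symCoeff a α x| ≤ C := by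
  obtain ⟨R, hR⟩ := hΩb.exists_norm_le
  have hc : ∀ᵐ x ∂μ, ∀ i, |x i| ≤ R := by
    filter_upwards [h.ae_mem hΩ.measurableSet] with x hx i
    exact (PiLp.norm_apply_le x i).trans (hR x hx)
  obtain ⟨C₀, h₀⟩ := exists_bound_opClassical h hΩ hΩb ha (g := fun _ => 1) contDiff_const
  simp only [opClassical_one] at h₀
  have h₁ : ∀ i, ∃ C, ∀ᵐ x ∂μ, |a ⟨1, ![i]⟩ x| ≤ C := fun i => by
    obtain ⟨C₁, h₁⟩ := exists_bound_opClassical h hΩ hΩb ha (contDiff_coord i)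
    refine ⟨C₁ + C₀ * R, ?_⟩
    filter_upwards [h₀, h₁, hc] with x k0 k1 kc
    rw [opClassical_coord] at k1
    have e : a ⟨1, ![i]⟩ x = (a (idx0 d 2) x * x i + a ⟨1, ![i]⟩ x) - a (idx0 d 2) x * x i := by
      ring
    rw [e]
    refine (abs_sub _ _).trans (add_le_add k1 ?_)
    rw [abs_mul]
    exact mul_le_mul k0 (kc i) (abs_nonneg _) ((abs_nonneg _).trans k0)
  rcases idx_two_cases α with rfl | ⟨i, rfl⟩ | ⟨i, j, rfl⟩
  · exact ⟨C₀, by simpa only [symCoeff_zero] using h₀⟩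
  · simp only [symCoeff_one]; exact h₁ i
  · obtain ⟨Ci, hi⟩ := h₁ i
    obtain ⟨Cj, hj⟩ := h₁ j
    obtain ⟨C₂, h₂⟩ := exists_bound_opClassical h hΩ hΩb ha
      ((contDiff_coord i).mul (contDiff_coord j))
    refine ⟨(C₂ + (C₀ * (R * R) + (Cj * R + Ci * R))) / 2, ?_⟩
    filter_upwards [h₀, hi, hj, h₂, hc] with x k0 ki kj k2 kc
    rw [opClassical_coord_mul] at k2
    rw [symCoeff_two, abs_div, abs_two]
    have hR0 : 0 ≤ R := (abs_nonneg _).trans (kc i)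
    have b0 : |a (idx0 d 2) x * (x i * x j)| ≤ C₀ * (R * R) := by
      rw [abs_mul, abs_mul]
      exact mul_le_mul k0 (mul_le_mul (kc i) (kc j) (abs_nonneg _) hR0) (by positivity)
        ((abs_nonneg _).trans k0)
    have b1 : |a ⟨1, ![j]⟩ x * x i| ≤ Cj * R := by
      rw [abs_mul]; exact mul_le_mul kj (kc i) (abs_nonneg _) ((abs_nonneg _).trans kj)
    have b2 : |a ⟨1, ![i]⟩ x * x j| ≤ Ci * R := by
      rw [abs_mul]; exact mul_le_mul ki (kc j) (abs_nonneg _) ((abs_nonneg _).trans ki)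
    gcongr
    rw [abs_le] at *
    constructor <;> linarith [k2.1, k2.2, b0.1, b0.2, b1.1, b1.2, b2.1, b2.2]

/-- The coefficients of the operator may be assumed to be measurable and bounded. -/
theorem exists_bounded_coeff (h : HasDensity Ω μ ρ) (hΩ : IsOpen Ω)
    (hΩb : Bornology.IsBounded Ω) (hm : ∀ α, AEStronglyMeasurable (a α) μ)
    (ha : OpLipschitz Ω μ a) : ∃ a' : Coeff d, (∀ α, Measurable (a' α)) ∧
      (∃ K, 0 ≤ K ∧ ∀ α x, |a' α x| ≤ K) ∧
      (∀ᵐ x ∂μ, ∀ f : Sp d → ℝ, ContDiff ℝ 2 f → opClassical a f x = opClassical a' f x) ∧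
      ∀ u ∈ sobolev 2 Ω μ, opWeak a u =ᵐ[μ] opWeak a' u := by
  have hms : ∀ α, AEStronglyMeasurable (symCoeff a α) μ := fun α => by
    have e : symCoeff a α = fun x => (a α x + a ⟨α.1, α.2 ∘ Fin.rev⟩ x) * 2⁻¹ := by
      funext x; rw [symCoeff, div_eq_mul_inv]
    rw [e]
    exact ((hm _).add (hm _)).mul_const _
  choose C hC using exists_bound_symCoeff h hΩ hΩb ha
  let K : ℝ := ∑ α, |C α|
  have hK0 : 0 ≤ K := Finset.sum_nonneg fun α _ => abs_nonneg _
  have hCK : ∀ α, C α ≤ K := fun α => (le_abs_self _).trans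
    (Finset.single_le_sum (f := fun α => |C α|) (fun α _ => abs_nonneg _) (Finset.mem_univ α))
  -- A measurable representative, truncated so that boundedness holds at every point; almost
  -- everywhere the truncation has no effect.
  let a' : Coeff d := fun α x => max (-K) (min K ((hms α).mk _ x))
  have hae : ∀ᵐ x ∂μ, ∀ α, a' α x = symCoeff a α x := by
    filter_upwards [ae_all_iff.2 fun α => (hms α).ae_eq_mk, ae_all_iff.2 hC] with x h1 h2 α
    have h3 := abs_le.1 ((h2 α).trans (hCK α))
    simp only [a']
    rw [← h1, min_eq_right h3.2, max_eq_right h3.1]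
  refine ⟨a', fun α => measurable_const.max (measurable_const.min
    (hms α).stronglyMeasurable_mk.measurable), ⟨K, hK0, fun α x => abs_le.2 ⟨le_max_left _ _,
      max_le (by linarith) (min_le_left _ _)⟩⟩, ?_, fun u hu => ?_⟩
  · filter_upwards [hae] with x hx f hf
    simp only [opClassical, hx]
    refine (sum_symCoeff_mul (fun α => partialD α f x) (fun i j => ?_) x).symm
    rw [partialD_two, partialD_two, fderiv_fderiv_comm hf]
  · filter_upwards [hae] with x hx
    simp only [opWeak, hx]
    refine (sum_symCoeff_mul (fun α => (u α : Sp d → ℝ) x) (fun i j => ?_) x).symm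
    simp only
    rw [sobolev_second_symm h hΩ hu]

end Coefficients

/-! ### Commuting derivatives in parameters and in space -/

section MixedDerivatives

variable {E F : Type*} [NormedAddCommGroup E] [NormedSpace ℝ E] [NormedAddCommGroup F]
  [NormedSpace ℝ F]

theorem fderiv_partial_right {H : E × F → ℝ} (hH : Differentiable ℝ H) (θ : E) (y w : F) :
    fderiv ℝ (fun y => H (θ, y)) y w = fderiv ℝ H (θ, y) (0, w) := by
  have h : HasFDerivAt (fun y => H (θ, y)) _ y :=
    (hH (θ, y)).hasFDerivAt.comp y (hasFDerivAt_prodMk_right θ y)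
  rw [h.fderiv]
  rfl

theorem fderiv_partial_left {H : E × F → ℝ} (hH : Differentiable ℝ H) (θ v : E) (y : F) :
    fderiv ℝ (fun θ => H (θ, y)) θ v = fderiv ℝ H (θ, y) (v, 0) := by
  have h : HasFDerivAt (fun θ => H (θ, y)) _ θ :=
    (hH (θ, y)).hasFDerivAt.comp θ (hasFDerivAt_prodMk_left θ y)
  rw [h.fderiv]
  rfl

/-- Partial derivatives in two groups of variables commute. -/
theorem fderiv_partial_comm {H : E × F → ℝ} (hH : ContDiff ℝ 2 H) (θ v : E) (y w : F) :
    fderiv ℝ (fun θ => fderiv ℝ (fun y => H (θ, y)) y w) θ v =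
      fderiv ℝ (fun y => fderiv ℝ (fun θ => H (θ, y)) θ v) y w := by
  have hd : Differentiable ℝ H := hH.differentiable (by norm_num)
  have hv : ∀ u, Differentiable ℝ fun p => fderiv ℝ H p u := fun u =>
    (contDiff_fderiv_apply (n := 2) (m := 1) hH (by norm_num) u).differentiable (by norm_num)
  simp only [fderiv_partial_left hd, fderiv_partial_right hd]
  rw [fderiv_partial_left (H := fun p => fderiv ℝ H p (0, w)) (hv _),
    fderiv_partial_right (H := fun p => fderiv ℝ H p (v, 0)) (hv _),
    ← fderiv_fderiv_apply hH, ← fderiv_fderiv_apply hH, fderiv_fderiv_comm hH]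

end MixedDerivatives

/-! ### Derivatives of a hidden unit with respect to its parameters -/

section Network

variable {d : ℕ} {η : Sp d → ℝ} {σ : ℝ → ℝ}

/-- The coordinates of the parameter space. -/
abbrev Dir (d : ℕ) := Option (Option (Fin d))

/-- The unit vectors of the parameter space. -/
noncomputable def dir : Dir d → Param d
  | none => (1, 0, 0)
  | some none => (0, 0, 1)
  | some (some k) => (0, bv k, 0)

theorem gradDot_eq (F G : Param d → ℝ) (θ : Param d) :
    gradDot F G θ = ∑ m, fderiv ℝ F θ (dir m) * fderiv ℝ G θ (dir m) := by
  rw [Fintype.sum_option, Fintype.sum_option]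
  simp only [gradDot, dir]
  ring

/-- The scalar factor of the derivatives of a hidden unit. -/
def dirScal : Dir d → ℝ → ℝ
  | none, _ => 1
  | some _, c => c

/-- The factor independent of the parameters. -/
def dirFactor (η : Sp d → ℝ) : Dir d → Sp d → ℝ
  | none => η
  | some none => η
  | some (some k) => fun x => η x * x k

/-- The activation function in the derivatives of a hidden unit. -/
noncomputable def dirAct (σ : ℝ → ℝ) : Dir d → ℝ → ℝ
  | none => σ
  | some _ => deriv σ

/-- The derivatives of a hidden unit with respect to its parameters. -/
noncomputable def dunit (η : Sp d → ℝ) (σ : ℝ → ℝ) (m : Dir d) (θ : Param d) (x : Sp d) : ℝ :=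
  dirScal m θ.1 * (dirFactor η m x * dirAct σ m (⟪θ.2.1, x⟫_ℝ + θ.2.2))

theorem contDiff_unit {n : WithTop ℕ∞} (hη : ContDiff ℝ n η) (hσ : ContDiff ℝ n σ) :
    ContDiff ℝ n fun p : Param d × Sp d => unit η σ p.1 p.2 :=
  (hη.comp contDiff_snd).mul ((contDiff_fst.comp contDiff_fst).mul (hσ.comp
    (((contDiff_fst.comp (contDiff_snd.comp contDiff_fst)).inner ℝ contDiff_snd).add
      (contDiff_snd.comp (contDiff_snd.comp contDiff_fst)))))

theorem contDiff_dirFactor {n : WithTop ℕ∞} (hη : ContDiff ℝ n η) (m : Dir d) :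
    ContDiff ℝ n (dirFactor η m) := by
  rcases m with _ | _ | k
  · exact hη
  · exact hη
  · exact hη.mul (contDiff_coord k)

theorem contDiff_dirAct (hσ : ContDiff ℝ 4 σ) (m : Dir d) : ContDiff ℝ 3 (dirAct σ m) := by
  rcases m with _ | _
  · exact hσ.of_le (by norm_num)
  · exact hσ.deriv'

theorem contDiff_dunit (hη : ContDiff ℝ 3 η) (hσ : ContDiff ℝ 4 σ) (m : Dir d) :
    ContDiff ℝ 3 fun p : Param d × Sp d => dunit η σ m p.1 p.2 := by
  have h1 : ContDiff ℝ 3 fun p : Param d × Sp d => dirScal m p.1.1 := by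
    rcases m with _ | _
    · exact contDiff_const
    · exact contDiff_fst.comp contDiff_fst
  exact h1.mul (((contDiff_dirFactor hη m).comp contDiff_snd).mul ((contDiff_dirAct hσ m).comp
    (((contDiff_fst.comp (contDiff_snd.comp contDiff_fst)).inner ℝ contDiff_snd).add
      (contDiff_snd.comp (contDiff_snd.comp contDiff_fst)))))

theorem fderiv_unit (hσ : Differentiable ℝ σ) (m : Dir d) (θ : Param d) (x : Sp d) :
    fderiv ℝ (fun θ => unit η σ θ x) θ (dir m) = dunit η σ m θ x := by
  have h1 : HasFDerivAt (fun θ : Param d => θ.1) (ContinuousLinearMap.fst ℝ ℝ (Sp d × ℝ)) θ :=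
    hasFDerivAt_fst
  let A : Param d →L[ℝ] ℝ := (innerSL ℝ x).comp ((ContinuousLinearMap.fst ℝ (Sp d) ℝ).comp
      (ContinuousLinearMap.snd ℝ ℝ (Sp d × ℝ))) +
    (ContinuousLinearMap.snd ℝ (Sp d) ℝ).comp (ContinuousLinearMap.snd ℝ ℝ (Sp d × ℝ))
  have hA : ∀ θ : Param d, A θ = ⟪θ.2.1, x⟫_ℝ + θ.2.2 := fun θ => by
    rw [real_inner_comm]; rfl
  have h2 : HasFDerivAt (fun θ : Param d => σ (⟪θ.2.1, x⟫_ℝ + θ.2.2))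
      (deriv σ (⟪θ.2.1, x⟫_ℝ + θ.2.2) • A) θ := by
    have h3 : HasDerivAt σ (deriv σ (A θ)) (A θ) := (hσ _).hasDerivAt
    have e : (fun θ : Param d => σ (⟪θ.2.1, x⟫_ℝ + θ.2.2)) = σ ∘ A :=
      funext fun θ => congrArg σ (hA θ).symm
    rw [e, ← hA]
    exact h3.comp_hasFDerivAt θ A.hasFDerivAt
  have h4 : HasFDerivAt (fun θ => unit η σ θ x) _ θ := (h1.mul h2).const_mul (η x)
  rw [h4.fderiv]
  rcases m with _ | _ | k
  · simp [dunit, dir, dirScal, dirFactor, dirAct, A]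
  · simp [dunit, dir, dirScal, dirFactor, dirAct, A]
    ring
  · simp [dunit, dir, dirScal, dirFactor, dirAct, A, EuclideanSpace.inner_single_right]
    ring

theorem contDiff_partial_fderiv {H : Param d × Sp d → ℝ} {n m : ℕ∞} (hH : ContDiff ℝ n H)
    (h : m + 1 ≤ n) (w : Sp d) :
    ContDiff ℝ m fun p : Param d × Sp d => fderiv ℝ (fun y => H (p.1, y)) p.2 w := by
  have h1 : (1 : WithTop ℕ∞) ≤ n := by exact_mod_cast le_add_self.trans h
  have e : (fun p : Param d × Sp d => fderiv ℝ (fun y => H (p.1, y)) p.2 w) =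
      fun p => fderiv ℝ H p (0, w) := funext fun p =>
    fderiv_partial_right (hH.differentiable (by
      intro h0; rw [h0] at h1; exact absurd h1 (by norm_num))) p.1 p.2 w
  rw [e]
  exact contDiff_fderiv_apply hH h _

/-- Derivatives of order at most two in `x` of a function of `(θ, x)` are jointly continuous. -/
theorem contDiff_partialD {H : Param d × Sp d → ℝ} (hH : ContDiff ℝ 3 H) (α : Idx d 2) :
    ContDiff ℝ 1 fun p : Param d × Sp d => partialD α (fun y => H (p.1, y)) p.2 := by
  rcases idx_two_cases α with rfl | ⟨i, rfl⟩ | ⟨i, j, rfl⟩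
  · simp only [partialD_idx0]
    exact hH.of_le (by norm_num)
  · simp only [partialD_one]
    exact (contDiff_partial_fderiv (n := 3) (m := 2) hH (by norm_num) _).of_le (by norm_num)
  · have h2 := fun p : Param d × Sp d => (hH.comp (contDiff_const.prodMk contDiff_id) :
      ContDiff ℝ 3 fun y => H (p.1, y)).of_le (by norm_num : (2 : WithTop ℕ∞) ≤ 3)
    simp only [partialD_two]
    have e : (fun p : Param d × Sp d => fderiv ℝ (fderiv ℝ fun y => H (p.1, y)) p.2 (bv i) (bv j)) =
        fun p => fderiv ℝ (fun z => fderiv ℝ (fun y => H (p.1, y)) z (bv j)) p.2 (bv i) :=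
      funext fun p => fderiv_fderiv_apply (h2 p) _ _ _
    rw [e]
    exact contDiff_partial_fderiv (n := 2) (m := 1)
      (contDiff_partial_fderiv (n := 3) (m := 2) hH (by norm_num) _) (by norm_num) _

/-- Derivatives in the parameters commute with `D_α`. -/
theorem fderiv_partialD {H : Param d × Sp d → ℝ} (hH : ContDiff ℝ 3 H) (α : Idx d 2)
    (θ v : Param d) (x : Sp d) :
    fderiv ℝ (fun θ => partialD α (fun y => H (θ, y)) x) θ v =
      partialD α (fun y => fderiv ℝ (fun θ => H (θ, y)) θ v) x := by
  have hH2 : ContDiff ℝ 2 H := hH.of_le (by norm_num)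
  have hs : ∀ θ, ContDiff ℝ 2 fun y => H (θ, y) := fun θ =>
    hH2.comp (contDiff_const.prodMk contDiff_id)
  have hv : ContDiff ℝ 2 fun y => fderiv ℝ (fun θ => H (θ, y)) θ v := by
    simp only [fderiv_partial_left (hH.differentiable (by norm_num))]
    exact (contDiff_fderiv_apply (n := 3) (m := 2) hH (by norm_num) (v, 0)).comp
      (contDiff_const.prodMk contDiff_id)
  rcases idx_two_cases α with rfl | ⟨i, rfl⟩ | ⟨i, j, rfl⟩
  · simp only [partialD_idx0]
  · simp only [partialD_one]
    exact fderiv_partial_comm hH2 θ v x _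
  · simp only [partialD_two, fderiv_fderiv_apply (hs _), fderiv_fderiv_apply hv]
    rw [fderiv_partial_comm (H := fun p : Param d × Sp d => fderiv ℝ (fun y => H (p.1, y)) p.2 (bv j))
      (contDiff_partial_fderiv (n := 3) (m := 2) hH (by norm_num) _)]
    simp only [fderiv_partial_comm hH2]

/-- The coefficients depend on `x` alone, so differentiation in the parameters passes through the
finite sum and commutes with each `D_α`. -/
theorem fderiv_opClassical_unit (a : Coeff d) (hη : ContDiff ℝ 3 η) (hσ : ContDiff ℝ 4 σ)
    (m : Dir d) (θ : Param d) (x : Sp d) :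
    fderiv ℝ (fun θ => opClassical a (unit η σ θ) x) θ (dir m) =
      opClassical a (dunit η σ m θ) x := by
  have hH : ContDiff ℝ 3 fun p : Param d × Sp d => unit η σ p.1 p.2 :=
    contDiff_unit hη (hσ.of_le (by norm_num))
  have hd : ∀ α : Idx d 2, DifferentiableAt ℝ (fun θ => partialD α (unit η σ θ) x) θ := fun α =>
    (((contDiff_partialD hH α).comp (contDiff_id.prodMk contDiff_const :
      ContDiff ℝ 1 fun θ : Param d => (θ, x))).differentiable (by simp)) θ
  simp only [opClassical]
  rw [fderiv_fun_sum fun α _ => (hd α).const_mul _, _root_.sum_apply]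
  refine Finset.sum_congr rfl fun α _ => ?_
  rw [fderiv_const_mul (hd α), _root_.smul_apply, smul_eq_mul]
  congr 1
  have := fderiv_partialD hH α θ (dir m) x
  simp only [fderiv_unit (hσ.differentiable (by norm_num))] at this
  exact this

end Network

/-! ### Transferring the factor `η` to the coefficients -/

section Leibniz

variable {d : ℕ} {Ω : Set (Sp d)} {η : Sp d → ℝ} {σ : ℝ → ℝ} {ψ g : Sp d → ℝ}
  {n : Idx d 2 → Sp d → ℝ}

theorem fderiv_mul_apply (hψ : Differentiable ℝ ψ) (hg : Differentiable ℝ g) (x v : Sp d) :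
    fderiv ℝ (fun x => ψ x * g x) x v = mulP ψ g (fun v x => fderiv ℝ g x v) v x := by
  rw [fderiv_fun_mul (hψ x) (hg x)]
  simp [mulP, mul_comm]

theorem fderiv_fderiv_mul_apply (hψ : ContDiff ℝ 2 ψ) (hg : ContDiff ℝ 2 g) (x v w : Sp d) :
    fderiv ℝ (fderiv ℝ fun x => ψ x * g x) x w v = mulQ ψ g (fun v x => fderiv ℝ g x v)
      (fun v w x => fderiv ℝ (fderiv ℝ g) x w v) v w x := by
  have dψ : Differentiable ℝ ψ := hψ.differentiable (by norm_num)
  have dg : Differentiable ℝ g := hg.differentiable (by norm_num)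
  have dψv : ∀ v, Differentiable ℝ fun x => fderiv ℝ ψ x v := fun v =>
    (contDiff_fderiv_apply (n := 2) (m := 1) hψ (by norm_num) v).differentiable (by norm_num)
  have dgv : ∀ v, Differentiable ℝ fun x => fderiv ℝ g x v := fun v =>
    (contDiff_fderiv_apply (n := 2) (m := 1) hg (by norm_num) v).differentiable (by norm_num)
  rw [fderiv_fderiv_apply (hψ.mul hg)]
  simp only [fderiv_mul_apply dψ dg, mulP]
  have h : HasFDerivAt (fun y => ψ y * fderiv ℝ g y v + fderiv ℝ ψ y v * g y) _ x :=
    ((dψ x).hasFDerivAt.mul (dgv v x).hasFDerivAt).add ((dψv v x).hasFDerivAt.mul (dg x).hasFDerivAt)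
  rw [h.fderiv]
  simp only [mulQ, fderiv_fderiv_apply hψ, fderiv_fderiv_apply hg, _root_.add_apply,
    _root_.smul_apply, smul_eq_mul]
  ring

/-- The coefficients of the operator `g ↦ ∑ n_α D_α (η g)`. -/
noncomputable def leib (n : Idx d 2 → Sp d → ℝ) (η : Sp d → ℝ) : Idx d 2 → Sp d → ℝ
  | ⟨0, _⟩ => fun x => ∑ α, n α x * partialD α η x
  | ⟨1, v⟩ => fun x => n ⟨1, v⟩ x * η x + ∑ j, (n ⟨2, ![v ⟨0, Nat.one_pos⟩, j]⟩ x +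
      n ⟨2, ![j, v ⟨0, Nat.one_pos⟩]⟩ x) * fderiv ℝ η x (bv j)
  | ⟨2, v⟩ => fun x => n ⟨2, v⟩ x * η x

theorem leib_zero (x : Sp d) : leib n η (idx0 d 2) x = ∑ α, n α x * partialD α η x := rfl

theorem leib_one (i : Fin d) (x : Sp d) : leib n η ⟨1, ![i]⟩ x = n ⟨1, ![i]⟩ x * η x +
    ∑ j, (n ⟨2, ![i, j]⟩ x + n ⟨2, ![j, i]⟩ x) * fderiv ℝ η x (bv j) := rfl

theorem leib_two (i j : Fin d) (x : Sp d) :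
    leib n η ⟨2, ![i, j]⟩ x = n ⟨2, ![i, j]⟩ x * η x := rfl

/-- The second order Leibniz rule, regrouped by the derivatives of `g`. This reduces functionals on
`η g` to functionals on `g`, to which the ridge density result applies. -/
theorem sum_mul_partialD_mul (hη : ContDiff ℝ 2 η) (hg : ContDiff ℝ 2 g) (x : Sp d) :
    ∑ α, n α x * partialD α (fun x => η x * g x) x = ∑ α, leib n η α x * partialD α g x := by
  have dη : Differentiable ℝ η := hη.differentiable (by norm_num)
  have dg : Differentiable ℝ g := hg.differentiable (by norm_num)
  rw [sum_mul_partialD, sum_mul_partialD]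
  simp only [jetForm, leib_zero, leib_one, leib_two, sum_mul_partialD n η]
  simp only [fderiv_mul_apply dη dg, fderiv_fderiv_mul_apply hη hg, mulP, mulQ]
  simp only [add_mul, mul_add, Finset.sum_add_distrib, Finset.sum_mul]
  rw [Finset.sum_comm (f := fun i j => n ⟨2, ![i, j]⟩ x * (fderiv ℝ η x (bv i) *
    fderiv ℝ g x (bv j)))]
  have e1 : ∑ i, n ⟨1, ![i]⟩ x * (fderiv ℝ η x (bv i) * g x) =
      ∑ i, n ⟨1, ![i]⟩ x * fderiv ℝ η x (bv i) * g x :=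
    Finset.sum_congr rfl fun i _ => by ring
  have e2 : ∑ i, n ⟨1, ![i]⟩ x * (η x * fderiv ℝ g x (bv i)) =
      ∑ i, n ⟨1, ![i]⟩ x * η x * fderiv ℝ g x (bv i) :=
    Finset.sum_congr rfl fun i _ => by ring
  have e3 : ∑ i, ∑ j, n ⟨2, ![i, j]⟩ x * (η x * fderiv ℝ (fderiv ℝ g) x (bv i) (bv j)) =
      ∑ i, ∑ j, n ⟨2, ![i, j]⟩ x * η x * fderiv ℝ (fderiv ℝ g) x (bv i) (bv j) :=
    Finset.sum_congr rfl fun i _ => Finset.sum_congr rfl fun j _ => by ring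
  have e4 : ∑ i, ∑ j, n ⟨2, ![j, i]⟩ x * (fderiv ℝ η x (bv j) * fderiv ℝ g x (bv i)) =
      ∑ i, ∑ j, n ⟨2, ![j, i]⟩ x * fderiv ℝ η x (bv j) * fderiv ℝ g x (bv i) :=
    Finset.sum_congr rfl fun i _ => Finset.sum_congr rfl fun j _ => by ring
  have e5 : ∑ i, ∑ j, n ⟨2, ![i, j]⟩ x * (fderiv ℝ η x (bv j) * fderiv ℝ g x (bv i)) =
      ∑ i, ∑ j, n ⟨2, ![i, j]⟩ x * fderiv ℝ η x (bv j) * fderiv ℝ g x (bv i) :=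
    Finset.sum_congr rfl fun i _ => Finset.sum_congr rfl fun j _ => by ring
  have e6 : ∑ i, ∑ j, n ⟨2, ![i, j]⟩ x * (fderiv ℝ (fderiv ℝ η) x (bv i) (bv j) * g x) =
      ∑ i, ∑ j, n ⟨2, ![i, j]⟩ x * fderiv ℝ (fderiv ℝ η) x (bv i) (bv j) * g x :=
    Finset.sum_congr rfl fun i _ => Finset.sum_congr rfl fun j _ => by ring
  rw [e1, e2, e3, e4, e5, e6]
  ring

/-- If `n` annihilates all `η σ(w · x + b)`, then it annihilates all `η φ`. -/
theorem annihilates_of_ridge (hΩ : IsOpen Ω) (hΩb : Bornology.IsBounded Ω) (hη : ContDiff ℝ 3 η)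
    (hσ : ContDiff ℝ 2 σ) {C : ℝ} (hC : ∀ k ≤ 2, ∀ x, |iteratedDeriv k σ x| ≤ C)
    (hnc : ¬ ∃ c, ∀ z, σ z = c) (hn : ∀ α, MemLp (n α) 2) (hn0 : ∀ α x, x ∉ Ω → n α x = 0)
    (h : ∀ (w : Sp d) (b : ℝ),
      ∫ x, ∑ α, n α x * partialD α (fun x => η x * σ (⟪w, x⟫_ℝ + b)) x = 0) :
    Annihilates n η := by
  have hη2 : ContDiff ℝ 2 η := hη.of_le (by norm_num)
  have hB : IsCompact (closure Ω) := hΩb.isCompact_closure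
  have hB0 : ∀ α x, x ∉ closure Ω → n α x = 0 := fun α x hx => hn0 α x fun h => hx (subset_closure h)
  have hi : ∀ α {c : Sp d → ℝ}, Continuous c → Integrable fun x => n α x * c x := fun α c hc =>
    integrable_mul_continuous (hn α) hB (hB0 α) hc
  have cη : ∀ j, Continuous fun x => fderiv ℝ η x (bv j) := fun j =>
    continuous_fderiv_apply_const (hη.of_le (by norm_num)) (bv j)
  -- The new coefficients are `L²` functions supported in a bounded set times continuous functions,
  -- hence integrable.
  have hM : ∀ α, Integrable (leib n η α) := by
    intro α
    rcases idx_two_cases α with rfl | ⟨i, rfl⟩ | ⟨i, j, rfl⟩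
    · exact integrable_finsetSum _ fun α _ => hi α (continuous_partialD α hη2)
    · refine (hi _ hη.continuous).add (integrable_finsetSum _ fun j _ => ?_)
      simp only [add_mul]
      exact (hi _ (cη j)).add (hi _ (cη j))
    · exact hi _ hη.continuous
  have hs : ∀ g : Sp d → ℝ, ContDiff ℝ 2 g → ∫ x, ∑ α, n α x * partialD α (fun x => η x * g x) x =
      ∫ x in Ω, ∑ α, leib n η α x * partialD α g x := by
    intro g hg
    rw [← integral_indicator hΩ.measurableSet]
    refine integral_congr_ae (Eventually.of_forall fun x => ?_)
    by_cases hx : x ∈ Ω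
    · simp only [Set.indicator_of_mem hx]
      exact sum_mul_partialD_mul hη2 hg x
    · simp [hx, hn0 _ x hx]
  intro φ hφ hφc
  rw [hs φ hφ]
  refine integral_partialD_eq_zero_of_ridge hΩ.measurableSet hΩb (fun α => (hM α).integrableOn) hσ hC
    hnc (fun w b => ?_) hφ hφc
  rw [← hs (fun x => σ (⟪w, x⟫_ℝ + b))
    (hσ.comp ((contDiff_const.inner ℝ contDiff_id).add contDiff_const))]
  exact h w b

end Leibniz

/-! ### Polynomial growth of hidden units in the parameters -/

section Bounds

variable {d : ℕ} {Ω : Set (Sp d)} {η : Sp d → ℝ} {σ : ℝ → ℝ} {ψ g : Sp d → ℝ}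

theorem partialD_const_mul (α : Idx d 2) (hg : ContDiff ℝ 2 g) (s : ℝ) (x : Sp d) :
    partialD α (fun x => s * g x) x = s * partialD α g x := by
  have h : ContDiffAt ℝ (α.1 : ℕ) g x :=
    (hg.of_le (by exact_mod_cast idx_le α)).contDiffAt
  have := iteratedFDeriv_const_smul_apply (a := s) h
  have e : (fun x => s * g x) = s • g := rfl
  rw [partialD, e, this]
  rfl

theorem abs_partialD_ridge_le {τ : ℝ → ℝ} (hτ : ContDiff ℝ 2 τ) {T : ℝ} (hT : ∀ k ≤ 2, ∀ x,
    |iteratedDeriv k τ x| ≤ T) (α : Idx d 2) (w : Sp d) (b : ℝ) (x : Sp d) :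
    |partialD α (fun x => τ (⟪w, x⟫_ℝ + b)) x| ≤ (1 + ‖w‖) ^ 2 * T := by
  rw [partialD_ridge (n := 2) α hτ (by exact_mod_cast idx_le α), abs_mul, Finset.abs_prod]
  have h1 : (1 : ℝ) ≤ 1 + ‖w‖ := by linarith [norm_nonneg w]
  have h2 : ∏ m, |w (α.2 m)| ≤ (1 + ‖w‖) ^ 2 := by
    calc ∏ m, |w (α.2 m)| ≤ ∏ _m : Fin (α.1 : ℕ), (1 + ‖w‖) :=
          Finset.prod_le_prod (fun _ _ => abs_nonneg _) fun m _ =>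
            (PiLp.norm_apply_le w (α.2 m)).trans (by linarith)
      _ = (1 + ‖w‖) ^ (α.1 : ℕ) := by simp
      _ ≤ (1 + ‖w‖) ^ 2 := pow_le_pow_right₀ h1 (idx_le α)
  exact mul_le_mul h2 (hT _ (idx_le α) _) (abs_nonneg _) (by positivity)

/-- The constant `4` is the number of Leibniz terms at order two, which also covers the lower
orders. -/
theorem abs_partialD_mul_le (hψ : ContDiff ℝ 2 ψ) (hg : ContDiff ℝ 2 g) {x : Sp d} {A B : ℝ}
    (hA : ∀ α : Idx d 2, |partialD α ψ x| ≤ A) (hB : ∀ α : Idx d 2, |partialD α g x| ≤ B)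
    (α : Idx d 2) : |partialD α (fun x => ψ x * g x) x| ≤ 4 * (A * B) := by
  have hA0 : 0 ≤ A := (abs_nonneg _).trans (hA (idx0 d 2))
  have hB0 : 0 ≤ B := (abs_nonneg _).trans (hB (idx0 d 2))
  have hAB : 0 ≤ A * B := mul_nonneg hA0 hB0
  have key : ∀ α β : Idx d 2, |partialD α ψ x * partialD β g x| ≤ A * B := fun α β => by
    rw [abs_mul]; exact mul_le_mul (hA α) (hB β) (abs_nonneg _) hA0
  have dψ : Differentiable ℝ ψ := hψ.differentiable (by norm_num)
  have dg : Differentiable ℝ g := hg.differentiable (by norm_num)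
  rcases idx_two_cases α with rfl | ⟨i, rfl⟩ | ⟨i, j, rfl⟩
  · have := key (idx0 d 2) (idx0 d 2)
    simp only [partialD_idx0] at this ⊢
    linarith
  · have k1 := key (idx0 d 2) ⟨1, ![i]⟩
    have k2 := key ⟨1, ![i]⟩ (idx0 d 2)
    simp only [partialD_idx0, partialD_one] at k1 k2 ⊢
    rw [fderiv_mul_apply dψ dg, mulP]
    exact (abs_add_le _ _).trans (by linarith)
  · have k1 := key (idx0 d 2) ⟨2, ![i, j]⟩
    have k2 := key ⟨1, ![i]⟩ ⟨1, ![j]⟩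
    have k3 := key ⟨1, ![j]⟩ ⟨1, ![i]⟩
    have k4 := key ⟨2, ![i, j]⟩ (idx0 d 2)
    simp only [partialD_idx0, partialD_one, partialD_two] at k1 k2 k3 k4 ⊢
    rw [fderiv_fderiv_mul_apply hψ hg, mulQ]
    refine (abs_add_le _ _).trans ?_
    have := abs_add_le (ψ x * fderiv ℝ (fderiv ℝ g) x (bv i) (bv j))
      (fderiv ℝ ψ x (bv i) * fderiv ℝ g x (bv j))
    have := abs_add_le (fderiv ℝ ψ x (bv j) * fderiv ℝ g x (bv i))
      (fderiv ℝ (fderiv ℝ ψ) x (bv i) (bv j) * g x)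
    linarith

theorem IsCb.exists_bound_iteratedDeriv {k : ℕ} (hσ : IsCb k σ) :
    ∃ T, 0 ≤ T ∧ ∀ j ≤ k, ∀ x, |iteratedDeriv j σ x| ≤ T := by
  choose! C hC using hσ.2
  refine ⟨∑ j ∈ Finset.range (k + 1), |C j|, Finset.sum_nonneg fun _ _ => abs_nonneg _,
    fun j hj x => ?_⟩
  rw [← Real.norm_eq_abs, ← norm_iteratedFDeriv_eq_norm_iteratedDeriv]
  exact ((hC j hj x).trans (le_abs_self _)).trans (Finset.single_le_sum
    (f := fun j => |C j|) (fun _ _ => abs_nonneg _) (Finset.mem_range.2 (Nat.lt_succ_of_le hj)))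

theorem exists_bound_dirAct (hσ : IsCb 4 σ) :
    ∃ T, 0 ≤ T ∧ ∀ m : Dir d, ∀ j ≤ 2, ∀ x, |iteratedDeriv j (dirAct σ m) x| ≤ T := by
  obtain ⟨T, hT0, hT⟩ := hσ.exists_bound_iteratedDeriv
  refine ⟨T, hT0, fun m j hj x => ?_⟩
  rcases m with _ | m
  · exact hT j (by omega) x
  -- In the directions `w` and `b` the activation is `σ'`, which costs one more bounded derivative
  -- of `σ`.
  · have : iteratedDeriv j (dirAct σ (some m)) = iteratedDeriv (j + 1) σ := by
      rw [iteratedDeriv_succ']; rfl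
    rw [this]
    exact hT (j + 1) (by omega) x

theorem contDiff_ridge {τ : ℝ → ℝ} {n : WithTop ℕ∞} (hτ : ContDiff ℝ n τ) (w : Sp d) (b : ℝ) :
    ContDiff ℝ n fun x : Sp d => τ (⟪w, x⟫_ℝ + b) :=
  hτ.comp ((contDiff_const.inner ℝ contDiff_id).add contDiff_const)

/-- The derivatives of the hidden units grow at most quadratically in the parameters. -/
theorem exists_bound_dunit (hΩb : Bornology.IsBounded Ω) (hη : ContDiff ℝ 3 η) (hσ : IsCb 4 σ) :
    ∃ C, 0 ≤ C ∧ ∀ (m : Dir d) (α : Idx d 2) (θ : Param d), ∀ x ∈ Ω,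
      |partialD α (dunit η σ m θ) x| ≤ C * ((1 + |θ.1|) * (1 + ‖θ.2.1‖) ^ 2) := by
  obtain ⟨T, hT0, hT⟩ := exists_bound_dirAct (d := d) hσ
  have hψ : ∀ m, ContDiff ℝ 2 (dirFactor η m) := fun m =>
    contDiff_dirFactor (hη.of_le (by norm_num)) m
  have hτ : ∀ m : Dir d, ContDiff ℝ 2 (dirAct σ m) := fun m =>
    (contDiff_dirAct hσ.1 m).of_le (by norm_num)
  choose D hD0 hD using fun (m : Dir d) => exists_bound_partialD hΩb (hψ m)
  let A : ℝ := ∑ m : Dir d, ∑ α, D m α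
  have hA0 : 0 ≤ A := Finset.sum_nonneg fun m _ => Finset.sum_nonneg fun α _ => hD0 m α
  have hDA : ∀ m α, D m α ≤ A := fun m α =>
    (Finset.single_le_sum (f := fun α => D m α) (fun α _ => hD0 m α) (Finset.mem_univ α)).trans
      (Finset.single_le_sum (f := fun m => ∑ α, D m α)
        (fun m _ => Finset.sum_nonneg fun α _ => hD0 m α) (Finset.mem_univ m))
  refine ⟨4 * (A * T), by positivity, fun m α θ x hx => ?_⟩
  have hg := contDiff_ridge (hτ m) θ.2.1 θ.2.2
  have h1 := abs_partialD_mul_le (hψ m) hg (x := x) (A := A) (B := (1 + ‖θ.2.1‖) ^ 2 * T)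
    (fun α => (hD m α x hx).trans (hDA m α))
    (fun α => abs_partialD_ridge_le (hτ m) (hT m) α θ.2.1 θ.2.2 x) α
  have h2 : partialD α (dunit η σ m θ) x = dirScal m θ.1 * _ :=
    partialD_const_mul α ((hψ m).mul hg) (dirScal m θ.1) x
  rw [h2, abs_mul]
  have h3 : |dirScal m θ.1| ≤ 1 + |θ.1| := by
    rcases m with _ | m
    · simp [dirScal]
    · simp [dirScal]
  calc _ ≤ (1 + |θ.1|) * (4 * (A * ((1 + ‖θ.2.1‖) ^ 2 * T))) :=
        mul_le_mul h3 h1 (abs_nonneg _) (by positivity)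
    _ = _ := by ring

end Bounds

/-! ### Bounded coefficients give a bounded operator from jets to `L²` -/

section Multiplication

variable {d : ℕ} {μ : Measure (Sp d)}

/-- Multiplication by a bounded measurable function on `L²(μ)`. -/
theorem exists_mulCLM {m : Sp d → ℝ} (hm : Measurable m) {K : ℝ} (hK : ∀ x, |m x| ≤ K) :
    ∃ M : Lp ℝ 2 μ →L[ℝ] Lp ℝ 2 μ, ∀ f : Lp ℝ 2 μ, (M f : Sp d → ℝ) =ᵐ[μ] fun x => m x * f x := by
  have hle : ∀ (f : Sp d → ℝ) x, ‖m x * f x‖ ≤ K * ‖f x‖ := fun f x => by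
    rw [norm_mul]
    exact mul_le_mul_of_nonneg_right (hK x) (norm_nonneg _)
  have hmem : ∀ f : Lp ℝ 2 μ, MemLp (fun x => m x * f x) 2 μ := fun f =>
    (Lp.memLp f).of_le_mul (hm.aestronglyMeasurable.mul (Lp.memLp f).1)
      (Eventually.of_forall (hle f))
  let M : Lp ℝ 2 μ →ₗ[ℝ] Lp ℝ 2 μ :=
    { toFun := fun f => (hmem f).toLp _
      map_add' := fun f g => Lp.ext (by
        filter_upwards [(hmem (f + g)).coeFn_toLp, (hmem f).coeFn_toLp, (hmem g).coeFn_toLp,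
          Lp.coeFn_add f g, Lp.coeFn_add ((hmem f).toLp _) ((hmem g).toLp _)] with x h1 h2 h3 h4 h5
        rw [h1, h5, Pi.add_apply, h2, h3, h4, Pi.add_apply, mul_add])
      map_smul' := fun s f => Lp.ext (by
        filter_upwards [(hmem (s • f)).coeFn_toLp, (hmem f).coeFn_toLp,
          Lp.coeFn_smul s f, Lp.coeFn_smul s ((hmem f).toLp _)] with x h1 h2 h3 h4
        rw [h1, RingHom.id_apply, h4, Pi.smul_apply, h2, h3, Pi.smul_apply, smul_eq_mul,
          smul_eq_mul]
        ring) }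
  refine ⟨M.mkContinuous K fun f => Lp.norm_le_mul_norm_of_ae_le_mul ?_, fun f =>
    (hmem f).coeFn_toLp⟩
  filter_upwards [(hmem f).coeFn_toLp] with x hx
  have : (M f : Sp d → ℝ) x = m x * f x := hx
  rw [this]
  exact hle f x

/-- A differential operator with bounded coefficients is bounded from `H²` to `L²`. -/
theorem exists_opCLM {a : Coeff d} (hm : ∀ α, Measurable (a α)) {K : ℝ} (hK : ∀ α x, |a α x| ≤ K) :
    ∃ L : Jet 2 μ →L[ℝ] Lp ℝ 2 μ, ∀ u : Jet 2 μ, (L u : Sp d → ℝ) =ᵐ[μ] opWeak a u := by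
  choose M hM using fun α => exists_mulCLM (μ := μ) (hm α) (hK α)
  refine ⟨∑ α, (M α).comp (jetProj μ α), fun u => ?_⟩
  have e : (∑ α, (M α).comp (jetProj μ α)) u = ∑ α, M α (u α) := by
    rw [_root_.sum_apply]; rfl
  rw [e]
  filter_upwards [Lp.coeFn_finsetSum Finset.univ (fun α => M α (u α)),
    ae_all_iff.2 fun α => hM α (u α)] with x h1 h2
  rw [h1]
  simp only [Finset.sum_apply, opWeak, h2]

end Multiplication

/-! ### Continuity and growth of the jets of hidden units -/

section ContinuousFamilies

variable {d : ℕ} {Ω : Set (Sp d)} {μ : Measure (Sp d)} {ρ : Sp d → ℝ≥0} {η : Sp d → ℝ} {σ : ℝ → ℝ}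

/-- Joint continuity gives convergence uniformly on the compact closure of `Ω`, and the measure is
finite. -/
theorem continuous_Lp_of_continuous {X : Type*} [TopologicalSpace X] (h : HasDensity Ω μ ρ)
    (hΩ : IsOpen Ω) (hΩb : Bornology.IsBounded Ω) {F : X × Sp d → ℝ} (hF : Continuous F)
    {j : X → Lp ℝ 2 μ} (hj : ∀ θ, (j θ : Sp d → ℝ) =ᵐ[μ] fun x => F (θ, x)) : Continuous j := by
  have := h.isFiniteMeasure hΩb
  rw [continuous_iff_continuousAt]
  intro θ₀
  rw [ContinuousAt, Metric.tendsto_nhds]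
  intro ε hε
  set A : ℝ := (measureUnivNNReal μ : ℝ) ^ ((2 : ℝ≥0∞).toReal⁻¹)
  have hA : 0 ≤ A := by positivity
  have hev : ∀ᶠ θ in 𝓝 θ₀, ∀ x ∈ closure Ω, |F (θ, x) - F (θ₀, x)| < ε / (A + 1) := by
    refine hΩb.isCompact_closure.eventually_forall_of_forall_eventually fun y _ => ?_
    have hc : Continuous fun z : X × Sp d => |F (z.1, z.2) - F (θ₀, z.2)| := by fun_prop
    refine (hc.tendsto (θ₀, y)).eventually_lt_const ?_
    simp only [sub_self, abs_zero]
    positivity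
  filter_upwards [hev] with θ hθ
  rw [dist_eq_norm]
  have hle : ‖j θ - j θ₀‖ ≤ A * (ε / (A + 1)) := by
    refine Lp.norm_le_of_ae_bound (by positivity) ?_
    filter_upwards [hj θ, hj θ₀, Lp.coeFn_sub (j θ) (j θ₀), h.ae_mem hΩ.measurableSet]
      with x h1 h2 h3 hx
    rw [h3, Pi.sub_apply, h1, h2]
    exact (hθ x (subset_closure hx)).le
  refine hle.trans_lt ?_
  rw [mul_div_assoc', div_lt_iff₀ (by positivity)]
  nlinarith

theorem contDiff_dunit_right (hη : ContDiff ℝ 3 η) (hσ : ContDiff ℝ 4 σ) (m : Dir d)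
    (θ : Param d) : ContDiff ℝ 2 (dunit η σ m θ) :=
  ((contDiff_dunit hη hσ m).comp (contDiff_const.prodMk contDiff_id)).of_le (by norm_num)

/-- The jet of a derivative of a hidden unit depends continuously on the parameters. -/
theorem continuous_classicalJet_dunit (h : HasDensity Ω μ ρ) (hΩ : IsOpen Ω)
    (hΩb : Bornology.IsBounded Ω) (hη : ContDiff ℝ 3 η) (hσ : ContDiff ℝ 4 σ) (m : Dir d) :
    Continuous fun θ => classicalJet μ (dunit η σ m θ) := by
  refine (PiLp.continuous_toLp 1 fun _ : Idx d 2 => Lp ℝ 2 μ).comp (continuous_pi fun α => ?_)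
  exact continuous_Lp_of_continuous h hΩ hΩb (contDiff_partialD (contDiff_dunit hη hσ m) α).continuous
    fun θ => classicalJet_coe h hΩ hΩb (contDiff_dunit_right hη hσ m θ) α

theorem exists_norm_classicalJet_dunit_le (h : HasDensity Ω μ ρ) (hΩ : IsOpen Ω)
    (hΩb : Bornology.IsBounded Ω) (hη : ContDiff ℝ 3 η) (hσ : IsCb 4 σ) :
    ∃ C, 0 ≤ C ∧ ∀ (m : Dir d) (θ : Param d),
      ‖classicalJet μ (dunit η σ m θ)‖ ≤ C * ((1 + |θ.1|) * (1 + ‖θ.2.1‖) ^ 2) := by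
  have := h.isFiniteMeasure hΩb
  obtain ⟨C, hC0, hC⟩ := exists_bound_dunit hΩb hη hσ
  set A : ℝ := (measureUnivNNReal μ : ℝ) ^ ((2 : ℝ≥0∞).toReal⁻¹)
  refine ⟨Fintype.card (Idx d 2) * (A * C), by positivity, fun m θ => ?_⟩
  rw [PiLp.norm_eq_of_L1]
  have hle : ∀ α ∈ (Finset.univ : Finset (Idx d 2)), ‖classicalJet μ (dunit η σ m θ) α‖ ≤
      A * (C * ((1 + |θ.1|) * (1 + ‖θ.2.1‖) ^ 2)) := fun α _ => by
    refine Lp.norm_le_of_ae_bound (by positivity) ?_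
    filter_upwards [classicalJet_coe h hΩ hΩb (contDiff_dunit_right hη hσ.1 m θ) α,
      h.ae_mem hΩ.measurableSet] with x h1 hx
    rw [h1]
    exact hC m α θ x hx
  refine (Finset.sum_le_card_nsmul _ _ _ hle).trans (le_of_eq ?_)
  rw [nsmul_eq_mul, Finset.card_univ]
  ring

end ContinuousFamilies

/-! ### The fourth moment of the weights -/

section Moments

variable {d : ℕ} {P : Measure (Param d)}

theorem norm_pow_four_le (w : Sp d) : ‖w‖ ^ 4 ≤ d * ∑ k, |w k| ^ 4 := by
  have h : ‖w‖ ^ 2 = ∑ k, w k ^ 2 := EuclideanSpace.real_norm_sq_eq w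
  have h2 := sq_sum_le_card_mul_sum_sq (s := (Finset.univ : Finset (Fin d))) (f := fun k => w k ^ 2)
  calc ‖w‖ ^ 4 = (‖w‖ ^ 2) ^ 2 := by ring
    _ ≤ _ := by
      rw [h]
      refine h2.trans (le_of_eq ?_)
      simp only [Finset.card_univ, Fintype.card_fin, ← pow_mul]
      congr 1
      exact Finset.sum_congr rfl fun k _ => by
        rw [show 4 = 2 * 2 from rfl, pow_mul, pow_mul, sq_abs]

theorem IsInitialLaw.integrable_weight (hP : IsInitialLaw P) :
    Integrable (fun θ : Param d => (1 + ‖θ.2.1‖) ^ 4) P := by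
  have := hP.prob
  have hi : Integrable (fun θ : Param d => 8 * (1 + d * ∑ k, |θ.2.1 k| ^ 4)) P :=
    ((integrable_const 1).add ((integrable_finsetSum _ fun k _ => hP.w_moment k).const_mul _)).const_mul 8
  have hc : Continuous fun θ : Param d => (1 + ‖θ.2.1‖) ^ 4 := by fun_prop
  refine hi.mono' hc.aestronglyMeasurable (Eventually.of_forall fun θ => ?_)
  rw [Real.norm_of_nonneg (by positivity)]
  have h1 := norm_pow_four_le θ.2.1
  -- Convexity of the fourth power, with `8 = 2 ^ 3`.
  have h2 : (1 + ‖θ.2.1‖) ^ 4 ≤ 8 * (1 + ‖θ.2.1‖ ^ 4) := by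
    nlinarith [sq_nonneg (1 - ‖θ.2.1‖), sq_nonneg (1 - ‖θ.2.1‖ ^ 2), sq_nonneg (1 + ‖θ.2.1‖),
      mul_nonneg (sq_nonneg (1 + ‖θ.2.1‖)) (sq_nonneg (1 - ‖θ.2.1‖))]
  linarith

end Moments

/-! ### Averages of rank one operators and Fubini -/

section Average

variable {Θ X : Type*} [MeasurableSpace Θ] [MeasurableSpace X] {P : Measure Θ} {μ : Measure X}
  {ι : Type*} [Fintype ι] {B : Θ → ℝ}

/-- The operator `h ↦ 𝔼 [∑ ⟪k_i, h⟫ J_i]`. -/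
theorem exists_average {H G : Type*} [NormedAddCommGroup H] [InnerProductSpace ℝ H]
    [NormedAddCommGroup G] [NormedSpace ℝ G] {k : ι → Θ → H} {J : ι → Θ → G}
    (hk : ∀ i, AEStronglyMeasurable (k i) P) (hJ : ∀ i, AEStronglyMeasurable (J i) P)
    (hB : Integrable (fun θ => B θ ^ 2) P) (hkB : ∀ᵐ θ ∂P, ∀ i, ‖k i θ‖ ≤ B θ)
    (hJB : ∀ᵐ θ ∂P, ∀ i, ‖J i θ‖ ≤ B θ) : ∃ W : H →L[ℝ] G, ∀ h,
      Integrable (fun θ => ∑ i, ⟪k i θ, h⟫_ℝ • J i θ) P ∧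
      W h = ∫ θ, ∑ i, ⟪k i θ, h⟫_ℝ • J i θ ∂P := by
  have hle : ∀ h : H, ∀ᵐ θ ∂P, ∀ i, ‖⟪k i θ, h⟫_ℝ • J i θ‖ ≤ B θ ^ 2 * ‖h‖ := fun h => by
    filter_upwards [hkB, hJB] with θ h1 h2 i
    have hB0 : 0 ≤ B θ := (norm_nonneg _).trans (h1 i)
    rw [norm_smul]
    calc ‖⟪k i θ, h⟫_ℝ‖ * ‖J i θ‖ ≤ (‖k i θ‖ * ‖h‖) * ‖J i θ‖ :=
          mul_le_mul_of_nonneg_right (norm_inner_le_norm _ _) (norm_nonneg _)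
      _ ≤ (B θ * ‖h‖) * B θ := by
          have := h1 i; have := h2 i; gcongr
      _ = _ := by ring
  have hi : ∀ h i, Integrable (fun θ => ⟪k i θ, h⟫_ℝ • J i θ) P := fun h i =>
    (hB.mul_const ‖h‖).mono' (((hk i).inner aestronglyMeasurable_const).smul (hJ i))
      ((hle h).mono fun θ hθ => hθ i)
  have hs : ∀ h, Integrable (fun θ => ∑ i, ⟪k i θ, h⟫_ℝ • J i θ) P := fun h =>
    integrable_finsetSum _ fun i _ => hi h i
  let W : H →ₗ[ℝ] G :=
    { toFun := fun h => ∫ θ, ∑ i, ⟪k i θ, h⟫_ℝ • J i θ ∂P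
      map_add' := fun h h' => by
        rw [← integral_add (hs h) (hs h')]
        simp only [inner_add_right, add_smul, Finset.sum_add_distrib]
      map_smul' := fun s h => by
        rw [RingHom.id_apply, ← integral_smul]
        simp only [inner_smul_right, Finset.smul_sum, smul_smul] }
  refine ⟨W.mkContinuous (∫ θ, Fintype.card ι * B θ ^ 2 ∂P) fun h => ?_, fun h => ⟨hs h, rfl⟩⟩
  rw [← integral_mul_const]
  refine norm_integral_le_of_norm_le ((hB.const_mul _).mul_const _) ?_
  filter_upwards [hle h] with θ hθ
  refine (norm_sum_le _ _).trans ((Finset.sum_le_card_nsmul _ _ _ fun i _ => hθ i).trans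
    (le_of_eq ?_))
  rw [nsmul_eq_mul, Finset.card_univ]
  ring

variable [SFinite P] [SFinite μ] {T : Set Θ} {O : Set X}

/-- The integrand is dominated by `D * B²` times `|f|` on sets of full measure. The factor `D` lets
the lemma be used twice: with `D = 1` for pointwise bounds, and with `D` an `L¹` norm when `c` is
itself an integral. -/
theorem integral_mul_integral_swap {φ : ι → Θ × X → ℝ} {c : ι → Θ → ℝ} {f : X → ℝ} {D : ℝ}
    (hφ : ∀ i, Measurable (φ i)) (hc : ∀ i, AEStronglyMeasurable (c i) P) (hf : Integrable f μ)
    (hB : Integrable (fun θ => B θ ^ 2) P) (hT : ∀ᵐ θ ∂P, θ ∈ T) (hO : ∀ᵐ x ∂μ, x ∈ O)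
    (hφB : ∀ θ ∈ T, ∀ x ∈ O, ∀ i, |φ i (θ, x)| ≤ B θ) (hcB : ∀ θ ∈ T, ∀ i, |c i θ| ≤ D * B θ) :
    ∫ x, f x * ∫ θ, ∑ i, φ i (θ, x) * c i θ ∂P ∂μ =
      ∫ θ, ∑ i, (∫ x, f x * φ i (θ, x) ∂μ) * c i θ ∂P := by
  have hi : ∀ i, Integrable (fun p : Θ × X => f p.2 * (φ i p * c i p.1)) (P.prod μ) := fun i => by
    refine ((hB.const_mul D).mul_prod hf.norm).mono'
      (hf.1.comp_snd.mul ((hφ i).aestronglyMeasurable.mul (hc i).comp_fst)) ?_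
    filter_upwards [Measure.quasiMeasurePreserving_fst.ae hT,
      Measure.quasiMeasurePreserving_snd.ae hO] with p h1 h2
    have k1 := hφB _ h1 _ h2 i
    have k2 := hcB _ h1 i
    rw [norm_mul, norm_mul]
    calc ‖f p.2‖ * (‖φ i p‖ * ‖c i p.1‖) ≤ ‖f p.2‖ * (B p.1 * (D * B p.1)) := by
          refine mul_le_mul_of_nonneg_left ?_ (norm_nonneg _)
          exact mul_le_mul k1 k2 (norm_nonneg _) ((abs_nonneg _).trans k1)
      _ = _ := by ring
  have hsum : Integrable (fun p : Θ × X => f p.2 * ∑ i, φ i p * c i p.1) (P.prod μ) := by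
    simp only [Finset.mul_sum]
    exact integrable_finsetSum _ fun i _ => hi i
  simp only [← integral_const_mul]
  rw [← integral_integral_swap (f := fun θ x => f x * ∑ i, φ i (θ, x) * c i θ) hsum]
  refine integral_congr_ae ?_
  filter_upwards [ae_all_iff.2 fun i => (hi i).prod_right_ae] with θ hθ
  simp only [Finset.mul_sum]
  rw [integral_finsetSum _ fun i _ => hθ i]
  refine Finset.sum_congr rfl fun i _ => ?_
  rw [← integral_mul_const]
  exact integral_congr_ae (Eventually.of_forall fun x => by ring)

/-- Fubini's theorem for an averaged kernel of finite rank. -/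
theorem integral_mul_integral_average {φ ψ : ι → Θ × X → ℝ} {f m : X → ℝ}
    (hφ : ∀ i, Measurable (φ i)) (hψ : ∀ i, Measurable (ψ i)) (hf : Integrable f μ)
    (hm : Integrable m μ)
    (hB : Integrable (fun θ => B θ ^ 2) P) (hT : ∀ᵐ θ ∂P, θ ∈ T) (hO : ∀ᵐ x ∂μ, x ∈ O)
    (hφB : ∀ θ ∈ T, ∀ x ∈ O, ∀ i, |φ i (θ, x)| ≤ B θ)
    (hψB : ∀ θ ∈ T, ∀ x ∈ O, ∀ i, |ψ i (θ, x)| ≤ B θ) :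
    ∫ y, m y * ∫ x, f x * ∫ θ, ∑ i, φ i (θ, x) * ψ i (θ, y) ∂P ∂μ ∂μ =
      ∫ θ, ∑ i, (∫ x, f x * φ i (θ, x) ∂μ) * ∫ y, m y * ψ i (θ, y) ∂μ ∂P := by
  have h1 : ∫ y, m y * ∫ x, f x * ∫ θ, ∑ i, φ i (θ, x) * ψ i (θ, y) ∂P ∂μ ∂μ =
      ∫ y, m y * ∫ θ, ∑ i, ψ i (θ, y) * ∫ x, f x * φ i (θ, x) ∂μ ∂P ∂μ := by
    refine integral_congr_ae ?_
    filter_upwards [hO] with y hy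
    rw [integral_mul_integral_swap (D := 1) (c := fun i θ => ψ i (θ, y)) hφ
      (fun i => ((hψ i).comp measurable_prodMk_right).aestronglyMeasurable) hf hB hT hO hφB
      fun θ hθ i => by rw [one_mul]; exact hψB θ hθ y hy i]
    simp only [mul_comm]
  have hΦ : ∀ i, AEStronglyMeasurable (fun θ => ∫ x, f x * φ i (θ, x) ∂μ) P := fun i =>
    AEStronglyMeasurable.integral_prod_right'
      (f := fun p : Θ × X => f p.2 * φ i p) (hf.1.comp_snd.mul (hφ i).aestronglyMeasurable)
  rw [h1, integral_mul_integral_swap (D := ∫ x, ‖f x‖ ∂μ) hψ hΦ hm hB hT hO hψB]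
  · simp only [mul_comm]
  · intro θ hθ i
    rw [← integral_mul_const, ← Real.norm_eq_abs]
    refine norm_integral_le_of_norm_le (hf.norm.mul_const _) ?_
    filter_upwards [hO] with x hx
    rw [norm_mul]
    exact mul_le_mul_of_nonneg_left (hφB θ hθ x hx i) (norm_nonneg _)

end Average

/-! ### The integral operator `𝒰` as an average over hidden units -/

section NetworkOperator

variable {d : ℕ} {Ω : Set (Sp d)} {μ : Measure (Sp d)} {ρ : Sp d → ℝ≥0} {η : Sp d → ℝ} {σ : ℝ → ℝ}
  {a a' : Coeff d} {P : Measure (Param d)} {L : Jet 2 μ →L[ℝ] Lp ℝ 2 μ}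

/-- The jet of the derivative of a hidden unit with respect to a parameter. -/
noncomputable def unitJet (μ : Measure (Sp d)) (η : Sp d → ℝ) (σ : ℝ → ℝ) (m : Dir d)
    (θ : Param d) : Jet 2 μ := classicalJet μ (dunit η σ m θ)

/-- A square integrable bound of all quantities attached to a hidden unit. -/
theorem exists_weight (h : HasDensity Ω μ ρ) (hΩ : IsOpen Ω) (hΩb : Bornology.IsBounded Ω)
    (hη : ContDiff ℝ 3 η) (hσ : IsCb 4 σ) (hP : IsInitialLaw P) {K : ℝ}
    (hK0 : 0 ≤ K) (hK : ∀ α x, |a' α x| ≤ K) (L : Jet 2 μ →L[ℝ] Lp ℝ 2 μ) :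
    ∃ (B : Param d → ℝ) (T : Set (Param d)), Integrable (fun θ => B θ ^ 2) P ∧ (∀ᵐ θ ∂P, θ ∈ T) ∧
      ∀ θ ∈ T, ∀ m, ‖unitJet μ η σ m θ‖ ≤ B θ ∧ ‖L (unitJet μ η σ m θ)‖ ≤ B θ ∧
        ∀ x ∈ Ω, |dunit η σ m θ x| ≤ B θ ∧ |opClassical a' (dunit η σ m θ) x| ≤ B θ := by
  obtain ⟨C₁, h10, h1⟩ := exists_norm_classicalJet_dunit_le h hΩ hΩb hη hσ
  obtain ⟨C₂, h20, h2⟩ := exists_bound_dunit hΩb hη hσ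
  obtain ⟨Kc, hKc⟩ := hP.c_bdd
  set N : ℝ := ((Fintype.card (Idx d 2) : ℕ) : ℝ)
  have hN : 0 ≤ N := by positivity
  -- The sum of the four constants for the jet, its image under `L`, the pointwise value and the
  -- pointwise operator value, so that one weight dominates all of them.
  set C : ℝ := C₁ + ‖L‖ * C₁ + C₂ + N * (K * C₂)
  have p1 : 0 ≤ ‖L‖ * C₁ := by positivity
  have p2 : 0 ≤ N * (K * C₂) := by positivity
  refine ⟨fun θ => C * ((1 + Kc) * (1 + ‖θ.2.1‖) ^ 2), {θ | |θ.1| < Kc}, ?_, hKc,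
    fun θ hθ m => ?_⟩
  -- The factor in `c` is bounded on `T`, so the squared weight involves only the fourth power of `1
  -- + ‖w‖`.
  · have e : (fun θ : Param d => (C * ((1 + Kc) * (1 + ‖θ.2.1‖) ^ 2)) ^ 2) =
        fun θ => (C * (1 + Kc)) ^ 2 * (1 + ‖θ.2.1‖) ^ 4 := by funext θ; ring
    rw [e]
    exact hP.integrable_weight.const_mul _
  · have hθ' : |θ.1| < Kc := hθ
    set t : ℝ := (1 + |θ.1|) * (1 + ‖θ.2.1‖) ^ 2
    have ht0 : 0 ≤ t := by positivity
    have hts : t ≤ (1 + Kc) * (1 + ‖θ.2.1‖) ^ 2 :=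
      mul_le_mul_of_nonneg_right (by linarith) (by positivity)
    have key : ∀ D, 0 ≤ D → D ≤ C → ∀ {r : ℝ}, r ≤ D * t → r ≤ C * ((1 + Kc) * (1 + ‖θ.2.1‖) ^ 2) :=
      fun D hD hDC r hr => hr.trans (mul_le_mul hDC hts ht0 (hD.trans hDC))
    refine ⟨key C₁ h10 (by linarith) (h1 m θ), key (‖L‖ * C₁) p1 (by linarith) ?_,
      fun x hx => ⟨key C₂ h20 (by linarith) ?_, key (N * (K * C₂)) p2 (by linarith) ?_⟩⟩
    · refine (L.le_opNorm _).trans ?_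
      rw [mul_assoc]
      exact mul_le_mul_of_nonneg_left (h1 m θ) (norm_nonneg _)
    · have := h2 m (idx0 d 2) θ x hx
      rwa [partialD_idx0] at this
    · refine (Finset.abs_sum_le_sum_abs _ _).trans ((Finset.sum_le_card_nsmul _ _
        (K * (C₂ * t)) fun α _ => ?_).trans (le_of_eq ?_))
      · rw [abs_mul]
        exact mul_le_mul (hK α x) (h2 m α θ x hx) (abs_nonneg _) hK0
      · rw [nsmul_eq_mul, Finset.card_univ]
        ring

theorem measurable_opClassical_dunit (hm : ∀ α, Measurable (a' α)) (hη : ContDiff ℝ 3 η)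
    (hσ : ContDiff ℝ 4 σ) (m : Dir d) :
    Measurable fun p : Param d × Sp d => opClassical a' (dunit η σ m p.1) p.2 :=
  Finset.measurable_fun_sum _ fun α _ => ((hm α).comp measurable_snd).mul
    (contDiff_partialD (contDiff_dunit hη hσ m) α).continuous.measurable

theorem opCLM_unitJet (h : HasDensity Ω μ ρ) (hΩ : IsOpen Ω) (hΩb : Bornology.IsBounded Ω)
    (hη : ContDiff ℝ 3 η) (hσ : ContDiff ℝ 4 σ)
    (hL : ∀ u : Jet 2 μ, (L u : Sp d → ℝ) =ᵐ[μ] opWeak a' u) (m : Dir d) (θ : Param d) :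
    (L (unitJet μ η σ m θ) : Sp d → ℝ) =ᵐ[μ] opClassical a' (dunit η σ m θ) :=
  (hL _).trans (opWeak_classicalJet h hΩ hΩb (contDiff_dunit_right hη hσ m θ))

theorem kernelU_eq (hη : ContDiff ℝ 3 η) (hσ : ContDiff ℝ 4 σ) {x : Sp d}
    (hx : ∀ f : Sp d → ℝ, ContDiff ℝ 2 f → opClassical a f x = opClassical a' f x) (y : Sp d) :
    kernelU a η σ P x y =
      ∫ θ, ∑ m, opClassical a' (dunit η σ m θ) x * dunit η σ m θ y ∂P := by
  refine integral_congr_ae (Eventually.of_forall fun θ => ?_)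
  simp only [gradDot_eq]
  refine Finset.sum_congr rfl fun m _ => ?_
  rw [fderiv_opClassical_unit a hη hσ, fderiv_unit (hσ.differentiable (by norm_num)),
    hx _ (contDiff_dunit_right hη hσ m θ)]

/-- The operator `h ↦ 𝔼 [⟪𝒜 ∇N, h⟫ ∇N]`, where `N` is a hidden unit, is the integral
operator `𝒰`. -/
theorem exists_network_operator (h : HasDensity Ω μ ρ) (hΩ : IsOpen Ω)
    (hΩb : Bornology.IsBounded Ω) (hη : ContDiff ℝ 3 η) (hσ : IsCb 4 σ) (hP : IsInitialLaw P)
    (hm : ∀ α, Measurable (a' α)) {K : ℝ} (hK0 : 0 ≤ K) (hK : ∀ α x, |a' α x| ≤ K)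
    (ha : ∀ᵐ x ∂μ, ∀ f : Sp d → ℝ, ContDiff ℝ 2 f → opClassical a f x = opClassical a' f x)
    (hL : ∀ u : Jet 2 μ, (L u : Sp d → ℝ) =ᵐ[μ] opWeak a' u) :
    ∃ W : Lp ℝ 2 μ →L[ℝ] Jet 2 μ, (∀ f, W f ∈ sobolev 2 Ω μ) ∧
      (∀ f g : Lp ℝ 2 μ, Integrable (fun θ => ∑ m, ⟪L (unitJet μ η σ m θ), f⟫_ℝ *
        ⟪L (unitJet μ η σ m θ), g⟫_ℝ) P ∧ ⟪L (W f), g⟫_ℝ =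
          ∫ θ, ∑ m, ⟪L (unitJet μ η σ m θ), f⟫_ℝ * ⟪L (unitJet μ η σ m θ), g⟫_ℝ ∂P) ∧
      ∀ f g : Lp ℝ 2 μ, ⟪g, (W f).fn⟫_ℝ = ∫ y, g y * opU μ a η σ P f y ∂μ := by
  have := hP.prob
  have := h.isFiniteMeasure hΩb
  obtain ⟨B, T, hB, hT, hBT⟩ := exists_weight h hΩ hΩb hη hσ hP hK0 hK L
  have hJ : ∀ m, Continuous (unitJet μ η σ m) := fun m =>
    continuous_classicalJet_dunit h hΩ hΩb hη hσ.1 m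
  obtain ⟨W, hW⟩ := exists_average (k := fun m θ => L (unitJet μ η σ m θ)) (J := unitJet μ η σ)
    (P := P) (fun m => (L.continuous.comp (hJ m)).aestronglyMeasurable)
    (fun m => (hJ m).aestronglyMeasurable) hB (hT.mono fun θ hθ m => (hBT θ hθ m).2.1)
    (hT.mono fun θ hθ m => (hBT θ hθ m).1)
  -- Continuous functionals commute with the jet-valued integral. The three claims come from three
  -- choices: weak derivative identities, the pairing after `L`, and the pairing with the underlying
  -- function.
  have hcomm : ∀ (l : Jet 2 μ →L[ℝ] ℝ) (f : Lp ℝ 2 μ),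
      Integrable (fun θ => ∑ m, ⟪L (unitJet μ η σ m θ), f⟫_ℝ * l (unitJet μ η σ m θ)) P ∧
      l (W f) = ∫ θ, ∑ m, ⟪L (unitJet μ η σ m θ), f⟫_ℝ * l (unitJet μ η σ m θ) ∂P := fun l f => by
    have e : ∀ θ, l (∑ m, ⟪L (unitJet μ η σ m θ), f⟫_ℝ • unitJet μ η σ m θ) =
        ∑ m, ⟪L (unitJet μ η σ m θ), f⟫_ℝ * l (unitJet μ η σ m θ) := fun θ => by
      rw [map_sum]
      simp only [map_smul, smul_eq_mul]
    have h1 := l.integrable_comp (hW f).1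
    have h2 := l.integral_comp_comm (hW f).1
    simp only [e] at h1 h2
    exact ⟨h1, by rw [(hW f).2, h2]⟩
  refine ⟨W, fun f α φ hφ => ?_, fun f g => ?_, fun f g => ?_⟩
  · obtain ⟨l, hl⟩ := h.exists_weak_functional α hφ
    refine sub_eq_zero.1 ((hl (W f)).symm.trans ?_)
    have hz : ∀ m θ, l (unitJet μ η σ m θ) = 0 := fun m θ => by
      rw [hl, sub_eq_zero]
      exact classicalJet_mem h hΩ hΩb (contDiff_dunit_right hη hσ.1 m θ) α φ hφ
    rw [(hcomm l f).2]
    simp [hz]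
  · have := hcomm ((innerSL ℝ g).comp L) f
    have e : ∀ u, ((innerSL ℝ g).comp L) u = ⟪L u, g⟫_ℝ := fun u =>
      (real_inner_comm (L u) g : ⟪g, L u⟫_ℝ = _)
    simp only [e] at this
    exact this
  · have e := (hcomm ((innerSL ℝ g).comp (jetProj μ (idx0 d 2))) f).2
    have e1 : ∀ u, ((innerSL ℝ g).comp (jetProj μ (idx0 d 2))) u = ⟪g, u.fn⟫_ℝ := fun u => rfl
    simp only [e1] at e
    have hint : ∀ q : Lp ℝ 2 μ, Integrable (q : Sp d → ℝ) μ := fun q =>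
      (Lp.memLp q).integrable (by norm_num)
    have e2 : ∀ m θ, ⟪L (unitJet μ η σ m θ), f⟫_ℝ =
        ∫ x, f x * opClassical a' (dunit η σ m θ) x ∂μ := fun m θ => by
      rw [L2.inner_def]
      refine integral_congr_ae ?_
      filter_upwards [opCLM_unitJet h hΩ hΩb hη hσ.1 hL m θ] with x hx
      rw [hx]; rfl
    have e3 : ∀ m θ, ⟪g, (unitJet μ η σ m θ).fn⟫_ℝ = ∫ y, g y * dunit η σ m θ y ∂μ := fun m θ => by
      rw [real_inner_comm, L2.inner_def]
      refine integral_congr_ae ?_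
      filter_upwards [classicalJet_coe h hΩ hΩb (contDiff_dunit_right hη hσ.1 m θ) (idx0 d 2)]
        with x hx
      have hx' : ((unitJet μ η σ m θ).fn : Sp d → ℝ) x = dunit η σ m θ x :=
        hx.trans (by simp only [partialD_idx0])
      rw [hx']; rfl
    have hU : ∀ y, opU μ a η σ P f y = ∫ x, f x *
        ∫ θ, ∑ m, opClassical a' (dunit η σ m θ) x * dunit η σ m θ y ∂P ∂μ := fun y => by
      refine integral_congr_ae ?_
      filter_upwards [ha] with x hx
      rw [kernelU_eq hη hσ.1 hx]
    simp only [hU]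
    -- Fubini identifies the function part of the average with the integral operator whose kernel is
    -- the averaged product of gradients.
    rw [e, integral_mul_integral_average (O := Ω) (B := B) (T := T)
      (φ := fun m p => opClassical a' (dunit η σ m p.1) p.2) (ψ := fun m p => dunit η σ m p.1 p.2)
      (fun m => measurable_opClassical_dunit hm hη hσ.1 m)
      (fun m => (contDiff_dunit hη hσ.1 m).continuous.measurable) (hint f) (hint g) hB hT
      (h.ae_mem hΩ.measurableSet) (fun θ hθ x hx m => ((hBT θ hθ m).2.2 x hx).2)
      (fun θ hθ x hx m => ((hBT θ hθ m).2.2 x hx).1)]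
    simp only [e2, e3]

end NetworkOperator

/-! ### Differences of Sobolev jets -/

section Subtraction

variable {d : ℕ} {Ω : Set (Sp d)} {μ : Measure (Sp d)} {ρ : Sp d → ℝ≥0} {p : ℕ}

theorem HasDensity.sub_mem_sobolev (h : HasDensity Ω μ ρ) {u v : Jet p μ}
    (hu : u ∈ sobolev p Ω μ) (hv : v ∈ sobolev p Ω μ) : u - v ∈ sobolev p Ω μ := by
  intro α φ hφ
  obtain ⟨l, hl⟩ := h.exists_weak_functional α hφ
  have h1 : l u = 0 := (hl u).trans (sub_eq_zero.2 (hu α φ hφ))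
  have h2 : l v = 0 := (hl v).trans (sub_eq_zero.2 (hv α φ hφ))
  refine sub_eq_zero.1 ((hl (u - v)).symm.trans ?_)
  rw [map_sub, h1, h2, sub_zero]

theorem partialD_sub (α : Idx d p) {f g : Sp d → ℝ} (hf : ContDiff ℝ p f) (hg : ContDiff ℝ p g)
    (x : Sp d) : partialD α (f - g) x = partialD α f x - partialD α g x := by
  have hα : ((α.1 : ℕ) : WithTop ℕ∞) ≤ p := by exact_mod_cast Nat.lt_succ_iff.1 α.1.2
  rw [partialD, iteratedFDeriv_sub_apply (hf.of_le hα).contDiffAt (hg.of_le hα).contDiffAt]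
  rfl

theorem IsTestFunction.sub {φ ψ : Sp d → ℝ} (hφ : IsTestFunction Ω φ) (hψ : IsTestFunction Ω ψ) :
    IsTestFunction Ω (φ - ψ) :=
  ⟨hφ.1.sub hψ.1, hφ.2.1.sub hψ.2.1,
    (tsupport_sub φ ψ).trans (Set.union_subset hφ.2.2 hψ.2.2)⟩

theorem sub_mem_sobolevOneZero {u v : Jet 1 μ} (hu : u ∈ sobolevOneZero Ω μ)
    (hv : v ∈ sobolevOneZero Ω μ) : u - v ∈ sobolevOneZero Ω μ := by
  refine map_mem_closure₂ continuous_sub hu hv ?_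
  rintro u ⟨φ, hφ, hu⟩ v ⟨ψ, hψ, hv⟩
  refine ⟨φ - ψ, hφ.sub hψ, fun α => ?_⟩
  filter_upwards [hu α, hv α, Lp.coeFn_sub (u α) (v α)] with x h1 h2 h3
  rw [partialD_sub α (hφ.1.of_le (natCast_le_infty 1)) (hψ.1.of_le (natCast_le_infty 1)),
    ← h1, ← h2]
  exact h3

theorem HasDensity.sub_mem_sobolevZero (h : HasDensity Ω μ ρ) {u v : Jet 2 μ}
    (hu : u ∈ sobolevZero Ω μ) (hv : v ∈ sobolevZero Ω μ) : u - v ∈ sobolevZero Ω μ :=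
  ⟨h.sub_mem_sobolev hu.1 hv.1, sub_mem_sobolevOneZero hu.2 hv.2⟩

end Subtraction

/-! ### Orthogonality to all hidden units -/

section Injectivity

variable {d : ℕ} {Ω : Set (Sp d)} {μ : Measure (Sp d)} {ρ : Sp d → ℝ≥0} {η : Sp d → ℝ} {σ : ℝ → ℝ}
  {a a' : Coeff d} {P : Measure (Param d)} {L : Jet 2 μ →L[ℝ] Lp ℝ 2 μ}

/-- A continuous function of `(w, b)` that vanishes almost surely vanishes identically. -/
theorem IsInitialLaw.eq_zero_of_ae (hP : IsInitialLaw P) {F : Sp d × ℝ → ℝ} (hF : Continuous F)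
    (h : ∀ᵐ θ ∂P, F θ.2 = 0) (q : Sp d × ℝ) : F q = 0 := by
  by_contra hq
  have := hP.full_support {q | F q ≠ 0} (isOpen_ne_fun hF continuous_const) ⟨q, hq⟩
  exact this.ne' h

/-- A function in `L²` that is orthogonal to the images of all hidden units is orthogonal to the
image of `H²_{(0)}`. -/
theorem inner_eq_zero_of_orthogonal (h : HasDensity Ω μ ρ) (hΩ : IsOpen Ω)
    (hΩb : Bornology.IsBounded Ω) {r : ℝ≥0} (hbd : HasHolderBoundary Ω 3 r)
    (hη : IsAuxiliary Ω η) (hσ : IsCb 4 σ) (hnc : ¬ ∃ s, ∀ z, σ z = s)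
    (hm : ∀ α, Measurable (a' α)) {K : ℝ} (hK : ∀ α x, |a' α x| ≤ K)
    (hL : ∀ u : Jet 2 μ, (L u : Sp d → ℝ) =ᵐ[μ] opWeak a' u) {f : Lp ℝ 2 μ}
    (hf : ∀ q : Sp d × ℝ, ⟪L (unitJet μ η σ none (0, q)), f⟫_ℝ = 0) {u : Jet 2 μ}
    (hu : u ∈ sobolevZero Ω μ) : ⟪L u, f⟫_ℝ = 0 := by
  obtain ⟨C, hC⟩ := h.upper
  -- With the density, the coefficients and `f` absorbed into `n`, the pairing of `𝒜 v` with `f` in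
  -- `L²(μ)` is a second order functional in Lebesgue measure.
  let n : Idx d 2 → Sp d → ℝ := fun α => Ω.indicator fun x => ρ x * (a' α x * f x)
  have hmem : ∀ α, MemLp (fun x => ρ x * (a' α x * f x)) 2 μ := fun α => by
    refine (Lp.memLp f).of_le_mul (c := C * K) (h.meas.coe_nnreal_real.aestronglyMeasurable.mul
      ((hm α).aestronglyMeasurable.mul (Lp.memLp f).1)) (Eventually.of_forall fun x => ?_)
    have h1 : (ρ x : ℝ) ≤ C := by exact_mod_cast hC x
    rw [norm_mul, norm_mul, Real.norm_of_nonneg (NNReal.coe_nonneg (ρ x)), mul_assoc]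
    exact mul_le_mul h1 (mul_le_mul_of_nonneg_right (hK α x) (norm_nonneg _)) (by positivity)
      (by positivity)
  have hn : ∀ α, MemLp (n α) 2 := fun α => h.memLp_indicator hΩ.measurableSet (hmem α)
  have hn0 : ∀ α x, x ∉ Ω → n α x = 0 := fun α x hx => Set.indicator_of_notMem hx _
  have hinner : ∀ (v : Lp ℝ 2 μ) (p : Idx d 2 → Sp d → ℝ),
      (v : Sp d → ℝ) =ᵐ[μ] (fun x => ∑ α, a' α x * p α x) →
      ⟪v, f⟫_ℝ = ∫ x in Ω, ∑ α, n α x * p α x := fun v p hv => by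
    have e : ⟪v, f⟫_ℝ = ∫ x, f x * ∑ α, a' α x * p α x ∂μ := by
      rw [L2.inner_def]
      refine integral_congr_ae ?_
      filter_upwards [hv] with x hx
      rw [hx]; rfl
    rw [e, h.integral_eq]
    refine setIntegral_congr_fun hΩ.measurableSet fun x hx => ?_
    simp only [n, Set.indicator_of_mem hx, Finset.mul_sum]
    exact Finset.sum_congr rfl fun α _ => by ring
  have hη3 : ContDiff ℝ 3 η := hη.smooth.1
  obtain ⟨D, _, hD⟩ := hσ.exists_bound_iteratedDeriv
  have hann : Annihilates n η := by
    refine annihilates_of_ridge hΩ hΩb hη3 (hσ.1.of_le (by norm_num))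
      (fun k hk x => hD k (by omega) x) hnc hn hn0 fun w b => ?_
    have e1 := hinner _ (fun α => partialD α (dunit η σ none (0, w, b)))
      (opCLM_unitJet h hΩ hΩb hη3 hσ.1 hL none (0, w, b))
    rw [hf (w, b)] at e1
    -- The derivative in `c` removes the outer weight and leaves `η σ(w · x + b)` itself.
    have e2 : dunit η σ none (0, w, b) = fun x => η x * σ (⟪w, x⟫_ℝ + b) :=
      funext fun x => one_mul _
    rw [e2] at e1
    rw [← setIntegral_eq_integral_of_forall_compl_eq_zero (s := Ω), ← e1]
    intro x hx
    exact Finset.sum_eq_zero fun α _ => by rw [hn0 α x hx, zero_mul]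
  rw [hinner (L u) (fun α x => u α x) (hL u)]
  exact hann.sobolevZero h hΩ hΩb hbd hη hn hn0 hu

end Injectivity

end DGM

/-! ### Convergence of the wide-limit network -/

open DGM

theorem mainTheorem3 (d : ℕ) (hd : 1 ≤ d)
    (Ω : Set (DGM.Sp d)) (hΩ_open : IsOpen Ω) (hΩ_bdd : Bornology.IsBounded Ω)
    (r : ℝ≥0) (hr0 : 0 < r) (hr1 : r < 1) (hΩ_bdry : DGM.HasHolderBoundary Ω 3 r)
    (μ : Measure (DGM.Sp d)) (hμ : DGM.IsSamplingMeasure Ω μ)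
    (a : DGM.Coeff d) (ha_meas : ∀ α, AEStronglyMeasurable (a α) μ)
    (ha_lip : DGM.OpLipschitz Ω μ a)
    (η : DGM.Sp d → ℝ) (hη : DGM.IsAuxiliary Ω η)
    (σ : ℝ → ℝ) (hσ : DGM.IsCb 4 σ) (hσ_nonconst : ¬ ∃ s : ℝ, ∀ z, σ z = s)
    (P : Measure (DGM.Param d)) (hP : DGM.IsInitialLaw P)
    (g : Lp ℝ 2 μ)
    (hA : DGM.HasBoundedInverse Ω μ a)
    (u : DGM.Jet 2 μ) (hu : u ∈ DGM.sobolevZero Ω μ) (hu_sol : DGM.opWeak a u =ᵐ[μ] g)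
    (Q : ℝ → DGM.Jet 2 μ) (hQ : DGM.IsWideLimit Ω μ a η σ P g Q) :
    Tendsto (fun t => ‖(Q t).fn - u.fn‖) atTop (𝓝 0) := by
  have hη3 := hη.smooth.1
  obtain ⟨ρ, hρ⟩ := hμ.exists_density
  obtain ⟨a', hm, ⟨K, hK0, hK⟩, ha, ha'⟩ := exists_bounded_coeff hρ hΩ_open hΩ_bdd ha_meas ha_lip
  obtain ⟨L, hL⟩ := exists_opCLM (μ := μ) hm hK
  obtain ⟨W, hW, hLW, hU⟩ := exists_network_operator hρ hΩ_open hΩ_bdd hη3 hσ hP hm hK0 hK ha hL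
  have hLa : ∀ v ∈ sobolev 2 Ω μ, opWeak a v =ᵐ[μ] L v := fun v hv =>
    (ha' v hv).trans (hL v).symm
  obtain ⟨k, hk, hinv⟩ := hA
  have hinj : ∀ f, L (W f) = 0 → f = 0 := fun f hf => by
    -- Solvability makes `f` itself an image `L v` with `v ∈ H²_{(0)}`, so orthogonality of `f` to
    -- all such images gives `⟪f, f⟫ = 0`.
    obtain ⟨v, hv, hvf, -⟩ := hinv f
    have e : L v = f := Lp.ext ((hLa v hv.1).symm.trans hvf)
    have h0 := (hLW f f).2
    rw [hf, inner_zero_left] at h0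
    have h1 := (integral_eq_zero_iff_of_nonneg (fun θ => Finset.sum_nonneg fun m _ =>
      mul_self_nonneg _) (hLW f f).1).1 h0.symm
    -- The derivative in `c` does not depend on `c`, so `c = 0` may be inserted, giving a function
    -- of `(w, b)` alone to which full support applies.
    have hc : Continuous fun q : Sp d × ℝ => ⟪L (unitJet μ η σ none (0, q)), f⟫_ℝ :=
      (L.continuous.comp ((continuous_classicalJet_dunit hρ hΩ_open hΩ_bdd hη3 hσ.1 none).comp
        (Continuous.prodMk_right 0))).inner continuous_const
    rw [← inner_self_eq_zero (𝕜 := ℝ)]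
    nth_rewrite 1 [← e]
    refine inner_eq_zero_of_orthogonal hρ hΩ_open hΩ_bdd hΩ_bdry hη hσ hσ_nonconst hm hK hL
      (hP.eq_zero_of_ae hc ?_) hv
    filter_upwards [h1] with θ hθ
    exact mul_self_eq_zero.1
      ((Finset.sum_eq_zero_iff_of_nonneg fun m _ => mul_self_nonneg _).1 hθ none (Finset.mem_univ _))
  have hLu : L u = g := Lp.ext ((hLa u hu.1).symm.trans hu_sol)
  have hflow : Tendsto (fun t => ‖L (Q t) - g‖) atTop (𝓝 0) := by
    refine tendsto_zero_of_flow (S := L.comp W) (fun f f' => ?_) (fun f => ?_) hinj fun t ht => ?_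
    · rw [real_inner_comm (L.comp W f') f]
      refine (hLW f f').2.trans (Eq.trans ?_ (hLW f' f).2.symm)
      simp only [mul_comm]
    · refine (integral_nonneg fun θ => ?_).trans_eq (hLW f f).2.symm
      exact Finset.sum_nonneg fun m _ => mul_self_nonneg _
    · obtain ⟨V, hV, hVU, hd⟩ := hQ.ode t ht
      have hres : (fun x => opWeak a (Q t) x - g x) =ᵐ[μ] (L (Q t) - g : Lp ℝ 2 μ) := by
        filter_upwards [hLa _ (hQ.mem t ht).1, Lp.coeFn_sub (L (Q t)) g] with x h1 h2
        rw [h2, Pi.sub_apply, h1]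
      have hopU : opU μ a η σ P (fun x => opWeak a (Q t) x - g x) =
          opU μ a η σ P (L (Q t) - g : Lp ℝ 2 μ) := funext fun y => integral_congr_ae (by
        filter_upwards [hres] with x hx
        rw [hx])
      rw [hopU] at hVU
      -- The equation prescribes only the values of the velocity almost everywhere. Both jets are
      -- Sobolev jets with the same function, so they agree with all derivatives and `L` may be
      -- applied.
      have hVW : V = W (-(L (Q t) - g)) := by
        refine sobolev_eq_of_fn_eq hρ hΩ_open hV.1 (hW _) (ext_inner_left ℝ fun f => ?_)
        have e1 : ⟪f, (W (-(L (Q t) - g))).fn⟫_ℝ = -⟪f, (W (L (Q t) - g)).fn⟫_ℝ := by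
          rw [map_neg, ← inner_neg_right]; rfl
        rw [e1, hU, ← integral_neg, L2.inner_def]
        refine integral_congr_ae ?_
        filter_upwards [hVU] with y hy
        rw [hy, ← mul_neg]
        exact mul_comm _ _
      have := (L.hasFDerivAt.comp_hasDerivWithinAt t hd).sub_const g
      rw [hVW, map_neg W, map_neg L] at this
      exact this
  refine squeeze_zero' (Eventually.of_forall fun t => norm_nonneg _) ?_ (by
    simpa using hflow.const_mul k)
  filter_upwards [eventually_ge_atTop 0] with t ht
  have hmem := hρ.sub_mem_sobolevZero (hQ.mem t ht) hu
  obtain ⟨v, -, -, hle, huniq⟩ := hinv (L (Q t) - g)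
  -- Uniqueness identifies the error with the solution for the residual as right-hand side, so the
  -- bound of the inverse applies to it.
  have e : Q t - u = v := huniq _ hmem (by
    have := hLa _ hmem.1
    rwa [map_sub, hLu] at this)
  rw [← e] at hle
  exact hle
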